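/- **Setting.** Let $M$ be a manifold with corners of codimension at most $2$ and dimension $N$, with a main face $\mathrm{mf}$ (a boundary hypersurface, possibly disconnected) and other boundary hypersurfaces $H$ that are pairwise disjoint and meet $\mathrm{mf}$. Each such $H$ is the total space of a fibration $\phi_H:H\to Z_H$ over a compact manifold without boundary, with fibres transversal to $\mathrm{mf}$; on $\mathrm{mf}$ the fibration is the identity. Let $x$ be a total boundary defining function. Near a point of $\mathrm{mf}\cap H$ there are adapted coordinates $(\tilde x,x'',y',y'')$, $y'\in\mathbb R^l$, $y''\in\mathbb R^m$, $1+l+m=N-1$: $x''=0$ defines $\mathrm{mf}$, $\tilde x=x/x''=0$ defines $H$, and on $H$ the $y'$ are pulled back from coordinates on $Z_H$. Let ${}^{s\Phi}T^*M$ be the dual of the bundle whose sections are the smooth vector fields $V$ that are tangent to the boundary and to the fibres of all $\phi_H$, $\phi_{\mathrm{mf}}$, with $Vx\in x^2C^\infty(M)$. Over the corner patch its elements are written $\tau\frac{dx}{x^2}+\eta\frac{d\tilde x}{x}+\mu'\cdot\frac{dy'}{x}+\mu''\cdot\frac{dy''}{x''}$; over the interior of $\mathrm{mf}$, with coordinates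 $(x,\bar y)$, $\tau\frac{dx}{x^2}+\mu\cdot\frac{d\bar y}{x}$. The contact form on ${}^{s\Phi}T^*_{\mathrm{mf}}M$ is $\chi=d\tau+\eta\,d\tilde x+\mu'\cdot dy'+\tilde x\,\mu''\cdot dy''$, respectively $d\tau+\mu\cdot d\bar y$. Over $\mathrm{mf}\cap H$ let $\tilde\phi_H$ be the map $(y',y'',\tau,\eta,\mu',\mu'')\mapsto(y',\tau,\mu')$ into the bundle ${}^{s\Phi}N^*Z_H$ over $Z_H$ (the scattering cotangent bundle of $Z_H\times[0,\epsilon)_x$ over $x=0$), which has the contact form $d\tau+\mu'\cdot dy'$; its fibres, with coordinates $(y'',\tau''=-\eta,\mu'')$, carry the contact form $d\tau''+\mu''\cdot dy''$. A *Legendre submanifold* $G$ of ${}^{s\Phi}T^*M$ is an embedded submanifold of ${}^{s\Phi}T^*_{\mathrm{mf}}M$ of dimension $N-1$ on which $\chi$ vanishes, transversal to ${}^{s\Phi}T^*_{\mathrm{mf}\cap H}M$ for each $H\ne\mathrm{mf}$, such that $\tilde\phi_H$ induces a surjective submersion of $G\cap{}^{s\Phi}T^*_{\mathrm{mf}\cap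 H}M$ onto a Legendre submanifold $G_1$ of ${}^{s\Phi}N^*Z_H$ with Legendre submanifolds as fibres. A *Legendre pair with conic points* $(G,G^\sharp)$ consists of two Legendre submanifolds of ${}^{s\Phi}T^*M$ such that: $G^\sharp$ is a section over $\mathrm{mf}$, locally the graph of $d(\phi_0/x)$ with $\phi_0$ smooth, of the form $\phi_0=\phi_1(y')+\tilde x\phi_2(\tilde x,y',y'')$ near $\mathrm{mf}\cap H$; $\mathrm{cl}(G)\setminus G\subset G^\sharp$; the lift $\hat G$ of $G$ to the space obtained by blowing up $G^\sharp$ together with the direction $dx/x^2$ is, near the front face over $G^\sharp$, a smooth submanifold of dimension $N-1$ transversal to the front face, and near $\mathrm{mf}\cap H$ also to $\tilde x=0$ (smoothly up to the corner); for each $H$, $G$ and $G^\sharp$ have the same base $G_1$, and the fibres over it form pairs with conic points in the same sense. In polar coordinates near the corner a point of the blown-up space is $(\tilde x,y',y'',\tau,r,\omega)$, $r\ge0$, $|\omega|=1$, and blows down to $(\eta,\mu',\mu'')=(\partial_{\tilde x}\phi_0,\partial_{y'}\phi_0,\partial_{y''}\phi_2)+r\omega$. Write $\partial\hat G$ for the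 part of $\hat G$ in $r=0$ over $G^\sharp$. **Statement.** Let adapted coordinates near a point of $\mathrm{mf}\cap H$ be given. (1) Let $G$ be a Legendre submanifold of ${}^{s\Phi}T^*M$ and $q\in G\cap{}^{s\Phi}T^*_{\mathrm{mf}\cap H}M$ a point over the patch, with base point $(0,y_0',y_0'')$. Then there are $k,k'\ge0$, points $v_0\in\mathbb R^k$, $w_0\in\mathbb R^{k'}$ and a function $$\phi=\phi_1(y',v)+\tilde x\,\phi_2(\tilde x,y',y'',v,w),$$ with $\phi_1,\phi_2$ smooth near $(y_0',v_0)$ and $q'=(0,y_0',y_0'',v_0,w_0)$, such that: $d_v\phi=0$ and $d_w\phi_2=0$ at $q'$, and $d_{(x,\tilde x,y',y'')}(\phi/x)$ at $q'$ is $q$; the differentials $d_{(y',v)}\frac{\partial\phi_1}{\partial v_j}$, $1\le j\le k$, are independent at $(y_0',v_0)$, and the $d_{(y'',w)}\frac{\partial\phi_2}{\partial w_{j}}$, $1\le j\le k'$, are independent at $q'$; and near $q$ $$G=\{(\tilde x,y',y'',d_{(x,\tilde x,y',y'')}(\phi/x)):\ \tilde x\ge0,\ d_v\phi=0,\ d_w\phi_2=0\},$$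 with $(\tilde x,y',y'',v,w)$ in a neighbourhood of $q'$. Here $d(\phi/x)$ has the coordinates $\tau=-\phi$, $\eta=\partial_{\tilde x}\phi$, $\mu'=\partial_{y'}\phi$, $\mu''=\partial_{y''}\phi_2$. (2) Let $(G,G^\sharp)$ be a Legendre pair with conic points in ${}^{s\Phi}T^*M$ and $q\in\partial\hat G$ a point over $\mathrm{mf}\cap H$ and over the patch, with base point $(0,y_0',y_0'')$. Then there are $k\ge0$, $w_0\in\mathbb R^k$ and a function $$\phi=\phi_1(y')+\tilde x\,\phi_2(\tilde x,y',y'')+s\,\tilde x\,\psi(\tilde x,y',y'',s,w),$$ with $\phi_1,\phi_2,\psi$ smooth near $y_0'$, $(0,y_0',y_0'')$ and $q'=(0,y_0',y_0'',0,w_0)$, such that: $(\phi_1+\tilde x\phi_2)/x$ parametrizes $G^\sharp$ near the base point of $q$; $\psi=0$ and $d_w\psi=0$ at $q'$; $d_{(y'',w)}\psi$ and $d_{(y'',w)}\frac{\partial\psi}{\partial w_j}$, $1\le j\le k$, are independent at $q'$; and, with $D=(\psi+\tilde x\,\partial_{\tilde x}\psi,\ \tilde x\,\partial_{y'}\psi,\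 \partial_{y''}\psi)$ and $\Lambda=(\tilde x,y',y'',\,-\phi,\,s|D|,\,D/|D|)$ (the lift of $d(\phi/x)$), $q=\Lambda(q')$ and near $q$ $$\hat G=\{\Lambda(\tilde x,y',y'',s,w):\ \tilde x\ge0,\ s\ge0,\ \psi+s\,\partial_s\psi=0,\ d_w\psi=0\},$$ with $(\tilde x,y',y'',s,w)$ in a neighbourhood of $q'$. -/

import Mathlib

open scoped Manifold ContDiff Topology InnerProductSpace

universe u v

noncomputable section

namespace FibredScattering

/-- Euclidean space of dimension `n`. -/
abbrev EE (n : ℕ) := EuclideanSpace ℝ (Fin n)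

/-! ### Submanifolds of a half-space or a quadrant -/

/-- `S` is, near its point `a`, an embedded smooth submanifold of the domain
`{z | 0 ≤ f z for all f in faces}`, transversal to the faces `{f = 0}` (and to their intersections),
with tangent space `T` at `a`. As usual on a manifold with corners, smooth functions are
restrictions of smooth functions on open sets of the ambient space. -/
def IsSubmanifoldAt {E : Type*} [NormedAddCommGroup E] [NormedSpace ℝ E]
    (faces : List (E →L[ℝ] ℝ)) (S : Set E) (a : E) (T : Submodule ℝ E) : Prop :=
  ∃ (c : ℕ) (F : E → Fin c → ℝ) (U : Set E), IsOpen U ∧ a ∈ U ∧ ContDiffOn ℝ ∞ F U ∧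
    (∀ z ∈ U, z ∈ S ↔ (∀ f ∈ faces, 0 ≤ f z) ∧ F z = 0) ∧
    (∀ t : Fin c → ℝ, ∃ v : E, (∀ f ∈ faces, f a = 0 → f v = 0) ∧ fderiv ℝ F a v = t) ∧
    T = LinearMap.ker (fderiv ℝ F a).toLinearMap

/-! ### Blow-ups

Points of a rescaled cotangent bundle over a coordinate patch are written `(b, τ, ζ)`: base point,
coefficient of `dx/x²`, remaining coefficients. A section `Γs` is blown up together with the
direction `dx/x²`: the blown-up space has the polar coordinates `(b, τ, r, ω)`, `r ≥ 0`, `|ω| = 1`,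
the blow-down map being `(b, τ, r, ω) ↦ (b, τ, ζ₀ b + r ω)` where `ζ₀ b` is the `ζ`-component of `Γs`
over `b`. -/

/-- The lift to the blown-up space of the part of `Γ` away from the centre. -/
def blowupLift {B C : Type*} [AddCommGroup C] [Module ℝ C] (nrm : C → ℝ)
    (Γ Γs : Set (B × ℝ × C)) : Set (B × ℝ × ℝ × C) :=
  {z | 0 < z.2.2.1 ∧ nrm z.2.2.2 = 1 ∧
    ∃ (τ₀ : ℝ) (ζ₀ : C), (z.1, τ₀, ζ₀) ∈ Γs ∧ (z.1, z.2.1, ζ₀ + z.2.2.1 • z.2.2.2) ∈ Γ}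

/-- The boundary of the lift: its limit points on the front face, over `Γs`. -/
def liftBoundary {B C : Type*} [TopologicalSpace B] [TopologicalSpace C] [AddCommGroup C]
    [Module ℝ C] (nrm : C → ℝ) (Γ Γs : Set (B × ℝ × C)) : Set (B × ℝ × ℝ × C) :=
  {z | z ∈ closure (blowupLift nrm Γ Γs) ∧ z.2.2.1 = 0 ∧ ∃ ζ₀ : C, (z.1, z.2.1, ζ₀) ∈ Γs}

/-- The desingularized set (lift of `Γ` to the blow-up of `Γs`). -/
def hat {B C : Type*} [TopologicalSpace B] [TopologicalSpace C] [AddCommGroup C]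
    [Module ℝ C] (nrm : C → ℝ) (Γ Γs : Set (B × ℝ × C)) : Set (B × ℝ × ℝ × C) :=
  blowupLift nrm Γ Γs ∪ liftBoundary nrm Γ Γs

/-- The function `r` on the blown-up space. -/
def radius (B C : Type*) [NormedAddCommGroup B] [NormedSpace ℝ B] [NormedAddCommGroup C]
    [NormedSpace ℝ C] : (B × ℝ × ℝ × C) →L[ℝ] ℝ :=
  (ContinuousLinearMap.fst ℝ ℝ C).comp
    ((ContinuousLinearMap.snd ℝ ℝ (ℝ × C)).comp (ContinuousLinearMap.snd ℝ B (ℝ × ℝ × C)))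

/-! ### Scattering cotangent bundle over the boundary, in local coordinates -/

/-- Coordinates `(y, τ, μ)` of the covector `τ dx/x² + μ·dy/x` over a boundary of dimension `n`. -/
abbrev ScPt (n : ℕ) := EE n × ℝ × EE n

/-- Legendre submanifold: dimension `n`, annihilated by the contact form `dτ + μ·dy`. -/
def IsScLegendre {n : ℕ} (Γ : Set (ScPt n)) : Prop :=
  ∀ a ∈ Γ, ∃ T : Submodule ℝ (ScPt n), IsSubmanifoldAt [] Γ a T ∧ Module.finrank ℝ T = n ∧
    ∀ v ∈ T, v.2.1 + ⟪a.2.2, v.1⟫_ℝ = 0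

/-- `Γs` is, over the open set `Y`, the graph of `d(f/x)` with `f` smooth. -/
def IsScGraph {n : ℕ} (Y : Set (EE n)) (Γs : Set (ScPt n)) : Prop :=
  ∀ y₀ ∈ Y, ∃ (W : Set (EE n)) (f : EE n → ℝ), IsOpen W ∧ y₀ ∈ W ∧ ContDiffOn ℝ ∞ f W ∧
    ∀ y ∈ W, ∀ (τ : ℝ) (μ : EE n), (y, τ, μ) ∈ Γs ↔ τ = -f y ∧ μ = gradient f y

/-- Intersecting pair of Legendre submanifolds with conic points, over the coordinate patch `Y`. -/
def IsScConicPair {n : ℕ} (Y : Set (EE n)) (Γ Γs : Set (ScPt n)) : Prop :=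
  IsScLegendre Γ ∧ IsScGraph Y Γs ∧
  (∀ a ∈ closure Γ, a.1 ∈ Y → a ∈ Γ ∪ Γs) ∧
  ∀ z ∈ liftBoundary (norm : EE n → ℝ) Γ Γs, ∃ T : Submodule ℝ (EE n × ℝ × ℝ × EE n),
    IsSubmanifoldAt [radius (EE n) (EE n)] (hat norm Γ Γs) z T ∧ Module.finrank ℝ T = n

/-! ### Fibred-scattering cotangent bundle over the main face near a corner, in local coordinates -/

/-- Base coordinates `(xt, y', y'')` on the main face, or cotangent coordinates `(η, μ', μ'')`. -/
abbrev Corner (l m : ℕ) := ℝ × EE l × EE m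

/-- Coordinates `((xt, y', y''), τ, (η, μ', μ''))` of the covector
`τ dx/x² + η dxt/x + μ'·dy'/x + μ''·dy''/x''`. -/
abbrev CornerPt (l m : ℕ) := Corner l m × ℝ × Corner l m

/-- Coordinates `((xt, y', y''), τ, r, ω)` on the blown-up space. -/
abbrev CornerBl (l m : ℕ) := Corner l m × ℝ × ℝ × Corner l m

/-- Euclidean length of `(η, μ', μ'')`. -/
def cnorm {l m : ℕ} (ζ : Corner l m) : ℝ := √(ζ.1 ^ 2 + ‖ζ.2.1‖ ^ 2 + ‖ζ.2.2‖ ^ 2)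

/-- The contact form `dτ + η dxt + μ'·dy' + xt μ''·dy''` at `a`, applied to `v`. -/
def cornerContact {l m : ℕ} (a v : CornerPt l m) : ℝ :=
  v.2.1 + a.2.2.1 * v.1.1 + ⟪a.2.2.2.1, v.1.2.1⟫_ℝ + a.1.1 * ⟪a.2.2.2.2, v.1.2.2⟫_ℝ

/-- The function `xt` on `Corner l m × F`. -/
def xtFun (l m : ℕ) (F : Type*) [NormedAddCommGroup F] [NormedSpace ℝ F] :
    (Corner l m × F) →L[ℝ] ℝ :=
  (ContinuousLinearMap.fst ℝ ℝ (EE l × EE m)).comp (ContinuousLinearMap.fst ℝ (Corner l m) F)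

/-- `T` is the tangent space at `a` of the Legendre submanifold `Γ` (of dimension `l + m + 1`),
which is transversal to `xt = 0`. -/
def IsCornerLegendreAt {l m : ℕ} (Γ : Set (CornerPt l m)) (a : CornerPt l m)
    (T : Submodule ℝ (CornerPt l m)) : Prop :=
  IsSubmanifoldAt [xtFun l m (ℝ × Corner l m)] Γ a T ∧ Module.finrank ℝ T = l + m + 1 ∧
    ∀ v ∈ T, cornerContact a v = 0

/-- The map `(y', y'', τ, η, μ', μ'') ↦ (y', τ, μ')`. -/
def baseProj {l m : ℕ} (a : CornerPt l m) : ScPt l := (a.1.2.1, a.2.1, a.2.2.2.1)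

/-- The fibre over `b = (y', τ, μ')` of `Γ ∩ {xt = 0}`, in the coordinates
`(y'', τ'', μ'')`, `τ'' = -η`, of the scattering cotangent bundle of the fibre of the face. -/
def fibreOver {l m : ℕ} (Γ : Set (CornerPt l m)) (b : ScPt l) : Set (ScPt m) :=
  {c | ((0, b.1, c.1), b.2.1, (-c.2.1, b.2.2, c.2.2)) ∈ Γ}

/-- In coordinates: `baseProj` induces a submersion of `Γ ∩ {xt = 0}` into `Γ₁`, with Legendre
fibres. -/
def IsCornerFibred {l m : ℕ} (Γ : Set (CornerPt l m)) (Γ₁ : Set (ScPt l)) : Prop :=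
  (∀ a ∈ Γ, a.1.1 = 0 → baseProj a ∈ Γ₁ ∧
    ∃ (T : Submodule ℝ (CornerPt l m)) (T₁ : Submodule ℝ (ScPt l)),
      IsCornerLegendreAt Γ a T ∧ IsSubmanifoldAt [] Γ₁ (baseProj a) T₁ ∧
      ∀ u ∈ T₁, ∃ v ∈ T, v.1.1 = 0 ∧ baseProj v = u) ∧
  ∀ b ∈ Γ₁, IsScLegendre (fibreOver Γ b)

/-- The coordinates of `d(f/x)` for `f = f₁(y') + xt f₂(xt, y', y'')`:
`τ = -f`, `η = ∂f/∂xt`, `μ' = ∂f/∂y'`, `μ'' = ∂f₂/∂y''`. -/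
def cornerDiff {l m : ℕ} (f₁ : EE l → ℝ) (f₂ : ℝ → EE l → EE m → ℝ)
    (xt : ℝ) (y' : EE l) (y'' : EE m) : CornerPt l m :=
  ((xt, y', y''), -(f₁ y' + xt * f₂ xt y' y''),
    (deriv (fun t => f₁ y' + t * f₂ t y' y'') xt,
      gradient (fun z => f₁ z + xt * f₂ xt z y'') y',
      gradient (fun z => f₂ xt y' z) y''))

/-- Over the set `W ∩ {xt ≥ 0}`, `Γs` is the graph of `d(f/x)`, `f = f₁(y') + xt f₂(xt, y', y'')`,
with `f₁`, `f₂` smooth on the open sets `W₁` and `W`. -/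
def IsCornerGraphOn {l m : ℕ} (Γs : Set (CornerPt l m)) (W₁ : Set (EE l)) (W : Set (Corner l m))
    (f₁ : EE l → ℝ) (f₂ : ℝ → EE l → EE m → ℝ) : Prop :=
  IsOpen W₁ ∧ IsOpen W ∧ (∀ b ∈ W, b.2.1 ∈ W₁) ∧ ContDiffOn ℝ ∞ f₁ W₁ ∧
  ContDiffOn ℝ ∞ (fun b : Corner l m => f₂ b.1 b.2.1 b.2.2) W ∧
  ∀ b ∈ W, 0 ≤ b.1 → ∀ (τ : ℝ) (ζ : Corner l m),
    (b, τ, ζ) ∈ Γs ↔ (b, τ, ζ) = cornerDiff f₁ f₂ b.1 b.2.1 b.2.2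

/-- Conic points, uniformly up to `xt = 0`, over the coordinate patch `Y ⊆ {xt ≥ 0}`: the section
`Γs` is smooth, `Γ` accumulates only on `Γs`, and its lift to the blow-up is near the front face a
smooth submanifold transversal to the front face and to `xt = 0`. -/
def IsCornerConic {l m : ℕ} (Y : Set (Corner l m)) (Γ Γs : Set (CornerPt l m)) : Prop :=
  (∀ b ∈ Y, ∃ W₁ W f₁ f₂, b ∈ W ∧ IsCornerGraphOn Γs W₁ W f₁ f₂) ∧
  (∀ a ∈ closure Γ, a.1 ∈ Y → a ∈ Γ ∪ Γs) ∧
  ∀ z ∈ liftBoundary cnorm Γ Γs, ∃ T : Submodule ℝ (CornerBl l m),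
    IsSubmanifoldAt [xtFun l m (ℝ × ℝ × Corner l m), radius (Corner l m) (Corner l m)]
      (hat cnorm Γ Γs) z T ∧ Module.finrank ℝ T = l + m + 1

/-! ### Non-degenerate parametrizations -/

/-- `φ/x`, `φ = φ₁(y', v) + xt φ₂(xt, y', y'', v, w)`, is a non-degenerate parametrization of `Γ`
near `q` (a point with `xt = 0`), the base point being `q' = (0, y'₀, y''₀, v₀, w₀)`. -/
def IsParametrization {l m k k' : ℕ} (Γ : Set (CornerPt l m)) (q : CornerPt l m)
    (φ₁ : EE l → EE k → ℝ) (φ₂ : ℝ → EE l → EE m → EE k → EE k' → ℝ)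
    (v₀ : EE k) (w₀ : EE k') : Prop :=
  ∃ (U₁ : Set (EE l × EE k)) (U : Set (ℝ × EE l × EE m × EE k × EE k')),
    IsOpen U₁ ∧ IsOpen U ∧ (q.1.2.1, v₀) ∈ U₁ ∧ (0, q.1.2.1, q.1.2.2, v₀, w₀) ∈ U ∧
    (∀ z ∈ U, (z.2.1, z.2.2.2.1) ∈ U₁) ∧
    ContDiffOn ℝ ∞ (fun z : EE l × EE k => φ₁ z.1 z.2) U₁ ∧
    ContDiffOn ℝ ∞ (fun z : ℝ × EE l × EE m × EE k × EE k' =>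
      φ₂ z.1 z.2.1 z.2.2.1 z.2.2.2.1 z.2.2.2.2) U ∧
    -- `q'` is critical and is mapped to `q`
    q = cornerDiff (fun y' => φ₁ y' v₀) (fun t y' y'' => φ₂ t y' y'' v₀ w₀) 0 q.1.2.1 q.1.2.2 ∧
    gradient (fun v => φ₁ q.1.2.1 v) v₀ = 0 ∧
    gradient (fun w => φ₂ 0 q.1.2.1 q.1.2.2 v₀ w) w₀ = 0 ∧
    -- non-degeneracy
    LinearIndependent ℝ (fun j : Fin k =>
      fderiv ℝ (fun z : EE l × EE k => gradient (fun v => φ₁ z.1 v) z.2 j) (q.1.2.1, v₀)) ∧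
    LinearIndependent ℝ (fun j : Fin k' =>
      fderiv ℝ (fun z : EE m × EE k' => gradient (fun w => φ₂ 0 q.1.2.1 z.1 v₀ w) z.2 j)
        (q.1.2.2, w₀)) ∧
    -- near `q`, `Γ` is the image of the critical set
    ∃ O : Set (CornerPt l m), IsOpen O ∧ q ∈ O ∧ ∀ a ∈ O, a ∈ Γ ↔
      ∃ (xt : ℝ) (y' : EE l) (y'' : EE m) (v : EE k) (w : EE k'),
        (xt, y', y'', v, w) ∈ U ∧ 0 ≤ xt ∧
        gradient (fun v => φ₁ y' v + xt * φ₂ xt y' y'' v w) v = 0 ∧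
        gradient (fun w => φ₂ xt y' y'' v w) w = 0 ∧
        a = cornerDiff (fun y' => φ₁ y' v) (fun t y' y'' => φ₂ t y' y'' v w) xt y' y''

/-- The coefficients of `dxt/x`, `dy'/x`, `dy''/x''` in `d(xt g / x)`, for
`g = g(xt, y', y'')`. -/
def coneDir {l m : ℕ} (g : ℝ → EE l → EE m → ℝ) (xt : ℝ) (y' : EE l) (y'' : EE m) : Corner l m :=
  (g xt y' y'' + xt * deriv (fun t => g t y' y'') xt,
    xt • gradient (fun z => g xt z y'') y', gradient (fun z => g xt y' z) y'')

/-- The lift to the blow-up (along the graph of `d((φ₁ + xt φ₂)/x)`) of `d(φ/x)`, where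
`φ = φ₁ + xt φ₂ + s xt g`: the covector `d(φ/x)` differs from the centre by `s` times `coneDir g`,
up to a multiple of `dx/x²`. -/
def conicPoint {l m : ℕ} (φ₁ : EE l → ℝ) (φ₂ : ℝ → EE l → EE m → ℝ) (g : ℝ → EE l → EE m → ℝ)
    (xt : ℝ) (y' : EE l) (y'' : EE m) (s : ℝ) : CornerBl l m :=
  ((xt, y', y''), -(φ₁ y' + xt * φ₂ xt y' y'' + s * xt * g xt y' y''),
    s * cnorm (coneDir g xt y' y''), (cnorm (coneDir g xt y' y''))⁻¹ • coneDir g xt y' y'')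

/-- `φ/x`, `φ = φ₁(y') + xt φ₂(xt, y', y'') + s xt ψ(xt, y', y'', s, w)`, is a non-degenerate
parametrization of the pair `(Γ, Γs)` near the point `q` (with `xt = 0`, `r = 0`) of the boundary of
the lift of `Γ`, the base point being `q' = (0, y'₀, y''₀, 0, w₀)`. -/
def IsConicParametrization {l m k : ℕ} (Γ Γs : Set (CornerPt l m)) (q : CornerBl l m)
    (φ₁ : EE l → ℝ) (φ₂ : ℝ → EE l → EE m → ℝ) (ψ : ℝ → EE l → EE m → ℝ → EE k → ℝ)
    (w₀ : EE k) : Prop :=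
  ∃ (W₁ : Set (EE l)) (W : Set (Corner l m)) (U : Set (ℝ × EE l × EE m × ℝ × EE k)),
    (0, q.1.2.1, q.1.2.2) ∈ W ∧ IsOpen U ∧ (0, q.1.2.1, q.1.2.2, 0, w₀) ∈ U ∧
    (∀ z ∈ U, (z.1, z.2.1, z.2.2.1) ∈ W) ∧
    -- `(φ₁ + xt φ₂)/x` parametrizes `Γs`
    IsCornerGraphOn Γs W₁ W φ₁ φ₂ ∧
    ContDiffOn ℝ ∞ (fun z : ℝ × EE l × EE m × ℝ × EE k =>
      ψ z.1 z.2.1 z.2.2.1 z.2.2.2.1 z.2.2.2.2) U ∧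
    -- `q'` is critical and is mapped to `q`
    q = conicPoint φ₁ φ₂ (fun t y' y'' => ψ t y' y'' 0 w₀) 0 q.1.2.1 q.1.2.2 0 ∧
    ψ 0 q.1.2.1 q.1.2.2 0 w₀ = 0 ∧
    gradient (fun w => ψ 0 q.1.2.1 q.1.2.2 0 w) w₀ = 0 ∧
    -- non-degeneracy: `dψ` and the `d(∂ψ/∂w_j)` in the variables `(y'', w)` are independent
    LinearIndependent ℝ (Fin.cons
      (fderiv ℝ (fun z : EE m × EE k => ψ 0 q.1.2.1 z.1 0 z.2) (q.1.2.2, w₀))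
      (fun j : Fin k => fderiv ℝ
        (fun z : EE m × EE k => gradient (fun w => ψ 0 q.1.2.1 z.1 0 w) z.2 j) (q.1.2.2, w₀)) :
      Fin (k + 1) → (EE m × EE k →L[ℝ] ℝ)) ∧
    -- near `q`, the lift of `Γ` is the image of the critical set
    ∃ O : Set (CornerBl l m), IsOpen O ∧ q ∈ O ∧ ∀ a ∈ O, a ∈ hat cnorm Γ Γs ↔
      ∃ (xt : ℝ) (y' : EE l) (y'' : EE m) (s : ℝ) (w : EE k),
        (xt, y', y'', s, w) ∈ U ∧ 0 ≤ xt ∧ 0 ≤ s ∧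
        ψ xt y' y'' s w + s * deriv (fun t => ψ xt y' y'' t w) s = 0 ∧
        gradient (fun w => ψ xt y' y'' s w) w = 0 ∧
        a = conicPoint φ₁ φ₂ (fun t y' y'' => ψ t y' y'' s w) xt y' y'' s

/-! ### Manifolds with corners of codimension two with fibred boundary -/

/-- Model space `[0, ∞) × [0, ∞) × ℝ^d` of manifolds of dimension `N = d + 2` with corners of
codimension at most two. -/
abbrev CModel (d : ℕ) :=
  ModelProd (EuclideanHalfSpace 1) (ModelProd (EuclideanHalfSpace 1) (EE d))

/-- The vector space containing `CModel d`. -/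
abbrev CVec (d : ℕ) := EE 1 × (EE 1 × EE d)

/-- The corresponding model with corners. -/
abbrev CI (d : ℕ) : ModelWithCorners ℝ (CVec d) (CModel d) :=
  (𝓡∂ 1).prod ((𝓡∂ 1).prod (𝓡 d))

/-- The coordinates `y'` of `y = (y', y'')`. -/
def blockOne {l m d : ℕ} (h : l + m = d) (y : EE d) : EE l :=
  WithLp.toLp 2 (fun j => y (Fin.cast h (Fin.castAdd m j)))

/-- The coordinates `y''` of `y = (y', y'')`. -/
def blockTwo {l m d : ℕ} (h : l + m = d) (y : EE d) : EE m :=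
  WithLp.toLp 2 (fun k => y (Fin.cast h (Fin.natAdd l k)))

section Charts

variable {d : ℕ} {M : Type*} [TopologicalSpace M]

/-- First coordinate (with values in `[0, ∞)`) of a chart. -/
def cu (e : OpenPartialHomeomorph M (CModel d)) (p : M) : ℝ := (e p).1.1 0

/-- Second coordinate (with values in `[0, ∞)`) of a chart. -/
def ct (e : OpenPartialHomeomorph M (CModel d)) (p : M) : ℝ := (e p).2.1.1 0

/-- The remaining coordinates of a chart. -/
def cy (e : OpenPartialHomeomorph M (CModel d)) (p : M) : EE d := (e p).2.2

/-- All coordinates of a chart but the first one. -/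
def cyb (e : OpenPartialHomeomorph M (CModel d)) (p : M) : EE (d + 1) :=
  WithLp.toLp 2 (Fin.cons (ct e p) (fun j => cy e p j))

end Charts

/-- The data of a boundary fibration on `M`: the main face `mf` (with the trivial fibration), the
other boundary hypersurfaces `face i` with maps `fib i : face i → Z i` to compact manifolds without
boundary, and a total boundary defining function `x`. -/
structure BoundaryFibration (d : ℕ) (M : Type u) [TopologicalSpace M] where
  mf : Set M
  Face : Type v
  face : Face → Set M
  /-- dimension of the base -/
  l : Face → ℕ
  /-- dimension of the fibres of the corner `face i ∩ mf` -/
  m : Face → ℕ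
  dim_eq : ∀ i, l i + m i = d
  Z : Face → Type v
  [topZ : ∀ i, TopologicalSpace (Z i)]
  [chartZ : ∀ i, ChartedSpace (EE (l i)) (Z i)]
  [mfdZ : ∀ i, IsManifold (𝓡 (l i)) ∞ (Z i)]
  [compZ : ∀ i, CompactSpace (Z i)]
  [t2Z : ∀ i, T2Space (Z i)]
  fib : ∀ i, face i → Z i
  x : M → ℝ

attribute [instance] BoundaryFibration.topZ BoundaryFibration.chartZ BoundaryFibration.mfdZ
  BoundaryFibration.compZ BoundaryFibration.t2Z

namespace BoundaryFibration

variable {d : ℕ} {M : Type*} [TopologicalSpace M] [ChartedSpace (CModel d) M]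

section NoSmooth

variable (B : BoundaryFibration d M)

/-- Coordinates `(x, yb)` near a point of the interior of the main face. -/
def IsMfChart (e : OpenPartialHomeomorph M (CModel d)) : Prop :=
  e ∈ IsManifold.maximalAtlas (CI d) ∞ M ∧
  ∀ p ∈ e.source, (p ∈ B.mf ↔ cu e p = 0) ∧ B.x p = cu e p ∧ 0 < ct e p ∧ ∀ j, p ∉ B.face j

/-- Coordinates `(x, y', z'')` near an interior point of `face i`: on the face, `y'` is the
pull-back of the coordinates `κ` on the base. -/
def IsFaceChart (i : B.Face) (e : OpenPartialHomeomorph M (CModel d))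
    (κ : OpenPartialHomeomorph (B.Z i) (EE (B.l i))) : Prop :=
  e ∈ IsManifold.maximalAtlas (CI d) ∞ M ∧ κ ∈ IsManifold.maximalAtlas (𝓡 (B.l i)) ∞ (B.Z i) ∧
  (∀ p ∈ e.source, (p ∈ B.face i ↔ cu e p = 0) ∧ B.x p = cu e p ∧ 0 < ct e p ∧ p ∉ B.mf ∧
    ∀ j, j ≠ i → p ∉ B.face j) ∧
  ∀ p : B.face i, (p : M) ∈ e.source → B.fib i p ∈ κ.source ∧
    κ (B.fib i p) = blockOne (B.dim_eq i) (cy e p)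

/-- Coordinates `(xt, x'', y', y'')` near a point of the corner `mf ∩ face i`: `x'' = 0` defines
`mf`, `xt = x/x'' = 0` defines `face i`, and on the face `y'` is the pull-back of the coordinates
`κ` on the base. -/
def IsCornerChart (i : B.Face) (e : OpenPartialHomeomorph M (CModel d))
    (κ : OpenPartialHomeomorph (B.Z i) (EE (B.l i))) : Prop :=
  e ∈ IsManifold.maximalAtlas (CI d) ∞ M ∧ κ ∈ IsManifold.maximalAtlas (𝓡 (B.l i)) ∞ (B.Z i) ∧
  (∀ p ∈ e.source, (p ∈ B.face i ↔ cu e p = 0) ∧ (p ∈ B.mf ↔ ct e p = 0) ∧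
    B.x p = cu e p * ct e p ∧ ∀ j, j ≠ i → p ∉ B.face j) ∧
  ∀ p : B.face i, (p : M) ∈ e.source → B.fib i p ∈ κ.source ∧
    κ (B.fib i p) = blockOne (B.dim_eq i) (cy e p)

/-- `B` is a stratification of the boundary of the manifold with corners `M`: the main face and the
other faces are its boundary hypersurfaces, the latter are disjoint, meet the main face, and are
total spaces of fibrations whose fibres are transversal to the main face; `x` is a total
boundary defining function. The local conditions are expressed by adapted coordinates. -/
structure IsFibred : Prop where
  smooth_x : ContMDiff (CI d) 𝓘(ℝ, ℝ) ∞ B.x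
  closed_mf : IsClosed B.mf
  closed_face : ∀ i, IsClosed (B.face i)
  disjoint_face : ∀ i j, i ≠ j → Disjoint (B.face i) (B.face j)
  face_inter_mf : ∀ i, (B.face i ∩ B.mf).Nonempty
  surj_fib : ∀ i, Function.Surjective (B.fib i)
  trivial_fib : ∀ i (z : B.Z i), ∃ t : Bundle.Trivialization (B.fib i ⁻¹' {z}) (B.fib i), z ∈ t.baseSet
  interior : ∀ p, p ∉ B.mf → (∀ i, p ∉ B.face i) → (CI d).IsInteriorPoint p ∧ 0 < B.x p
  mf_chart : ∀ p ∈ B.mf, (∀ i, p ∉ B.face i) → ∃ e, B.IsMfChart e ∧ p ∈ e.source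
  face_chart : ∀ i, ∀ p ∈ B.face i, p ∉ B.mf → ∃ e κ, B.IsFaceChart i e κ ∧ p ∈ e.source
  corner_chart : ∀ i, ∀ p ∈ B.face i, p ∈ B.mf → ∃ e κ, B.IsCornerChart i e κ ∧ p ∈ e.source

/-- The bundle over the base `Z i`, isomorphic to the scattering cotangent bundle of
`Z i × [0, ε)_x` over `x = 0`: its points `(z, τ, α)` stand for `τ dx/x² + α/x`, with `α` a covector
at `z`. -/
abbrev NormalBundle (i : B.Face) :=
  Σ z : B.Z i, ℝ × (TangentSpace (𝓡 (B.l i)) z →L[ℝ] ℝ)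

end NoSmooth

variable [IsManifold (CI d) ∞ M]

/-- Derivative of the function `f` along the vector field `V`, at `p`. -/
def along (V : Cₛ^∞⟮CI d; CVec d, (TangentSpace (CI d) : M → Type)⟯) (f : M → ℝ) (p : M) : ℝ :=
  mfderiv (CI d) 𝓘(ℝ, ℝ) f p (V p)

variable (B : BoundaryFibration d M)

/-- The fibred-scattering vector fields: `V x ∈ x² C^∞` and `V` is tangent to the fibres of the
boundary fibrations, that is, `V f` vanishes on a face if `f` is constant on its fibres (on `mf` the
fibration is the identity). Functions vanishing on a face are such functions, so `V` is tangent to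
the boundary. -/
def Vsf : Submodule ℝ (Cₛ^∞⟮CI d; CVec d, (TangentSpace (CI d) : M → Type)⟯) where
  carrier := {V |
    (∃ g : M → ℝ, ContMDiff (CI d) 𝓘(ℝ, ℝ) ∞ g ∧ ∀ p, along V B.x p = B.x p ^ 2 * g p) ∧
    (∀ f : M → ℝ, ContMDiff (CI d) 𝓘(ℝ, ℝ) ∞ f → ∀ p ∈ B.mf, along V f p = 0) ∧
    ∀ (i : B.Face) (f : M → ℝ), ContMDiff (CI d) 𝓘(ℝ, ℝ) ∞ f →
      (∀ p p' : B.face i, B.fib i p = B.fib i p' → f p = f p') →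
      ∀ p ∈ B.face i, along V f p = 0}
  add_mem' := by
    rintro V W ⟨⟨g, hg, hV⟩, hV', hV''⟩ ⟨⟨g', hg', hW⟩, hW', hW''⟩
    have key : ∀ f p, along (V + W) f p = along V f p + along W f p := fun f p =>
      (mfderiv (CI d) 𝓘(ℝ, ℝ) f p).map_add (V p) (W p)
    refine ⟨⟨g + g', hg.add hg', fun p => ?_⟩, fun f hf p hp => ?_, fun i f hf hc p hp => ?_⟩
    · rw [key, hV, hW, Pi.add_apply]; ring
    · rw [key, hV' f hf p hp, hW' f hf p hp, add_zero]
    · rw [key, hV'' i f hf hc p hp, hW'' i f hf hc p hp, add_zero]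
  zero_mem' := by
    have key : ∀ f (p : M),
        along (0 : Cₛ^∞⟮CI d; CVec d, (TangentSpace (CI d) : M → Type)⟯) f p = 0 :=
      fun f p => (mfderiv (CI d) 𝓘(ℝ, ℝ) f p).map_zero
    refine ⟨⟨fun _ => 0, contMDiff_const, fun p => ?_⟩, fun f _ p _ => key f p,
      fun _ f _ _ p _ => key f p⟩
    rw [key, mul_zero]
  smul_mem' := by
    rintro c V ⟨⟨g, hg, hV⟩, hV', hV''⟩
    have key : ∀ f p, along (c • V) f p = c * along V f p := fun f p =>
      (mfderiv (CI d) 𝓘(ℝ, ℝ) f p).map_smul c (V p)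
    refine ⟨⟨fun p => c * g p, contMDiff_const.mul hg, fun p => ?_⟩, fun f hf p hp => ?_,
      fun i f hf hc p hp => ?_⟩
    · rw [key, hV]; ring
    · rw [key, hV' f hf p hp, mul_zero]
    · rw [key, hV'' i f hf hc p hp, mul_zero]

/-- The fibre at `p` of the fibred-scattering cotangent bundle: the dual of the fibre
`Vsf / (I_p Vsf)`, `I_p` the ideal of `p`, of the bundle whose smooth sections are `Vsf`. -/
def Covec (p : M) : Type _ :=
  {ξ : B.Vsf →ₗ[ℝ] ℝ // ∀ (f : M → ℝ) (V W : B.Vsf), ContMDiff (CI d) 𝓘(ℝ, ℝ) ∞ f →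
    (∀ p', W.1 p' = f p' • V.1 p') → ξ W = f p * ξ V}

/-- The total space of the fibred-scattering cotangent bundle. -/
abbrev CotBundle := Σ p : M, B.Covec p

/-- The filter of neighbourhoods of `p` in the interior of `M`. -/
def nhdsInterior (p : M) : Filter M := 𝓝[{p' | B.x p' ≠ 0}] p

/-- `ξ = τ dx/x² + μ·dyb/x` in the coordinates `(x, yb)` (the forms are evaluated on vector
fields, by continuity at the boundary). -/
def IsMfCovec (e : OpenPartialHomeomorph M (CModel d)) (p : M) (ξ : B.Covec p)
    (τ : ℝ) (μ : EE (d + 1)) : Prop :=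
  ∀ (V : B.Vsf) (a : ℝ) (b : EE (d + 1)),
    Filter.Tendsto (fun p' => along V.1 B.x p' / B.x p' ^ 2) (B.nhdsInterior p) (𝓝 a) →
    (∀ j, Filter.Tendsto (fun p' => along V.1 (fun p => cyb e p j) p' / B.x p')
      (B.nhdsInterior p) (𝓝 (b j))) →
    ξ.1 V = τ * a + ⟪μ, b⟫_ℝ

/-- `ξ = τ dx/x² + η dxt/x + μ'·dy'/x + μ''·dy''/x''` in the coordinates `(xt, x'', y', y'')`,
where `ζ = (η, μ', μ'')`. -/
def IsCornerCovec (i : B.Face) (e : OpenPartialHomeomorph M (CModel d)) (p : M) (ξ : B.Covec p)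
    (τ : ℝ) (ζ : Corner (B.l i) (B.m i)) : Prop :=
  ∀ (V : B.Vsf) (a : ℝ) (b : Corner (B.l i) (B.m i)),
    Filter.Tendsto (fun p' => along V.1 B.x p' / B.x p' ^ 2) (B.nhdsInterior p) (𝓝 a) →
    Filter.Tendsto (fun p' => along V.1 (cu e) p' / B.x p') (B.nhdsInterior p) (𝓝 b.1) →
    (∀ j, Filter.Tendsto
      (fun p' => along V.1 (fun p => blockOne (B.dim_eq i) (cy e p) j) p' / B.x p')
      (B.nhdsInterior p) (𝓝 (b.2.1 j))) →
    (∀ k, Filter.Tendsto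
      (fun p' => along V.1 (fun p => blockTwo (B.dim_eq i) (cy e p) k) p' / ct e p')
      (B.nhdsInterior p) (𝓝 (b.2.2 k))) →
    ξ.1 V = τ * a + ζ.1 * b.1 + ⟪ζ.2.1, b.2.1⟫_ℝ + ⟪ζ.2.2, b.2.2⟫_ℝ

/-- The coordinates `(xt, y', y'')` on the main face. -/
def cornerBase (i : B.Face) (e : OpenPartialHomeomorph M (CModel d)) (p : M) :
    Corner (B.l i) (B.m i) :=
  (cu e p, blockOne (B.dim_eq i) (cy e p), blockTwo (B.dim_eq i) (cy e p))

/-- The point `⟨p, ξ⟩` over the main face has the coordinates `a`. -/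
def HasCornerCoords (i : B.Face) (e : OpenPartialHomeomorph M (CModel d)) (P : B.CotBundle)
    (a : CornerPt (B.l i) (B.m i)) : Prop :=
  P.1 ∈ e.source ∧ P.1 ∈ B.mf ∧ B.cornerBase i e P.1 = a.1 ∧ B.IsCornerCovec i e P.1 P.2 a.2.1 a.2.2

/-- `G`, over the main face, in corner coordinates. -/
def cornerImage (i : B.Face) (e : OpenPartialHomeomorph M (CModel d)) (G : Set B.CotBundle) :
    Set (CornerPt (B.l i) (B.m i)) :=
  {a | ∃ P ∈ G, B.HasCornerCoords i e P a}

/-- The part of the main face covered by a corner chart. -/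
def cornerPatch (i : B.Face) (e : OpenPartialHomeomorph M (CModel d)) :
    Set (Corner (B.l i) (B.m i)) :=
  B.cornerBase i e '' (e.source ∩ B.mf)

/-- `G`, over the interior of the main face, in coordinates `(yb, τ, μ)`. -/
def mfImage (e : OpenPartialHomeomorph M (CModel d)) (G : Set B.CotBundle) : Set (ScPt (d + 1)) :=
  {a | ∃ P ∈ G, P.1 ∈ e.source ∧ P.1 ∈ B.mf ∧ cyb e P.1 = a.1 ∧ B.IsMfCovec e P.1 P.2 a.2.1 a.2.2}

/-- The part of the main face covered by an interior chart. -/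
def mfPatch (e : OpenPartialHomeomorph M (CModel d)) : Set (EE (d + 1)) :=
  cyb e '' (e.source ∩ B.mf)

/-- The differential at `z` of the `j`-th coordinate of `κ`, applied to `v`. -/
def coordDiff {n : ℕ} {Y : Type*} [TopologicalSpace Y] [ChartedSpace (EE n) Y]
    (κ : OpenPartialHomeomorph Y (EE n)) (j : Fin n) (z : Y) (v : TangentSpace (𝓡 n) z) : ℝ :=
  mfderiv (𝓡 n) 𝓘(ℝ, ℝ) (fun z => κ z j) z v

/-- A subset of the bundle over the base in coordinates `(y', τ, μ')`. -/
def baseImage (i : B.Face) (κ : OpenPartialHomeomorph (B.Z i) (EE (B.l i)))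
    (G₁ : Set (B.NormalBundle i)) : Set (ScPt (B.l i)) :=
  {b | ∃ P ∈ G₁, P.1 ∈ κ.source ∧ κ P.1 = b.1 ∧ P.2.1 = b.2.1 ∧
    ∀ v : TangentSpace (𝓡 (B.l i)) P.1,
      P.2.2 v = ∑ j, b.2.2 j * coordDiff κ j P.1 v}

/-- `G₁` is a Legendre submanifold of the bundle over the base. -/
def IsBaseLegendre (i : B.Face) (G₁ : Set (B.NormalBundle i)) : Prop :=
  ∀ κ ∈ IsManifold.maximalAtlas (𝓡 (B.l i)) ∞ (B.Z i), IsScLegendre (B.baseImage i κ G₁)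

/-- The natural map from the bundle over `mf ∩ face i` to the bundle over the base, given in
coordinates by `(y', y'', τ, η, μ', μ'') ↦ (y', τ, μ')`, induces a surjective submersion from `G`
onto `G₁` whose fibres are Legendre submanifolds. -/
def FibresOver (i : B.Face) (G : Set B.CotBundle) (G₁ : Set (B.NormalBundle i)) : Prop :=
  (∀ e κ, B.IsCornerChart i e κ → IsCornerFibred (B.cornerImage i e G) (B.baseImage i κ G₁)) ∧
  ∀ P ∈ G₁, ∃ e κ, B.IsCornerChart i e κ ∧
    ∃ a ∈ B.cornerImage i e G, a.1.1 = 0 ∧ baseProj a ∈ B.baseImage i κ {P}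

/-- `G` is a Legendre submanifold of the restriction of the bundle to the main face, transversal to
the boundary. -/
def IsMainLegendre (G : Set B.CotBundle) : Prop :=
  (∀ P ∈ G, P.1 ∈ B.mf) ∧
  (∀ e, B.IsMfChart e → IsScLegendre (B.mfImage e G)) ∧
  ∀ i e κ, B.IsCornerChart i e κ → ∀ a ∈ B.cornerImage i e G,
    ∃ T, IsCornerLegendreAt (B.cornerImage i e G) a T

/-- Legendre submanifolds of the fibred-scattering cotangent bundle. -/
def IsLegendre (G : Set B.CotBundle) : Prop :=
  B.IsMainLegendre G ∧ ∀ i, ∃ G₁, B.IsBaseLegendre i G₁ ∧ B.FibresOver i G G₁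

/-- Legendre pairs with conic points in the fibred-scattering cotangent bundle. -/
def IsLegendrePair (G Gs : Set B.CotBundle) : Prop :=
  B.IsLegendre G ∧ B.IsLegendre Gs ∧
  (∀ e, B.IsMfChart e → IsScConicPair (B.mfPatch e) (B.mfImage e G) (B.mfImage e Gs)) ∧
  (∀ i, ∃ G₁, B.IsBaseLegendre i G₁ ∧ B.FibresOver i G G₁ ∧ B.FibresOver i Gs G₁ ∧
    ∀ e κ, B.IsCornerChart i e κ → ∀ b ∈ B.baseImage i κ G₁,
      IsScConicPair {y'' | (0, b.1, y'') ∈ B.cornerPatch i e}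
        (fibreOver (B.cornerImage i e G) b) (fibreOver (B.cornerImage i e Gs) b)) ∧
  ∀ i e κ, B.IsCornerChart i e κ →
    IsCornerConic (B.cornerPatch i e) (B.cornerImage i e G) (B.cornerImage i e Gs)

end BoundaryFibration

end FibredScattering

end

open FibredScattering

open scoped Manifold ContDiff Topology InnerProductSpace

noncomputable section

namespace FibredScattering

/-! ### Smooth functions: parametric integrals, division by a coordinate, extension -/

section Calculus

open Filter

variable {X : Type} [NormedAddCommGroup X] [NormedSpace ℝ X]

/-! Both parts are Legendre transforms, carried out uniformly up to the corner.

For a single Legendre submanifold, isotropy gives some `t` for which `μ' - t y'` are coordinates on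
the base `Γ₁`, and some `s` for which `μ'' - s y''` are coordinates on the fibre
(`exists_injective_sub_smul`, `IsScLegendre.exists_coord`). By transversality and a dimension count,
`(xt, v, w) = (xt, μ' - t y', μ'' - s y'')` are coordinates on `Γ` near `q`
(`IsCornerFibred.exists_chart`). Write `Y'`, `Y''` for the values of `y'`, `y''` on `Γ`. The
Legendre transform `θ` of `-τ` then satisfies `∂_v θ = -Y'` and `∂_w θ = -xt Y''` (`fderiv_genFun`).
At `xt = 0` the values of `τ` and `y'` come from the base, so `θ(0, v, w)` depends on `v` alone and
`θ = h(v) + xt θ₂` (`exists_genFun_split`). The phase is `⟪y', v⟫ + t/2 |y'|² + h(v) + xt (⟪y'', w⟫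
+ s/2 |y''|² + θ₂)`; its critical equations read `y' = Y'`, `y'' = Y''`, and its non-degeneracy is
visible in the terms `⟪y', v⟫`, `⟪y'', w⟫`.

For a conic pair, let `σ = τ + f₁ + xt f₂` measure the distance in `τ` from the section. On the lift
the contact condition becomes `dσ + r (ω₀ dxt + ω'·dy' + xt ω''·dy'') = 0`. Since `Γ` and `Γs` have
the same base, `σ` and `ω'` vanish for `xt = 0 < r` (`IsConicCorner.eventually_corner`), and `σ`
vanishes on the front face. Hence `σ = xt r κ` and `ω' = xt ν` with smooth `κ`, `ν`. Dividing the
contact form coefficient by coefficient leaves, at `xt = r = 0`, the relations `ω₀ = 0`, `ω' = 0`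
and `ν·dy' + ω''·dy'' = 0` (`exists_frontFace_oneForm`). So `e = ω''(q)` is a unit vector, and with
`P` the projection to its orthogonal complement, isotropy yields a `t` such that `xt, r, y', P ω'' -
t P y''` are linear coordinates on the tangent space (`IsConicCorner.exists_coord`).

Rescaling by `⟪ω'', e⟫` gives coordinates `xt, s, y', w` in which the direction is `D = ω / ⟪ω'',
e⟫` with `D'' = e + ι (w + t P Y'')`. This `D''` is the `y''`-gradient of `coneQuad`, so `ψ =
coneQuad + h(xt, s, y', w)` with `h` read off from `σ/(xt s)` (`exists_coneFun`). Its critical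
equations determine `P y''` and `⟪y'', e⟫`, that is, `y'' = Y''`.

Contact identities are available only in the interior, where the submanifold can be differentiated
in all directions. They reach the faces by continuity (`eventually_eq_zero_of_closure`), after
division by the monomials in `xt` and `s`. All charts come from the inverse function theorem
(`exists_levelSet_chart`). -/

theorem hasFDerivAt_integral_of_contDiff [FiniteDimensional ℝ X]
    {V : Type} [NormedAddCommGroup V] [NormedSpace ℝ V]
    {F : X × ℝ → V} (hF : ContDiff ℝ ∞ F) (p : X) :
    HasFDerivAt (fun p => ∫ t in (0 : ℝ)..1, F (p, t))
      (∫ t in (0 : ℝ)..1, (fderiv ℝ F (p, t)).comp (ContinuousLinearMap.inl ℝ X ℝ)) p := by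
  have hc : Continuous (fun z : X × ℝ => (fderiv ℝ F z).comp (ContinuousLinearMap.inl ℝ X ℝ)) :=
    (hF.continuous_fderiv (by simp)).clm_comp continuous_const
  obtain ⟨C, hC⟩ := ((isCompact_closedBall p 1).prod (isCompact_Icc (a := (0 : ℝ)) (b := 1))
    ).exists_bound_of_continuousOn hc.continuousOn
  refine intervalIntegral.hasFDerivAt_integral_of_dominated_of_fderiv_le (bound := fun _ => C)
    (F' := fun p t => (fderiv ℝ F (p, t)).comp (ContinuousLinearMap.inl ℝ X ℝ))
    (Metric.closedBall_mem_nhds p one_pos) (Eventually.of_forall fun x => ?_) ?_ ?_ ?_ ?_ ?_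
  · exact (hF.continuous.comp (by fun_prop : Continuous fun t : ℝ => (x, t))).aestronglyMeasurable
  · exact (hF.continuous.comp (by fun_prop : Continuous fun t : ℝ => (p, t))).intervalIntegrable _ _
  · exact (hc.comp (by fun_prop : Continuous fun t : ℝ => (p, t))).aestronglyMeasurable
  · refine Eventually.of_forall fun t ht x hx => hC (x, t) ⟨hx, ?_⟩
    rw [Set.uIoc_of_le zero_le_one] at ht
    exact ⟨ht.1.le, ht.2⟩
  · exact intervalIntegrable_const
  · refine Eventually.of_forall fun t _ x _ => ?_
    exact ((hF.differentiable (by simp)) (x, t)).hasFDerivAt.comp x (hasFDerivAt_prodMk_left x t)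

/-- The derivative of the integral is again a parametric integral, with values in a space of linear
maps; the induction therefore has to run over all target spaces at once. -/
theorem contDiff_nat_integral_of_contDiff [FiniteDimensional ℝ X] (n : ℕ) :
    ∀ {V : Type} [NormedAddCommGroup V] [NormedSpace ℝ V] {F : X × ℝ → V}, ContDiff ℝ ∞ F →
      ContDiff ℝ n (fun p => ∫ t in (0 : ℝ)..1, F (p, t)) := by
  induction n with
  | zero =>
    intro V _ _ F hF
    exact contDiff_zero.2
      (continuous_iff_continuousAt.2 fun p => (hasFDerivAt_integral_of_contDiff hF p).continuousAt)
  | succ n ih =>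
    intro V _ _ F hF
    have hd := hasFDerivAt_integral_of_contDiff hF
    refine contDiff_succ_iff_fderiv.2
      ⟨fun p => (hd p).differentiableAt, fun h => absurd h (WithTop.natCast_ne_top n), ?_⟩
    rw [show fderiv ℝ (fun p => ∫ t in (0 : ℝ)..1, F (p, t)) = fun p => ∫ t in (0 : ℝ)..1,
      (fun z : X × ℝ => (fderiv ℝ F z).comp (ContinuousLinearMap.inl ℝ X ℝ)) (p, t) from
      funext fun p => (hd p).fderiv]
    exact ih ((hF.fderiv_right (by simp)).clm_comp contDiff_const)

theorem contDiff_integral_of_contDiff [FiniteDimensional ℝ X]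
    {V : Type} [NormedAddCommGroup V] [NormedSpace ℝ V]
    {F : X × ℝ → V} (hF : ContDiff ℝ ∞ F) :
    ContDiff ℝ ∞ (fun p => ∫ t in (0 : ℝ)..1, F (p, t)) :=
  contDiff_infty.2 fun n => contDiff_nat_integral_of_contDiff n hF

/-- Division by a coordinate. -/
theorem exists_contDiff_eq_add_smul [FiniteDimensional ℝ X]
    {V : Type} [NormedAddCommGroup V] [NormedSpace ℝ V] [CompleteSpace V]
    {f : X → V} (hf : ContDiff ℝ ∞ f) (ℓ : X →L[ℝ] ℝ) (e : X) :
    ∃ h : X → V, ContDiff ℝ ∞ h ∧ ∀ p, f p = f (p - ℓ p • e) + ℓ p • h p := by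
  -- Hadamard's formula: the quotient is the average of the derivative in the direction `e` over the
  -- segment from `p - ℓ p • e` to `p`.
  set F : X × ℝ → V := fun z => fderiv ℝ f (z.1 - ℓ z.1 • e + (z.2 * ℓ z.1) • e) e with hFdef
  have hF : ContDiff ℝ ∞ F := by
    have h1 : ContDiff ℝ ∞ (fun z : X × ℝ => z.1 - ℓ z.1 • e + (z.2 * ℓ z.1) • e) := by fun_prop
    exact (((hf.fderiv_right (by simp)).comp h1).clm_apply contDiff_const)
  refine ⟨_, contDiff_integral_of_contDiff hF, fun p => ?_⟩
  have hd : ∀ t : ℝ, HasDerivAt (fun t : ℝ => f (p - ℓ p • e + (t * ℓ p) • e))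
      (ℓ p • F (p, t)) t := by
    intro t
    have h2 : HasDerivAt (fun t : ℝ => p - ℓ p • e + (t * ℓ p) • e) (ℓ p • e) t := by
      have := (((hasDerivAt_id t).mul_const (ℓ p)).smul_const e).const_add (p - ℓ p • e)
      simpa using this
    have := ((hf.differentiable (by simp)) _).hasFDerivAt.comp_hasDerivAt t h2
    simpa [hFdef, Function.comp_def] using this
  have hi := intervalIntegral.integral_eq_sub_of_hasDerivAt (a := 0) (b := 1)
    (fun t _ => hd t) (Continuous.intervalIntegrable
      (continuous_const.smul (hF.continuous.comp (by fun_prop : Continuous fun t : ℝ => (p, t)))) _ _)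
  rw [intervalIntegral.integral_smul] at hi
  rw [hi]
  simp

/-- A function that is smooth near a point agrees near it with a globally smooth one. -/
theorem exists_contDiff_eventuallyEq [FiniteDimensional ℝ X]
    {V : Type*} [NormedAddCommGroup V] [NormedSpace ℝ V]
    {f : X → V} {U : Set X} (hU : IsOpen U) (hf : ContDiffOn ℝ ∞ f U) {a : X} (ha : a ∈ U) :
    ∃ g : X → V, ContDiff ℝ ∞ g ∧ g =ᶠ[𝓝 a] f := by
  obtain ⟨ε, hε, hball⟩ := Metric.isOpen_iff.1 hU a ha
  let φ : ContDiffBump a := ⟨ε / 4, ε / 2, by positivity, by linarith⟩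
  refine ⟨fun x => φ x • f x, ?_, ?_⟩
  · refine contDiff_iff_contDiffAt.2 fun x => ?_
    by_cases hx : x ∈ U
    · exact φ.contDiff.contDiffAt.smul (hf.contDiffAt (hU.mem_nhds hx))
    · have : x ∉ tsupport φ := by
        rw [φ.tsupport_eq]
        intro h
        exact hx (hball (Metric.closedBall_subset_ball (by simp [φ]; linarith) h))
      have h0 : (fun x => φ x • f x) =ᶠ[𝓝 x] fun _ => 0 := by
        filter_upwards [notMem_tsupport_iff_eventuallyEq.1 this] with y hy
        simp [hy]
      exact contDiffAt_const.congr_of_eventuallyEq h0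
  · filter_upwards [φ.eventuallyEq_one] with x hx
    simp [hx]

/-- An identity between continuous functions on a region extends to its closure. -/
theorem eventually_eq_zero_of_closure {V : Type*} [TopologicalSpace V] [T2Space V] [Zero V]
    {A : X → V} (hA : Continuous A) {R R' : Set X} {a u : X}
    (hR : ∀ p ∈ R', ∀ ε : ℝ, 0 < ε → p + ε • u ∈ R)
    (h : ∀ᶠ p in 𝓝 a, p ∈ R → A p = 0) : ∀ᶠ p in 𝓝 a, p ∈ R' → A p = 0 := by
  filter_upwards [h.eventually_nhds] with p hp hpR
  have hc : Tendsto (fun ε : ℝ => p + ε • u) (𝓝[>] 0) (𝓝 p) := by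
    have : Continuous fun ε : ℝ => p + ε • u := by fun_prop
    have h2 := this.tendsto 0
    simp only [zero_smul, add_zero] at h2
    exact h2.mono_left nhdsWithin_le_nhds
  have h1 : Tendsto (fun ε : ℝ => A (p + ε • u)) (𝓝[>] 0) (𝓝 (A p)) :=
    (hA.tendsto p).comp hc
  refine tendsto_nhds_unique h1 (tendsto_const_nhds.congr' ?_)
  filter_upwards [hc.eventually hp, self_mem_nhdsWithin] with ε h3 h4
  exact (h3 (hR p hpR ε h4)).symm

/-- Local coordinates on a level set. -/
theorem exists_levelSet_chart {E P : Type} [NormedAddCommGroup E] [NormedSpace ℝ E]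
    [FiniteDimensional ℝ E] [NormedAddCommGroup P] [NormedSpace ℝ P] [FiniteDimensional ℝ P]
    {c : ℕ} {F : E → Fin c → ℝ} {Φ : E → P} {U : Set E} {a : E} (hU : IsOpen U) (ha : a ∈ U)
    (hF : ContDiffOn ℝ ∞ F U) (hΦ : ContDiffOn ℝ ∞ Φ U) (hFa : F a = 0)
    (hbij : Function.Bijective ((fderiv ℝ F a).prod (fderiv ℝ Φ a))) :
    ∃ g : P → E, ContDiff ℝ ∞ g ∧ g (Φ a) = a ∧
      (∀ᶠ p in 𝓝 (Φ a), g p ∈ U ∧ F (g p) = 0 ∧ Φ (g p) = p) ∧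
      ∀ᶠ z in 𝓝 a, F z = 0 → g (Φ z) = z := by
  have hFa' : ContDiffAt ℝ ∞ F a := hF.contDiffAt (hU.mem_nhds ha)
  have hΦa' : ContDiffAt ℝ ∞ Φ a := hΦ.contDiffAt (hU.mem_nhds ha)
  -- The inverse function theorem is applied to `(F, Φ)`; the chart `g` is the inverse restricted to
  -- the slice `F = 0` and then cut off.
  set Ψ : E → (Fin c → ℝ) × P := fun z => (F z, Φ z) with hΨ
  have hΨs : ContDiffOn ℝ ∞ Ψ U := hF.prodMk hΦ
  have hΨa : ContDiffAt ℝ ∞ Ψ a := hΨs.contDiffAt (hU.mem_nhds ha)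
  let Λ : E ≃L[ℝ] (Fin c → ℝ) × P := ContinuousLinearEquiv.ofBijective
    ((fderiv ℝ F a).prod (fderiv ℝ Φ a)) (LinearMap.ker_eq_bot.2 hbij.1)
    (LinearMap.range_eq_top.2 hbij.2)
  have hΛ : HasFDerivAt Ψ (Λ : E →L[ℝ] (Fin c → ℝ) × P) a := by
    have := (hFa'.differentiableAt (by simp)).hasFDerivAt.prodMk
      (hΦa'.differentiableAt (by simp)).hasFDerivAt
    convert this using 1
    ext <;> simp [Λ]
  let T := hΨa.toOpenPartialHomeomorph Ψ hΛ (by simp)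
  have hT : ∀ z, T z = Ψ z := fun z => rfl
  have haT : a ∈ T.source := hΨa.mem_toOpenPartialHomeomorph_source hΛ (by simp)
  have hTa : T a = (0, Φ a) := by rw [hT, hΨ]; simp [hFa]
  have hmem : (0, Φ a) ∈ T.target := hTa ▸ T.map_source haT
  have hsymm : T.symm (0, Φ a) = a := by rw [← hTa, T.left_inv haT]
  -- The inverse must be smooth on a whole neighbourhood before it can be cut off. For this the
  -- differential of `Ψ` has to stay invertible near `a`, since smoothness at one point gives
  -- neighbourhoods shrinking with the order.
  have hgood : ∀ᶠ z in 𝓝 a, z ∈ U ∧ fderiv ℝ Ψ z ∈ Set.range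
      (ContinuousLinearEquiv.toContinuousLinearMap : (E ≃L[ℝ] (Fin c → ℝ) × P) → _) := by
    refine Eventually.and (hU.mem_nhds ha) ?_
    have hc : ContinuousAt (fderiv ℝ Ψ) a := (hΨa.fderiv_right (m := 0) (by simp)).continuousAt
    exact hc.eventually (by rw [hΛ.fderiv]; exact ContinuousLinearEquiv.nhds Λ)
  have hcs : ContinuousAt T.symm (0, Φ a) := T.continuousAt_symm hmem
  have hev : ∀ᶠ y in 𝓝 ((0 : Fin c → ℝ), Φ a), ContDiffAt ℝ ∞ T.symm y := by
    have h1 : ∀ᶠ y in 𝓝 ((0 : Fin c → ℝ), Φ a), y ∈ T.target := T.open_target.mem_nhds hmem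
    have h2 := hcs.eventually (by rw [hsymm]; exact hgood)
    filter_upwards [h1, h2] with y hy1 ⟨hy2, Λ', hΛ'⟩
    have hcd : ContDiffAt ℝ ∞ Ψ (T.symm y) := hΨs.contDiffAt (hU.mem_nhds hy2)
    refine T.contDiffAt_symm (f₀' := Λ') hy1 ?_ hcd
    rw [hΛ']
    exact (hcd.differentiableAt (by simp)).hasFDerivAt
  have hι : Continuous fun p : P => ((0 : Fin c → ℝ), p) := by fun_prop
  obtain ⟨V, hVsub, hVo, hVa⟩ := eventually_nhds_iff.1 ((hι.tendsto (Φ a)).eventually hev)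
  have hs : ContDiffOn ℝ ∞ (fun p : P => T.symm ((0 : Fin c → ℝ), p)) V := fun p hp =>
    ((hVsub p hp).comp p (by fun_prop : ContDiffAt ℝ ∞ (fun p : P => ((0 : Fin c → ℝ), p)) p)
      ).contDiffWithinAt
  obtain ⟨g, hg, hgeq⟩ := exists_contDiff_eventuallyEq hVo hs hVa
  refine ⟨g, hg, by rw [hgeq.eq_of_nhds, hsymm], ?_, ?_⟩
  · have h1 : ∀ᶠ p in 𝓝 (Φ a), ((0 : Fin c → ℝ), p) ∈ T.target :=
      (hι.tendsto (Φ a)).eventually (T.open_target.mem_nhds hmem)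
    have h2 : ∀ᶠ p in 𝓝 (Φ a), T.symm ((0 : Fin c → ℝ), p) ∈ U :=
      (hι.tendsto (Φ a)).eventually (hcs.eventually (by rw [hsymm]; exact hU.mem_nhds ha))
    filter_upwards [hgeq, h1, h2] with p hp hp1 hp2
    have h3 := T.right_inv hp1
    rw [hT, hΨ, Prod.mk.injEq] at h3
    rw [hp]
    exact ⟨hp2, h3⟩
  · have h1 := hΦa'.continuousAt.eventually hgeq
    filter_upwards [h1, T.open_source.mem_nhds haT] with z hz1 hz2 hz3
    rw [hz1]
    have := T.left_inv hz2
    rwa [hT, show Ψ z = (0, Φ z) by rw [hΨ]; simp [hz3]] at this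

theorem bijective_prod_of_finrank {E P Q : Type} [NormedAddCommGroup E] [NormedSpace ℝ E]
    [FiniteDimensional ℝ E] [NormedAddCommGroup P] [NormedSpace ℝ P] [FiniteDimensional ℝ P]
    [NormedAddCommGroup Q] [NormedSpace ℝ Q] [FiniteDimensional ℝ Q]
    {A : E →L[ℝ] Q} {B : E →L[ℝ] P} (hA : Function.Surjective A)
    (hdim : Module.finrank ℝ (LinearMap.ker A.toLinearMap) = Module.finrank ℝ P)
    (hinj : ∀ v, A v = 0 → B v = 0 → v = 0) : Function.Bijective (A.prod B) := by
  have hi : Function.Injective (A.prod B).toLinearMap := by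
    rw [← LinearMap.ker_eq_bot, LinearMap.ker_eq_bot']
    intro v hv
    have hv' : (A v, B v) = 0 := hv
    rw [Prod.mk_eq_zero] at hv'
    exact hinj v hv'.1 hv'.2
  have h1 := A.toLinearMap.finrank_range_add_finrank_ker
  rw [LinearMap.range_eq_top.2 hA, finrank_top, hdim, ← Module.finrank_prod] at h1
  exact ⟨hi, (LinearMap.injective_iff_surjective_of_finrank_eq_finrank h1.symm).1 hi⟩

/-- Coordinates on a level set extending given linear functions, compatible with the tangent
space. -/
theorem exists_tangent_chart {E Q : Type} [NormedAddCommGroup E] [NormedSpace ℝ E]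
    [FiniteDimensional ℝ E] [NormedAddCommGroup Q] [NormedSpace ℝ Q] [FiniteDimensional ℝ Q]
    {c : ℕ} {F : E → Fin c → ℝ} {U : Set E} {a : E} (hU : IsOpen U) (ha : a ∈ U)
    (hF : ContDiffOn ℝ ∞ F U) (hFa : F a = 0) (L : E →L[ℝ] Q)
    (hsurj : ∀ t y, ∃ v, fderiv ℝ F a v = t ∧ L v = y)
    (K : Submodule ℝ E) (hK : ∀ v, v ∈ K ↔ fderiv ℝ F a v = 0 ∧ L v = 0) :
    ∃ (g : Q × K → E) (z₀ : K), ContDiff ℝ ∞ g ∧ g (L a, z₀) = a ∧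
      (∀ᶠ p in 𝓝 (L a, z₀), g p ∈ U ∧ F (g p) = 0 ∧ L (g p) = p.1) ∧
      ∀ u : K, fderiv ℝ g (L a, z₀) (0, u) = u := by
  -- A linear projection onto `K` completes `L` to a full set of coordinates on the level set.
  obtain ⟨π', hπ'⟩ := K.subtype.exists_leftInverse_of_injective K.ker_subtype
  set π : E →L[ℝ] K := LinearMap.toContinuousLinearMap π' with hπdef
  have hπ : ∀ u : K, π (u : E) = u := fun u => LinearMap.congr_fun hπ' u
  have hΦd : fderiv ℝ (fun z => L.prod π z) a = L.prod π := (L.prod π).fderiv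
  have hinj : ∀ v, fderiv ℝ F a v = 0 → L.prod π v = 0 → v = 0 := by
    intro v h1 h2
    have h2' : (L v, π v) = 0 := h2
    rw [Prod.mk_eq_zero] at h2'
    have hv : v ∈ K := (hK v).2 ⟨h1, h2'.1⟩
    have := hπ ⟨v, hv⟩
    rw [h2'.2] at this
    exact (congrArg Subtype.val this).symm
  obtain ⟨g, hg, hga, hgp, -⟩ := exists_levelSet_chart (Φ := fun z => L.prod π z) hU ha hF
    (L.prod π).contDiff.contDiffOn hFa (by
      rw [hΦd]
      constructor
      · intro v w hvw
        rw [← sub_eq_zero]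
        rw [← sub_eq_zero, ← map_sub] at hvw
        have h : (fderiv ℝ F a (v - w), L.prod π (v - w)) = 0 := hvw
        rw [Prod.mk_eq_zero] at h
        exact hinj _ h.1 h.2
      · rintro ⟨t, y, u⟩
        obtain ⟨v, hv1, hv2⟩ := hsurj t y
        have hk := (hK _).1 (u - π v).2
        refine ⟨v + (u - π v : K), ?_⟩
        have h1 : fderiv ℝ F a (v + (u - π v : K)) = t := by rw [map_add, hk.1, hv1, add_zero]
        have h2 : L (v + (u - π v : K)) = y := by rw [map_add, hk.2, hv2, add_zero]
        have h3 : π (v + (u - π v : K)) = u := by rw [map_add, hπ]; abel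
        change (fderiv ℝ F a (v + (u - π v : K)), L (v + (u - π v : K)),
          π (v + (u - π v : K))) = _
        rw [h1, h2, h3])
  refine ⟨g, π a, hg, hga, ?_, fun u => ?_⟩
  · filter_upwards [hgp] with p hp
    exact ⟨hp.1, hp.2.1, congrArg Prod.fst hp.2.2⟩
  · have hdg : HasFDerivAt g (fderiv ℝ g (L a, π a)) (L a, π a) :=
      (hg.differentiable (by simp) _).hasFDerivAt
    have hFd : HasFDerivAt F (fderiv ℝ F a) (g (L a, π a)) := by
      have hga' : g (L a, π a) = a := hga
      rw [hga']
      exact ((hF.contDiffAt (hU.mem_nhds ha)).differentiableAt (by simp)).hasFDerivAt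
    -- Differentiating `F ∘ g = 0` and `(L, π) ∘ g = id` determines the derivative of `g`, because
    -- `F'` and `(L, π)` are jointly injective.
    have e1 : (fderiv ℝ F a).comp (fderiv ℝ g (L a, π a)) = 0 := by
      refine (hFd.comp _ hdg).unique ?_
      refine (hasFDerivAt_const (0 : Fin c → ℝ) _).congr_of_eventuallyEq ?_
      filter_upwards [hgp] with p hp using hp.2.1
    have e2 : (L.prod π).comp (fderiv ℝ g (L a, π a)) = ContinuousLinearMap.id ℝ (Q × K) := by
      refine ((L.prod π).hasFDerivAt.comp _ hdg).unique ?_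
      refine (hasFDerivAt_id _).congr_of_eventuallyEq ?_
      filter_upwards [hgp] with p hp using hp.2.2
    have f1 := DFunLike.congr_fun e1 (0, u)
    have f2 := DFunLike.congr_fun e2 (0, u)
    have hu := (hK _).1 u.2
    rw [← sub_eq_zero]
    refine hinj _ ?_ ?_
    · rw [map_sub, hu.1, sub_zero]; exact f1
    · rw [map_sub, sub_eq_zero]
      refine f2.trans ?_
      change ((0 : Q), u) = (L u, π u)
      rw [hu.2, hπ]

end Calculus

/-! ### Isotropic subspaces -/

section Isotropic

variable {X : Type} [NormedAddCommGroup X] [NormedSpace ℝ X]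

/-- The exterior derivative of a vanishing one-form `dκ + A·dB + C·dD` vanishes. -/
theorem isotropic_of_oneForm_eq_zero {V W : Type} [NormedAddCommGroup V] [InnerProductSpace ℝ V]
    [NormedAddCommGroup W] [InnerProductSpace ℝ W] {κ : X → ℝ} {A B : X → V} {C D : X → W}
    (hκ : ContDiff ℝ ∞ κ) (hA : ContDiff ℝ ∞ A) (hB : ContDiff ℝ ∞ B) (hC : ContDiff ℝ ∞ C)
    (hD : ContDiff ℝ ∞ D) {a : X}
    (h : ∀ᶠ z in 𝓝 a, ∀ u, fderiv ℝ κ z u + ⟪A z, fderiv ℝ B z u⟫_ℝ + ⟪C z, fderiv ℝ D z u⟫_ℝ = 0)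
    (u v : X) :
    ⟪fderiv ℝ A a u, fderiv ℝ B a v⟫_ℝ + ⟪fderiv ℝ C a u, fderiv ℝ D a v⟫_ℝ =
      ⟪fderiv ℝ A a v, fderiv ℝ B a u⟫_ℝ + ⟪fderiv ℝ C a v, fderiv ℝ D a u⟫_ℝ := by
  have dd : ∀ {V : Type} [NormedAddCommGroup V] [NormedSpace ℝ V] {f : X → V}, ContDiff ℝ ∞ f →
      ∀ v, HasFDerivAt (fun z => fderiv ℝ f z v) ((fderiv ℝ (fderiv ℝ f) a).flip v) a := by
    intro V _ _ f hf v
    have h1 : ContDiff ℝ ∞ (fderiv ℝ f) := hf.fderiv_right (by simp)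
    have h2 := ((h1.differentiable (by simp)) a).hasFDerivAt.clm_apply (hasFDerivAt_const v a)
    convert h2 using 1
    ext; simp
  have sy : ∀ {V : Type} [NormedAddCommGroup V] [NormedSpace ℝ V] {f : X → V}, ContDiff ℝ ∞ f →
      ∀ u v, fderiv ℝ (fderiv ℝ f) a u v = fderiv ℝ (fderiv ℝ f) a v u := fun hf u v =>
    (hf.contDiffAt.isSymmSndFDerivAt (n := ∞) 
      (by simpa using (WithTop.coe_le_coe.2 le_top : ((2 : ℕ∞) : WithTop ℕ∞) ≤ ∞))) u v
  -- The identity for a fixed `v` is differentiated in the direction `u`. Exchanging `u` and `v` and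
  -- subtracting removes all second derivatives by symmetry.
  have key : ∀ u v, fderiv ℝ (fderiv ℝ κ) a u v +
      (⟪A a, fderiv ℝ (fderiv ℝ B) a u v⟫_ℝ + ⟪fderiv ℝ A a u, fderiv ℝ B a v⟫_ℝ) +
      (⟪C a, fderiv ℝ (fderiv ℝ D) a u v⟫_ℝ + ⟪fderiv ℝ C a u, fderiv ℝ D a v⟫_ℝ) = 0 := by
    intro u v
    have h1 := ((dd hκ v).add (((hA.differentiable (by simp)) a).hasFDerivAt.inner ℝ (dd hB v))).add
      (((hC.differentiable (by simp)) a).hasFDerivAt.inner ℝ (dd hD v))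
    have h2 := h1.unique ((hasFDerivAt_const (0 : ℝ) a).congr_of_eventuallyEq
      (h.mono fun z hz => hz v))
    have h3 := DFunLike.congr_fun h2 u
    simpa using h3
  have k1 := key u v
  have k2 := key v u
  rw [sy hκ v u, sy hB v u, sy hD v u] at k2
  linarith

/-- An isotropic subspace is a graph over `μ - t y` for some `t`. -/
theorem exists_injective_sub_smul {K : Type} [AddCommGroup K] [Module ℝ K] {n : ℕ}
    (A B : K →ₗ[ℝ] EE n) (hinj : ∀ u, A u = 0 → B u = 0 → u = 0)
    (hiso : ∀ u v, ⟪B u, A v⟫_ℝ = ⟪B v, A u⟫_ℝ) : ∃ t : ℝ, ∀ u, B u = t • A u → u = 0 := by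
  -- Otherwise every `t` has an "eigenvector" `u t` with `B (u t) = t • A (u t)`. As for a symmetric
  -- operator, the vectors `A (u t)` for different `t` are orthogonal and nonzero, and `n + 1` of
  -- them do not fit into dimension `n`.
  by_contra! hcon
  choose u hu hu0 using hcon
  have hne : ∀ t, A (u t) ≠ 0 := fun t ht => hu0 t (hinj _ ht (by rw [hu, ht, smul_zero]))
  have horth : ∀ s t, s ≠ t → ⟪A (u s), A (u t)⟫_ℝ = 0 := by
    intro s t hst
    have h := hiso (u s) (u t)
    rw [hu, hu, real_inner_smul_left, real_inner_smul_left, real_inner_comm (A (u s))] at h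
    have h2 : (s - t) * ⟪A (u s), A (u t)⟫_ℝ = 0 := by linarith
    exact (mul_eq_zero.1 h2).resolve_left (sub_ne_zero.2 hst)
  have hli : LinearIndependent ℝ (fun j : Fin (n + 1) => A (u ((j : ℕ) : ℝ))) := by
    refine linearIndependent_of_ne_zero_of_inner_eq_zero (fun j => hne _) fun i j hij => ?_
    exact horth _ _ (fun h => hij (Fin.ext (by exact_mod_cast h)))
  have := hli.fintype_card_le_finrank
  simp at this

end Isotropic

/-! ### Tangent spaces and Legendre submanifolds -/

section Tangent

open Filter

variable {E : Type} [NormedAddCommGroup E] [NormedSpace ℝ E]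

/-- Velocities of a map into a submanifold are tangent to it. -/
theorem IsSubmanifoldAt.fderiv_mem {faces : List (E →L[ℝ] ℝ)} {S : Set E} {a : E}
    {T : Submodule ℝ E} (h : IsSubmanifoldAt faces S a T) {X : Type*} [NormedAddCommGroup X]
    [NormedSpace ℝ X] {G : X → E} {p : X} (hG : DifferentiableAt ℝ G p) (hp : G p = a)
    (hev : ∀ᶠ p' in 𝓝 p, G p' ∈ S) (u : X) : fderiv ℝ G p u ∈ T := by
  obtain ⟨c, F, U, hU, ha, hF, hS, -, rfl⟩ := h
  subst hp
  have hd := ((hF.contDiffAt (hU.mem_nhds ha)).differentiableAt (by simp)).hasFDerivAt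
  have h1 : HasFDerivAt (F ∘ G) (0 : X →L[ℝ] (Fin c → ℝ)) p := by
    refine (hasFDerivAt_const (0 : Fin c → ℝ) p).congr_of_eventuallyEq ?_
    filter_upwards [hev, hG.continuousAt.eventually (hU.mem_nhds ha)] with p' h1 h2
    exact ((hS _ h2).1 h1).2
  exact DFunLike.congr_fun ((hd.comp p hG.hasFDerivAt).unique h1) u

/-- Obtained from `exists_tangent_chart` with a trivial `L` into a zero-dimensional space, so that
`K` is the full tangent space. It makes every tangent vector the velocity of a smooth map into `S`.
-/
theorem IsSubmanifoldAt.exists_param [FiniteDimensional ℝ E] {S : Set E} {a : E}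
    {T : Submodule ℝ E} (h : IsSubmanifoldAt [] S a T) (haS : a ∈ S) :
    ∃ (g : T → E) (z₀ : T), ContDiff ℝ ∞ g ∧ g z₀ = a ∧ (∀ᶠ z in 𝓝 z₀, g z ∈ S) ∧
      ∀ u : T, fderiv ℝ g z₀ u = u := by
  obtain ⟨c, F, U, hU, ha, hF, hS, hs, rfl⟩ := h
  obtain ⟨g, z₀, hg, hga, hgp, hgd⟩ := exists_tangent_chart hU ha hF ((hS a ha).1 haS).2
    (0 : E →L[ℝ] (Fin 0 → ℝ))
    (fun t y => by
      obtain ⟨v, -, hv⟩ := hs t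
      exact ⟨v, hv, Subsingleton.elim _ _⟩)
    (LinearMap.ker (fderiv ℝ F a).toLinearMap) (fun v => by simp)
  have hι : Continuous fun z : LinearMap.ker (fderiv ℝ F a).toLinearMap =>
      ((0 : Fin 0 → ℝ), z) := by fun_prop
  refine ⟨fun z => g (0, z), z₀, hg.comp (by fun_prop), hga, ?_, fun u => ?_⟩
  · filter_upwards [(hι.tendsto z₀).eventually hgp] with z hz
    exact (hS _ hz.1).2 ⟨by simp, hz.2.1⟩
  · have h1 := ((hg.differentiable (by simp)) ((0 : Fin 0 → ℝ), z₀)).hasFDerivAt.comp z₀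
      (hasFDerivAt_prodMk_right (0 : Fin 0 → ℝ) z₀)
    have h2 : fderiv ℝ (fun z => g (0, z)) z₀ = _ := h1.fderiv
    rw [h2]
    exact hgd u

/-- A vector of `T` is a velocity inside `S`, and velocities inside `S` are annihilated by the
equations of any other description. Thus the tangent space does not depend on the defining
functions. -/
theorem IsSubmanifoldAt.tangent_le [FiniteDimensional ℝ E] {S : Set E} {a : E}
    {T T' : Submodule ℝ E} (h : IsSubmanifoldAt [] S a T) (h' : IsSubmanifoldAt [] S a T')
    (haS : a ∈ S) : T ≤ T' := by
  obtain ⟨g, z₀, hg, hga, hgp, hgd⟩ := h.exists_param haS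
  intro v hv
  have := h'.fderiv_mem ((hg.differentiable (by simp)) z₀) hga hgp ⟨v, hv⟩
  rwa [hgd] at this

theorem IsSubmanifoldAt.tangent_unique [FiniteDimensional ℝ E] {S : Set E} {a : E}
    {T T' : Submodule ℝ E} (h : IsSubmanifoldAt [] S a T) (h' : IsSubmanifoldAt [] S a T')
    (haS : a ∈ S) : T = T' :=
  le_antisymm (h.tangent_le h' haS) (h'.tangent_le h haS)

theorem fderiv_clm_comp {X V : Type*} [NormedAddCommGroup X] [NormedSpace ℝ X]
    [NormedAddCommGroup V] [NormedSpace ℝ V] {g : X → E} (L : E →L[ℝ] V) {p : X}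
    (hg : DifferentiableAt ℝ g p) (u : X) :
    fderiv ℝ (fun p => L (g p)) p u = L (fderiv ℝ g p u) := by
  rw [show (fun p => L (g p)) = L ∘ g from rfl, (L.hasFDerivAt.comp p hg.hasFDerivAt).fderiv]
  rfl

end Tangent

/-! ### Linear coordinates on Legendre submanifolds of a scattering cotangent bundle -/

section ScLegendre

open Filter

variable {n : ℕ} {Γ : Set (ScPt n)}

theorem IsScLegendre.finrank_eq (h : IsScLegendre Γ) {a : ScPt n} (ha : a ∈ Γ)
    {T : Submodule ℝ (ScPt n)} (hT : IsSubmanifoldAt [] Γ a T) : Module.finrank ℝ T = n := by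
  obtain ⟨T', hT', hd, -⟩ := h a ha
  rw [hT.tangent_unique hT' ha, hd]

/-- Near each point, `μ - t y` are coordinates on a Legendre submanifold, for some `t`. -/
theorem IsScLegendre.exists_coord (h : IsScLegendre Γ) {a : ScPt n} (ha : a ∈ Γ)
    {T : Submodule ℝ (ScPt n)} (hT : IsSubmanifoldAt [] Γ a T) :
    ∃ t : ℝ, ∀ v ∈ T, v.2.2 = t • v.1 → v = 0 := by
  have hcontact : ∀ a' ∈ Γ, ∀ T', IsSubmanifoldAt [] Γ a' T' →
      ∀ v ∈ T', v.2.1 + ⟪a'.2.2, v.1⟫_ℝ = 0 := by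
    intro a' ha' T' hT'
    obtain ⟨T'', hT'', -, hc⟩ := h a' ha'
    rw [hT'.tangent_unique hT'' ha']
    exact hc
  obtain ⟨g, z₀, hg, hga, hgp, hgd⟩ := hT.exists_param ha
  have hgdiff := hg.differentiable (n := ∞) (by simp)
  let py : ScPt n →L[ℝ] EE n := ContinuousLinearMap.fst ℝ _ _
  let pτ : ScPt n →L[ℝ] ℝ := (ContinuousLinearMap.fst ℝ _ _).comp (ContinuousLinearMap.snd ℝ _ _)
  let pμ : ScPt n →L[ℝ] EE n :=
    (ContinuousLinearMap.snd ℝ _ _).comp (ContinuousLinearMap.snd ℝ _ _)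
  -- The one-form is `dτ + μ·dy`; the second pair of functions is not needed and is taken to be
  -- zero.
  have hiso := isotropic_of_oneForm_eq_zero (a := z₀) (pτ.contDiff.comp hg) (pμ.contDiff.comp hg)
    (py.contDiff.comp hg) (contDiff_const (c := (0 : EE n))) (contDiff_const (c := (0 : EE n))) (by
      filter_upwards [hgp.eventually_nhds] with z hz u
      have hzΓ := hz.self_of_nhds
      obtain ⟨T', hT', -⟩ := h _ hzΓ
      have := hcontact _ hzΓ T' hT' _ (hT'.fderiv_mem (hgdiff z) rfl hz u)
      rw [inner_zero_left, add_zero]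
      erw [fderiv_clm_comp pτ (hgdiff z), fderiv_clm_comp py (hgdiff z)]
      exact this)
  -- The contact form expresses `dτ` by `dy`, so a tangent vector with `dy = 0` and `dμ = 0` is
  -- zero.
  obtain ⟨t, ht⟩ := exists_injective_sub_smul (py.toLinearMap.comp T.subtype)
    (pμ.toLinearMap.comp T.subtype)
    (fun u h1 h2 => by
      have h1' : (u : ScPt n).1 = 0 := h1
      have h2' : (u : ScPt n).2.2 = 0 := h2
      have h3 := hcontact a ha T hT u u.2
      rw [h1', inner_zero_right, add_zero] at h3
      exact Subtype.ext (Prod.ext h1' (Prod.ext h3 h2')))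
    (fun u v => by
      have := hiso u v
      erw [fderiv_clm_comp pμ (hgdiff z₀), fderiv_clm_comp py (hgdiff z₀),
        fderiv_clm_comp pμ (hgdiff z₀), fderiv_clm_comp py (hgdiff z₀)] at this
      simpa [hgd] using this)
  refine ⟨t, fun v hv hvt => ?_⟩
  have := ht ⟨v, hv⟩ hvt
  exact congrArg Subtype.val this

end ScLegendre

/-! ### Coordinates on a Legendre submanifold near the corner -/

section CornerChart

open Filter

variable {l m : ℕ}

/-- The functions `(xt, μ' - t y', μ'' - s y'')`. -/
def cornerCoord (l m : ℕ) (t s : ℝ) : CornerPt l m →L[ℝ] ℝ × EE l × EE m :=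
  LinearMap.toContinuousLinearMap
    { toFun := fun a => (a.1.1, a.2.2.2.1 - t • a.1.2.1, a.2.2.2.2 - s • a.1.2.2)
      map_add' := fun a b => by
        simp only [Prod.fst_add, Prod.snd_add, smul_add, Prod.mk_add_mk, add_sub_add_comm]
      map_smul' := fun c a => by
        simp only [Prod.smul_fst, Prod.smul_snd, RingHom.id_apply, Prod.smul_mk, smul_sub,
          smul_comm c] }

theorem cornerCoord_apply (t s : ℝ) (a : CornerPt l m) : cornerCoord l m t s a =
    (a.1.1, a.2.2.2.1 - t • a.1.2.1, a.2.2.2.2 - s • a.1.2.2) := rfl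

theorem eq_of_cornerCoord_eq {t s : ℝ} {a : CornerPt l m} {p : ℝ × EE l × EE m}
    (h : cornerCoord l m t s a = p) :
    a.1.1 = p.1 ∧ a.2.2.2.1 = p.2.1 + t • a.1.2.1 ∧ a.2.2.2.2 = p.2.2 + s • a.1.2.2 := by
  subst h
  simp [cornerCoord_apply]

/-- `baseProj` as a linear map. -/
def baseProjL (l m : ℕ) : CornerPt l m →L[ℝ] ScPt l :=
  LinearMap.toContinuousLinearMap
    { toFun := baseProj
      map_add' := fun _ _ => rfl
      map_smul' := fun _ _ => rfl }

/-- The linear part of the inclusion of the fibres. -/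
def fibreIncl (l m : ℕ) : ScPt m →L[ℝ] CornerPt l m :=
  LinearMap.toContinuousLinearMap
    { toFun := fun c => ((0, 0, c.1), 0, (-c.2.1, 0, c.2.2))
      map_add' := fun a b => by simp [add_comm]
      map_smul' := fun c a => by simp }

theorem fibreIncl_apply (c : ScPt m) :
    fibreIncl l m c = ((0, 0, c.1), 0, (-c.2.1, 0, c.2.2)) := rfl

theorem xtFun_apply {F : Type*} [NormedAddCommGroup F] [NormedSpace ℝ F] (a : Corner l m × F) :
    xtFun l m F a = a.1.1 := rfl

/-- Tangent vectors along the corner are mapped to tangent vectors of the base. -/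
theorem IsCornerFibred.baseProj_mem {Γ : Set (CornerPt l m)} {Γ₁ : Set (ScPt l)}
    (h : IsCornerFibred Γ Γ₁) {q : CornerPt l m} (hq : q ∈ Γ) (hq0 : q.1.1 = 0)
    {T : Submodule ℝ (CornerPt l m)} {T₁ : Submodule ℝ (ScPt l)}
    (hTs : IsSubmanifoldAt [xtFun l m (ℝ × Corner l m)] Γ q T)
    (hT₁ : IsSubmanifoldAt [] Γ₁ (baseProj q) T₁) :
    ∀ v ∈ T, v.1.1 = 0 → baseProj v ∈ T₁ := by
  intro v hv hv0
  obtain ⟨c, F, U, hU, hqU, hF, hS, hsurj, rfl⟩ := hTs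
  have hL : xtFun l m (ℝ × Corner l m) q = 0 := hq0
  -- A chart of `Γ` with `xt` as a coordinate. Its slice `xt = 0` is mapped by `baseProj` into `Γ₁`,
  -- so the velocities of the slice project to tangent vectors of `Γ₁`.
  obtain ⟨g, z₀, hg, hga, hgp, hgd⟩ := exists_tangent_chart hU hqU hF ((hS q hqU).1 hq).2
    (xtFun l m (ℝ × Corner l m))
    (fun t' y => by
      -- Transversality: a value of `F'` is attained by a vector with vanishing `xt`-component, so
      -- this component can afterwards be prescribed freely.
      obtain ⟨v', hv1, hv2⟩ := hsurj (t' - fderiv ℝ F q ((y, 0, 0), 0, 0))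
      have hv3 := hv1 _ (List.mem_singleton_self _) hL
      refine ⟨v' + ((y, 0, 0), 0, 0), by rw [map_add, hv2]; abel, ?_⟩
      rw [map_add, hv3, zero_add]
      rfl)
    (LinearMap.ker (fderiv ℝ F q).toLinearMap ⊓
      LinearMap.ker (xtFun l m (ℝ × Corner l m)).toLinearMap)
    (fun v => by simp)
  rw [hL] at hga hgp hgd
  have hι : Continuous fun z : ↥(LinearMap.ker (fderiv ℝ F q).toLinearMap ⊓
      LinearMap.ker (xtFun l m (ℝ × Corner l m)).toLinearMap) => ((0 : ℝ), z) := by fun_prop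
  have h1 := (baseProjL l m).hasFDerivAt.comp z₀
    (((hg.differentiable (by simp)) ((0 : ℝ), z₀)).hasFDerivAt.comp z₀
      (hasFDerivAt_prodMk_right (0 : ℝ) z₀))
  have h2 := hT₁.fderiv_mem h1.differentiableAt (by
    change baseProjL l m (g (0, z₀)) = _
    rw [hga]; rfl)
    (by
      filter_upwards [(hι.tendsto z₀).eventually hgp] with z hz
      obtain ⟨hz1, hz2, hz3⟩ := hz
      have hz3' : (g (0, z)).1.1 = 0 := hz3
      refine (h.1 _ ((hS _ hz1).2 ⟨?_, hz2⟩) hz3').1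
      intro f hf
      rw [List.mem_singleton.1 hf]
      exact hz3.ge) ⟨v, hv, hv0⟩
  rw [h1.fderiv] at h2
  have h4 := hgd ⟨v, hv, hv0⟩
  have h5 : baseProjL l m (fderiv ℝ g (0, z₀) (0, ⟨v, hv, hv0⟩)) ∈ T₁ := h2
  rw [h4] at h5
  exact h5

/-- Since `F'` is already onto on the vectors with vanishing `xt`-component, the direction of `xt`
can be corrected by such a vector to lie in the kernel of `F'`. -/
theorem IsSubmanifoldAt.exists_transversal {Γ : Set (CornerPt l m)} {q : CornerPt l m}
    (hq0 : q.1.1 = 0) {T : Submodule ℝ (CornerPt l m)}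
    (hTs : IsSubmanifoldAt [xtFun l m (ℝ × Corner l m)] Γ q T) : ∃ v₁ ∈ T, v₁.1.1 = 1 := by
  obtain ⟨c, F, U, hU, hqU, hF, hS, hsurj, rfl⟩ := hTs
  obtain ⟨v', hv1, hv2⟩ := hsurj (fderiv ℝ F q ((1, 0, 0), 0, 0))
  have hv3 : v'.1.1 = 0 := hv1 _ (List.mem_singleton_self _) hq0
  refine ⟨((1, 0, 0), 0, 0) - v', ?_, by simp [hv3]⟩
  simp [hv2]

/-- Linear coordinates on a space fibred over `T₁` with fibre `Tf`. -/
theorem eq_zero_of_cornerCoord_eq_zero {T : Submodule ℝ (CornerPt l m)} {T₁ : Submodule ℝ (ScPt l)}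
    {Tf : Submodule ℝ (ScPt m)} (hTd : Module.finrank ℝ T = l + m + 1)
    (hd₁ : Module.finrank ℝ T₁ = l) (hdf : Module.finrank ℝ Tf = m)
    (hsub : ∀ u ∈ T₁, ∃ v ∈ T, v.1.1 = 0 ∧ baseProj v = u)
    (hbT : ∀ v ∈ T, v.1.1 = 0 → baseProj v ∈ T₁) (hfT : ∀ c ∈ Tf, fibreIncl l m c ∈ T)
    {v₁ : CornerPt l m} (hv₁ : v₁ ∈ T) (hv₁1 : v₁.1.1 = 1) {t s : ℝ}
    (ht : ∀ v ∈ T₁, v.2.2 = t • v.1 → v = 0) (hs : ∀ v ∈ Tf, v.2.2 = s • v.1 → v = 0) :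
    ∀ v ∈ T, cornerCoord l m t s v = 0 → v = 0 := by
  have hfib0 : ∀ c : ScPt m,
      baseProj (fibreIncl l m c - (fibreIncl l m c).1.1 • v₁) = 0 := by
    intro c
    simp [fibreIncl_apply, baseProj]
  -- Subtracting `xt(v) • v₁` from `v` makes it tangent to the corner, where the projection to `T₁`
  -- is defined. The map `M` is onto, so its kernel has dimension `(l + m + 1) - (1 + l) = m`.
  let M : T →ₗ[ℝ] ℝ × T₁ := (((xtFun l m (ℝ × Corner l m)).toLinearMap).comp T.subtype).prod
    (LinearMap.codRestrict T₁ ((baseProjL l m).toLinearMap.comp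
      (T.subtype - (((xtFun l m (ℝ × Corner l m)).toLinearMap).comp T.subtype).smulRight v₁))
      (fun v => hbT _ (T.sub_mem v.2 (T.smul_mem _ hv₁)) (by simp [xtFun_apply, hv₁1])))
  have hM1 : ∀ v : T, (M v).1 = (v : CornerPt l m).1.1 := fun v => rfl
  have hM2 : ∀ v : T, ((M v).2 : ScPt l) =
      baseProj ((v : CornerPt l m) - (v : CornerPt l m).1.1 • v₁) := fun v => rfl
  have hMsurj : Function.Surjective M := by
    rintro ⟨r, u, hu⟩
    obtain ⟨v, hv, hv0, hvu⟩ := hsub u hu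
    refine ⟨⟨v + r • v₁, T.add_mem hv (T.smul_mem _ hv₁)⟩, Prod.ext ?_ (Subtype.ext ?_)⟩
    · rw [hM1]; simp [hv0, hv₁1]
    · rw [hM2]; simp [hv0, hv₁1, hvu]
  have hker : Module.finrank ℝ (LinearMap.ker M) = m := by
    have h1 := M.finrank_range_add_finrank_ker
    rw [LinearMap.range_eq_top.2 hMsurj, finrank_top, Module.finrank_prod, hd₁, hTd,
      Module.finrank_self] at h1
    omega
  have hJinj : Function.Injective (fibreIncl l m).toLinearMap := by
    intro c c' hcc
    have h1 : fibreIncl l m c = fibreIncl l m c' := hcc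
    simp only [fibreIncl_apply, Prod.mk.injEq, neg_inj, true_and] at h1
    exact Prod.ext h1.1 (Prod.ext h1.2.1 h1.2.2)
  -- The tangent space of the fibre lies in the kernel of `M` and has the same dimension `m`, so the
  -- kernel consists of fibre directions.
  have hJ : Tf.map (fibreIncl l m).toLinearMap = (LinearMap.ker M).map T.subtype := by
    refine Submodule.eq_of_le_of_finrank_eq ?_ ?_
    · rintro _ ⟨c, hc, rfl⟩
      refine ⟨⟨_, hfT c hc⟩, ?_, rfl⟩
      rw [SetLike.mem_coe, LinearMap.mem_ker]
      exact Prod.ext rfl (Subtype.ext (hfib0 c))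
    · rw [← (Submodule.equivMapOfInjective _ hJinj Tf).finrank_eq,
        Submodule.finrank_map_subtype_eq, hdf, hker]
  intro v hv hv0
  simp only [cornerCoord_apply, Prod.mk_eq_zero, sub_eq_zero] at hv0
  obtain ⟨hvx, hvt, hvs⟩ := hv0
  have hb0 : baseProj v = 0 := ht _ (hbT v hv hvx) hvt
  obtain ⟨c, hcTf, hcv⟩ : v ∈ Tf.map (fibreIncl l m).toLinearMap := by
    rw [hJ]
    refine ⟨⟨v, hv⟩, ?_, rfl⟩
    rw [SetLike.mem_coe, LinearMap.mem_ker]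
    refine Prod.ext hvx (Subtype.ext ?_)
    rw [hM2]
    simp [hvx, hb0]
  change fibreIncl l m c = v at hcv
  have hc0 := hs c hcTf (by
    have h1 := congrArg (fun a : CornerPt l m => a.2.2.2.2) hcv
    have h2 := congrArg (fun a : CornerPt l m => a.1.2.2) hcv
    simp only [fibreIncl_apply] at h1 h2
    rw [h1, h2, hvs])
  rw [← hcv, hc0, map_zero]

/-- On the tangent space of a fibred Legendre submanifold at a point of the corner,
`(xt, μ' - t y', μ'' - s y'')` are linear coordinates. -/
theorem IsCornerFibred.exists_coord {Γ : Set (CornerPt l m)} {Γ₁ : Set (ScPt l)}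
    (h : IsCornerFibred Γ Γ₁) (h₁ : IsScLegendre Γ₁) {q : CornerPt l m} (hq : q ∈ Γ)
    (hq0 : q.1.1 = 0) :
    ∃ (t s : ℝ) (T : Submodule ℝ (CornerPt l m)) (T₁ : Submodule ℝ (ScPt l)),
      IsCornerLegendreAt Γ q T ∧ IsSubmanifoldAt [] Γ₁ (baseProj q) T₁ ∧
      (∀ v ∈ T, cornerCoord l m t s v = 0 → v = 0) ∧ ∀ v ∈ T₁, v.2.2 = t • v.1 → v = 0 := by
  obtain ⟨hq₁, T, T₁, hT, hT₁, hsub⟩ := h.1 q hq hq0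
  obtain ⟨t, ht⟩ := h₁.exists_coord hq₁ hT₁
  have hd₁ := h₁.finrank_eq hq₁ hT₁
  have hfib := h.2 _ hq₁
  -- The point `q` seen in its own fibre; the sign comes from `τ'' = -η`.
  set c₀ : ScPt m := (q.1.2.2, -q.2.2.1, q.2.2.2.2) with hc₀
  have hqc : ∀ c : ScPt m, c ∈ fibreOver Γ (baseProj q) ↔ q + fibreIncl l m (c - c₀) ∈ Γ := by
    intro c
    have : q + fibreIncl l m (c - c₀) = ((0, (baseProj q).1, c.1), (baseProj q).2.1,
        (-c.2.1, (baseProj q).2.2, c.2.2)) := by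
      simp only [fibreIncl_apply, hc₀, baseProj]
      ext <;> simp [hq0]
    rw [this]
    rfl
  have hc₀mem : c₀ ∈ fibreOver Γ (baseProj q) := by rw [hqc]; simpa using hq
  obtain ⟨Tf, hTf, hdf, -⟩ := hfib c₀ hc₀mem
  obtain ⟨s, hs⟩ := hfib.exists_coord hc₀mem hTf
  refine ⟨t, s, T, T₁, hT, hT₁, ?_, ht⟩
  obtain ⟨hTs, hTd, hTc⟩ := hT
  -- tangent vectors of the fibre are tangent to `Γ`
  have hfT : ∀ c ∈ Tf, fibreIncl l m c ∈ T := by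
    intro c hc
    obtain ⟨g, z₀, hg, hga, hgp, hgd⟩ := hTf.exists_param hc₀mem
    have hgdiff := (hg.differentiable (by simp)) z₀
    have h1 := hgdiff.hasFDerivAt.sub_const c₀
    have h2 := ((fibreIncl l m).hasFDerivAt.comp z₀ h1).const_add q
    have h3 := hTs.fderiv_mem h2.differentiableAt (by simp [hga])
      (hgp.mono fun z hz => (hqc _).1 hz) ⟨c, hc⟩
    rw [h2.fderiv] at h3
    have h4 := hgd ⟨c, hc⟩
    rw [ContinuousLinearMap.comp_apply, h4] at h3
    exact h3
  obtain ⟨v₁, hv₁, hv₁1⟩ := hTs.exists_transversal hq0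
  exact eq_zero_of_cornerCoord_eq_zero hTd hd₁ hdf hsub (h.baseProj_mem hq hq0 hTs hT₁) hfT hv₁
    hv₁1 ht hs

/-- A local parametrization of a fibred Legendre submanifold by `(xt, μ' - t y', μ'' - s y'')`. -/
theorem IsCornerFibred.exists_chart {Γ : Set (CornerPt l m)} {Γ₁ : Set (ScPt l)}
    (h : IsCornerFibred Γ Γ₁) (h₁ : IsScLegendre Γ₁) {q : CornerPt l m} (hq : q ∈ Γ)
    (hq0 : q.1.1 = 0) :
    ∃ (t s : ℝ) (g : ℝ × EE l × EE m → CornerPt l m), ContDiff ℝ ∞ g ∧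
      g (cornerCoord l m t s q) = q ∧
      (∀ᶠ p in 𝓝 (cornerCoord l m t s q), (0 ≤ p.1 → g p ∈ Γ) ∧ cornerCoord l m t s (g p) = p) ∧
      (∀ᶠ a in 𝓝 q, a ∈ Γ → 0 ≤ a.1.1 ∧ g (cornerCoord l m t s a) = a) ∧
      ∀ᶠ p in 𝓝 (cornerCoord l m t s q), p.1 = 0 →
        baseProj (g p) = baseProj (g (0, p.2.1, (cornerCoord l m t s q).2.2)) := by
  obtain ⟨t, s, T, T₁, hT, hT₁, hinj, hinj₁⟩ := h.exists_coord h₁ hq hq0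
  have hq₁ := (h.1 q hq hq0).1
  have hd₁ := h₁.finrank_eq hq₁ hT₁
  obtain ⟨⟨c, F, U, hU, hqU, hF, hS, hsurj, rfl⟩, hTd, -⟩ := hT
  obtain ⟨c₁, F₁, U₁, hU₁, hqU₁, hF₁, hS₁, hsurj₁, rfl⟩ := hT₁
  have hmem : ∀ z ∈ U, z ∈ Γ ↔ 0 ≤ z.1.1 ∧ F z = 0 := by
    intro z hz
    rw [hS z hz]
    simp [xtFun_apply]
  obtain ⟨g, hg, hga, hgp, hgz⟩ := exists_levelSet_chart (Φ := cornerCoord l m t s) hU hqU hF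
    (cornerCoord l m t s).contDiff.contDiffOn ((hmem q hqU).1 hq).2 (by
      rw [ContinuousLinearMap.fderiv]
      refine bijective_prod_of_finrank (fun y => ?_) ?_ fun v h1 h2 => hinj v h1 h2
      · obtain ⟨v, -, hv⟩ := hsurj y
        exact ⟨v, hv⟩
      · rw [hTd]; simp; ring)
  let Φ₁ : ScPt l →L[ℝ] EE l := ((ContinuousLinearMap.snd ℝ _ _).comp
    (ContinuousLinearMap.snd ℝ _ _)) - t • ContinuousLinearMap.fst ℝ _ _
  have hΦ₁ : ∀ b, Φ₁ b = b.2.2 - t • b.1 := fun b => rfl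
  obtain ⟨g₁, -, -, -, hgz₁⟩ := exists_levelSet_chart (Φ := Φ₁) hU₁ hqU₁ hF₁
    Φ₁.contDiff.contDiffOn ((hS₁ _ hqU₁).1 hq₁).2 (by
      rw [ContinuousLinearMap.fderiv]
      refine bijective_prod_of_finrank (fun y => ?_) ?_ fun v h1 h2 => hinj₁ v h1 ?_
      · obtain ⟨v, -, hv⟩ := hsurj₁ y
        exact ⟨v, hv⟩
      · rw [hd₁]; simp
      · rwa [hΦ₁, sub_eq_zero] at h2)
  -- Points of `Γ` over the corner project into `Γ₁`, on which `μ' - t y'` is a local coordinate.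
  -- Hence the projection of `g p` depends on `p.2.1` only.
  have hbase : ∀ᶠ p in 𝓝 (cornerCoord l m t s q), p.1 = 0 → baseProj (g p) = g₁ p.2.1 := by
    have hc : Tendsto (fun p => baseProj (g p)) (𝓝 (cornerCoord l m t s q)) (𝓝 (baseProj q)) := by
      have := ((baseProjL l m).continuous.comp hg.continuous).tendsto (cornerCoord l m t s q)
      rw [Function.comp_apply, hga] at this
      exact this
    filter_upwards [hgp, hc.eventually hgz₁, hc.eventually (hU₁.mem_nhds hqU₁)] with p hp hp1 hp2 hp0
    have hx : (g p).1.1 = p.1 := (eq_of_cornerCoord_eq hp.2.2).1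
    have hΓ : g p ∈ Γ := (hmem _ hp.1).2 ⟨by rw [hx, hp0], hp.2.1⟩
    have hb := (h.1 _ hΓ (hx.trans hp0)).1
    rw [← hp1 ((hS₁ _ hp2).1 hb).2]
    congr 1
    exact congrArg (fun z : ℝ × EE l × EE m => z.2.1) hp.2.2
  refine ⟨t, s, g, hg, hga, ?_, ?_, ?_⟩
  · filter_upwards [hgp] with p hp
    have hx : (g p).1.1 = p.1 := (eq_of_cornerCoord_eq hp.2.2).1
    exact ⟨fun h0 => (hmem _ hp.1).2 ⟨by rwa [hx], hp.2.1⟩, hp.2.2⟩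
  · filter_upwards [hgz, hU.mem_nhds hqU] with a ha haU haΓ
    have := (hmem a haU).1 haΓ
    exact ⟨this.1, ha this.2⟩
  · have hc : Tendsto (fun p : ℝ × EE l × EE m => ((0 : ℝ), p.2.1, (cornerCoord l m t s q).2.2))
        (𝓝 (cornerCoord l m t s q)) (𝓝 (cornerCoord l m t s q)) := by
      have h1 : Continuous fun p : ℝ × EE l × EE m =>
        ((0 : ℝ), p.2.1, (cornerCoord l m t s q).2.2) := by fun_prop
      have h2 := h1.tendsto (cornerCoord l m t s q)
      rwa [show ((0 : ℝ), (cornerCoord l m t s q).2.1, (cornerCoord l m t s q).2.2) =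
        cornerCoord l m t s q from Prod.ext hq0.symm rfl] at h2
    filter_upwards [hbase, hc.eventually hbase] with p hp hp' hp0
    rw [hp hp0, hp' rfl]

/-- The contact form vanishes along maps into a Legendre submanifold. -/
theorem IsCornerLegendreAt.contact_eq_zero {Γ : Set (CornerPt l m)} {a : CornerPt l m}
    {T : Submodule ℝ (CornerPt l m)} (h : IsCornerLegendreAt Γ a T) {X : Type*}
    [NormedAddCommGroup X] [NormedSpace ℝ X] {G : X → CornerPt l m} {p : X}
    (hG : DifferentiableAt ℝ G p) (hp : G p = a) (hev : ∀ᶠ p' in 𝓝 p, G p' ∈ Γ) (u : X) :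
    cornerContact a (fderiv ℝ G p u) = 0 :=
  h.2.2 _ (h.1.fderiv_mem hG hp hev u)

end CornerChart

/-! ### Partial gradients -/

section PartialGradient

open Filter

variable {X V : Type*} [NormedAddCommGroup X] [NormedSpace ℝ X]
  [NormedAddCommGroup V] [InnerProductSpace ℝ V] [CompleteSpace V]

/-- The gradient of `f` in the directions given by `j`. -/
def partialGradient (j : V →L[ℝ] X) (f : X → ℝ) (p : X) : V :=
  (InnerProductSpace.toDual ℝ V).symm ((fderiv ℝ f p).comp j)

theorem inner_partialGradient (j : V →L[ℝ] X) (f : X → ℝ) (p : X) (v : V) :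
    ⟪partialGradient j f p, v⟫_ℝ = fderiv ℝ f p (j v) := by
  rw [partialGradient, InnerProductSpace.toDual_symm_apply]
  rfl

theorem eq_partialGradient {j : V →L[ℝ] X} {f : X → ℝ} {p : X} {y : V}
    (h : ∀ v, fderiv ℝ f p (j v) = ⟪y, v⟫_ℝ) : partialGradient j f p = y :=
  ext_inner_right ℝ fun v => by rw [inner_partialGradient, h]

theorem hasGradientAt_comp {j : V →L[ℝ] X} {f : X → ℝ} {c : V → X} {v : V}
    (hf : DifferentiableAt ℝ f (c v)) (hc : HasFDerivAt c j v) :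
    HasGradientAt (fun v => f (c v)) (partialGradient j f (c v)) v := by
  rw [hasGradientAt_iff_hasFDerivAt, partialGradient, LinearIsometryEquiv.apply_symm_apply]
  exact hf.hasFDerivAt.comp v hc

theorem contDiff_partialGradient (j : V →L[ℝ] X) {f : X → ℝ} (hf : ContDiff ℝ ∞ f) :
    ContDiff ℝ ∞ (partialGradient j f) := by
  have h1 : ContDiff ℝ ∞ (fun p => (fderiv ℝ f p).comp j) :=
    (hf.fderiv_right (by simp)).clm_comp contDiff_const
  exact (InnerProductSpace.toDual ℝ V).symm.toContinuousLinearEquiv.contDiff.comp h1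

theorem partialGradient_congr {j : V →L[ℝ] X} {f f' : X → ℝ} {p : X} (h : f =ᶠ[𝓝 p] f') :
    partialGradient j f p = partialGradient j f' p := by
  rw [partialGradient, partialGradient, h.fderiv_eq]

theorem hasGradientAt_inner_left (y v : V) : HasGradientAt (fun v => ⟪y, v⟫_ℝ) y v := by
  rw [hasGradientAt_iff_hasFDerivAt]
  exact (InnerProductSpace.toDual ℝ V y).hasFDerivAt

theorem hasGradientAt_inner_right (y v : V) : HasGradientAt (fun v => ⟪v, y⟫_ℝ) y v := by
  have := hasGradientAt_inner_left y v
  simpa only [real_inner_comm] using this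

theorem hasGradientAt_half_inner_self (t : ℝ) (v : V) :
    HasGradientAt (fun v => t / 2 * ⟪v, v⟫_ℝ) (t • v) v := by
  rw [hasGradientAt_iff_hasFDerivAt]
  refine (((hasFDerivAt_id v).inner ℝ (hasFDerivAt_id v)).const_mul (t / 2)).congr_fderiv ?_
  ext u
  simp only [InnerProductSpace.toDual_apply_apply, _root_.smul_apply,
    ContinuousLinearMap.comp_apply, fderivInnerCLM_apply, ContinuousLinearMap.prod_apply, id_eq,
    ContinuousLinearMap.id_apply, smul_eq_mul, real_inner_smul_left]
  rw [real_inner_comm u v]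
  ring

theorem _root_.HasGradientAt.add' {f f' : V → ℝ} {a b v : V} (hf : HasGradientAt f a v)
    (hf' : HasGradientAt f' b v) : HasGradientAt (fun z => f z + f' z) (a + b) v := by
  rw [hasGradientAt_iff_hasFDerivAt] at *
  rw [map_add]
  exact hf.add hf'

theorem hasGradientAt_const' (c : ℝ) (v : V) : HasGradientAt (fun _ => c) 0 v := by
  rw [hasGradientAt_iff_hasFDerivAt, map_zero]
  exact hasFDerivAt_const c v

/-- Functionals that are dual to some family of vectors are independent. -/
theorem linearIndependent_of_dual {n : ℕ} {f : Fin n → X →L[ℝ] ℝ} (e : Fin n → X)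
    (h : ∀ i j, f j (e i) = if i = j then 1 else 0) : LinearIndependent ℝ f := by
  rw [Fintype.linearIndependent_iff]
  intro c hc i
  have h1 := DFunLike.congr_fun hc (e i)
  simpa [_root_.sum_apply, h] using h1

end PartialGradient

/-- The derivative in `y` of the components of `A y + R w`. -/
theorem fderiv_add_comp_apply {V : Type*} [NormedAddCommGroup V] [NormedSpace ℝ V] {n k : ℕ}
    (A : V →L[ℝ] EE n) {R : EE k → EE n} (hR : ContDiff ℝ ∞ R) (j : Fin n) (z : V × EE k) (v : V) :
    fderiv ℝ (fun z : V × EE k => (A z.1 + R z.2) j) z (v, 0) = A v j := by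
  have h1 : HasFDerivAt (fun z : V × EE k => A z.1 + R z.2)
      (A.comp (ContinuousLinearMap.fst ℝ V (EE k)) +
        (fderiv ℝ R z.2).comp (ContinuousLinearMap.snd ℝ V (EE k))) z :=
    (A.hasFDerivAt.comp z hasFDerivAt_fst).add
      (((hR.differentiable (by simp)) z.2).hasFDerivAt.comp z hasFDerivAt_snd)
  have h2 := (EuclideanSpace.proj j : EE n →L[ℝ] ℝ).hasFDerivAt.comp z h1
  have h3 : fderiv ℝ (fun z : V × EE k => (A z.1 + R z.2) j) z = _ := h2.fderiv
  rw [h3]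
  simp

/-! ### Parametrization of Legendre submanifolds -/

section Parametrization

open Filter

variable {l m : ℕ}

/-- Inclusion of the second factor. -/
def inclSnd (l m : ℕ) : EE l →L[ℝ] ℝ × EE l × EE m :=
  (ContinuousLinearMap.inr ℝ ℝ (EE l × EE m)).comp (ContinuousLinearMap.inl ℝ (EE l) (EE m))

/-- Inclusion of the third factor. -/
def inclThd (l m : ℕ) : EE m →L[ℝ] ℝ × EE l × EE m :=
  (ContinuousLinearMap.inr ℝ ℝ (EE l × EE m)).comp (ContinuousLinearMap.inr ℝ (EE l) (EE m))

theorem inclSnd_apply (v : EE l) : inclSnd l m v = (0, v, 0) := rfl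

theorem inclThd_apply (v : EE m) : inclThd l m v = (0, 0, v) := rfl

theorem hasFDerivAt_mk_snd (x : ℝ) (w : EE m) (v : EE l) :
    HasFDerivAt (fun v => (x, v, w)) (inclSnd l m) v :=
  (hasFDerivAt_prodMk_right x (v, w)).comp v (hasFDerivAt_prodMk_left v w)

theorem hasFDerivAt_mk_thd (x : ℝ) (v : EE l) (w : EE m) :
    HasFDerivAt (fun w => (x, v, w)) (inclThd l m) w :=
  (hasFDerivAt_prodMk_right x (v, w)).comp w (hasFDerivAt_prodMk_right v w)

theorem hasDerivAt_comp_fst {Y : Type*} [NormedAddCommGroup Y] [NormedSpace ℝ Y] {f : ℝ × Y → ℝ}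
    {x : ℝ} {y : Y} (hf : DifferentiableAt ℝ f (x, y)) :
    HasDerivAt (fun t => f (t, y)) (fderiv ℝ f (x, y) (1, 0)) x := by
  have h := hf.hasFDerivAt.comp_hasDerivAt x ((hasDerivAt_id x).prodMk (hasDerivAt_const x y))
  simpa [Function.comp_def] using h

/-- The generating function of the parametrized Legendre submanifold `g`. -/
def genFun (t s : ℝ) (g : ℝ × EE l × EE m → CornerPt l m) (p : ℝ × EE l × EE m) : ℝ :=
  -(g p).2.1 - ⟪(g p).1.2.1, p.2.1⟫_ℝ - t / 2 * ⟪(g p).1.2.1, (g p).1.2.1⟫_ℝ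
    - p.1 * (⟪(g p).1.2.2, p.2.2⟫_ℝ + s / 2 * ⟪(g p).1.2.2, (g p).1.2.2⟫_ℝ)

theorem contDiff_genFun {t s : ℝ} {g : ℝ × EE l × EE m → CornerPt l m} (hg : ContDiff ℝ ∞ g) :
    ContDiff ℝ ∞ (genFun t s g) := by
  have h1 : ContDiff ℝ ∞ (fun p => (g p).1.2.1) := hg.fst.snd.fst
  have h2 : ContDiff ℝ ∞ (fun p => (g p).1.2.2) := hg.fst.snd.snd
  have h3 : ContDiff ℝ ∞ (fun p => (g p).2.1) := hg.snd.fst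
  have h4 : ContDiff ℝ ∞ (fun p : ℝ × EE l × EE m => p.2.1) := by fun_prop
  have h5 : ContDiff ℝ ∞ (fun p : ℝ × EE l × EE m => p.2.2) := by fun_prop
  exact ((h3.neg.sub (h1.inner ℝ h4)).sub (contDiff_const.mul (h1.inner ℝ h1))).sub
    (contDiff_fst.mul ((h2.inner ℝ h5).add (contDiff_const.mul (h2.inner ℝ h2))))

/-- On the chart `μ' = v + t y'` and `μ'' = w + s y''`. Inserting this into the contact form, the
differentials of `y'` and `y''` along `g` cancel, as in any Legendre transform, and only `dxt`,
`dv`, `dw` survive. -/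
theorem fderiv_genFun {t s : ℝ} {g : ℝ × EE l × EE m → CornerPt l m} (hg : ContDiff ℝ ∞ g)
    {p : ℝ × EE l × EE m} (hcoord : ∀ᶠ p' in 𝓝 p, cornerCoord l m t s (g p') = p')
    (hcontact : ∀ u, cornerContact (g p) (fderiv ℝ g p u) = 0) (u : ℝ × EE l × EE m) :
    fderiv ℝ (genFun t s g) p u = ((g p).2.2.1 - (⟪(g p).1.2.2, p.2.2⟫_ℝ +
      s / 2 * ⟪(g p).1.2.2, (g p).1.2.2⟫_ℝ)) * u.1 - ⟪(g p).1.2.1, u.2.1⟫_ℝ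
      - p.1 * ⟪(g p).1.2.2, u.2.2⟫_ℝ := by
  have hd : HasFDerivAt g (fderiv ℝ g p) p := ((hg.differentiable (by simp)) p).hasFDerivAt
  set G := fderiv ℝ g p with hG
  have h1 := hd.fst.snd.fst
  have h2 := hd.fst.snd.snd
  have h3 := hd.snd.fst
  have h0 : HasFDerivAt (fun p : ℝ × EE l × EE m => p) (ContinuousLinearMap.id ℝ _) p :=
    hasFDerivAt_id p
  have h4 := h0.snd.fst
  have h5 := h0.snd.snd
  have h := ((h3.neg.sub (h1.inner ℝ h4)).sub ((h1.inner ℝ h1).const_mul (t / 2))).sub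
    (h0.fst.mul ((h2.inner ℝ h5).add ((h2.inner ℝ h2).const_mul (s / 2))))
  have h' : fderiv ℝ (genFun t s g) p = _ := h.fderiv
  have hx : (G u).1.1 = u.1 := by
    have e1 := hd.fst.fst
    have e2 : HasFDerivAt (fun p => (g p).1.1) (ContinuousLinearMap.fst ℝ ℝ (EE l × EE m)) p :=
      hasFDerivAt_fst.congr_of_eventuallyEq (hcoord.mono fun p' hp' => (eq_of_cornerCoord_eq hp').1)
    exact DFunLike.congr_fun (e1.unique e2) u
  obtain ⟨c1, c2, c3⟩ := eq_of_cornerCoord_eq hcoord.self_of_nhds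
  have hc := hcontact u
  simp only [cornerContact, c1, c2, c3, hx, inner_add_left, real_inner_smul_left] at hc
  rw [h']
  simp only [_root_.sub_apply, _root_.neg_apply,
    _root_.add_apply, _root_.smul_apply, ContinuousLinearMap.comp_apply,
    fderivInnerCLM_apply, ContinuousLinearMap.prod_apply, ContinuousLinearMap.coe_fst',
    ContinuousLinearMap.coe_snd', ContinuousLinearMap.id_apply, smul_eq_mul,
    Pi.add_apply]
  rw [real_inner_comm p.2.1 (G u).1.2.1, real_inner_comm p.2.2 (G u).1.2.2,
    real_inner_comm (g p).1.2.1 (G u).1.2.1, real_inner_comm (g p).1.2.2 (G u).1.2.2] at *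
  linear_combination -hc

end Parametrization

/-! ### The generating function up to the corner, and the non-degenerate phase function -/

section Parametrization

open Filter

variable {l m : ℕ}

theorem tendsto_mk_snd (x : ℝ) (w : EE m) (v : EE l) :
    Tendsto (fun v => (x, v, w)) (𝓝 v) (𝓝 (x, v, w)) :=
  (by fun_prop : Continuous fun v : EE l => (x, v, w)).tendsto v

/-- The first derivatives of the generating function, up to the corner. -/
theorem partialGradient_genFun {t s : ℝ} {g : ℝ × EE l × EE m → CornerPt l m}
    (hg : ContDiff ℝ ∞ g) {p₀ : ℝ × EE l × EE m}
    (hcoord : ∀ᶠ p in 𝓝 p₀, cornerCoord l m t s (g p) = p)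
    (hcontact : ∀ᶠ p in 𝓝 p₀, 0 < p.1 → ∀ u, cornerContact (g p) (fderiv ℝ g p u) = 0) :
    ∀ᶠ p in 𝓝 p₀, 0 ≤ p.1 →
      fderiv ℝ (genFun t s g) p (1, 0) = (g p).2.2.1 - (⟪(g p).1.2.2, p.2.2⟫_ℝ +
        s / 2 * ⟪(g p).1.2.2, (g p).1.2.2⟫_ℝ) ∧
      partialGradient (inclSnd l m) (genFun t s g) p = -(g p).1.2.1 ∧
      partialGradient (inclThd l m) (genFun t s g) p = -(p.1 • (g p).1.2.2) := by
  have hθ := contDiff_genFun (t := t) (s := s) hg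
  have hopen : ∀ p : ℝ × EE l × EE m, p ∈ {p : ℝ × EE l × EE m | 0 ≤ p.1} → ∀ ε : ℝ, 0 < ε →
      p + ε • ((1 : ℝ), (0 : EE l × EE m)) ∈ {p : ℝ × EE l × EE m | 0 < p.1} := by
    intro p hp ε hε
    simp only [Set.mem_ofPred_eq] at hp ⊢
    simp only [Prod.fst_add, Prod.smul_fst, smul_eq_mul, mul_one]
    linarith
  have hc := hg.continuous
  have hfd : Continuous (fun p => fderiv ℝ (genFun t s g) p (1, 0)) :=
    (hθ.continuous_fderiv (by simp)).clm_apply continuous_const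
  have hp1 := (contDiff_partialGradient (inclSnd l m) hθ).continuous
  have hp2 := (contDiff_partialGradient (inclThd l m) hθ).continuous
  -- The contact condition can be used only for `xt > 0`, where `g` maps a full neighbourhood into
  -- the submanifold; the three identities below are closed conditions and extend to `xt = 0`.
  have hpos : ∀ᶠ p in 𝓝 p₀, 0 < p.1 → ∀ u : ℝ × EE l × EE m,
      fderiv ℝ (genFun t s g) p u = ((g p).2.2.1 - (⟪(g p).1.2.2, p.2.2⟫_ℝ +
        s / 2 * ⟪(g p).1.2.2, (g p).1.2.2⟫_ℝ)) * u.1 - ⟪(g p).1.2.1, u.2.1⟫_ℝ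
        - p.1 * ⟪(g p).1.2.2, u.2.2⟫_ℝ := by
    filter_upwards [hcoord.eventually_nhds, hcontact] with p h1 h2 h3
    exact fderiv_genFun hg h1 (h2 h3)
  have e1 := eventually_eq_zero_of_closure (a := p₀)
    (A := fun p => fderiv ℝ (genFun t s g) p (1, 0) - ((g p).2.2.1 - (⟪(g p).1.2.2, p.2.2⟫_ℝ +
        s / 2 * ⟪(g p).1.2.2, (g p).1.2.2⟫_ℝ))) (by fun_prop) hopen (by
      filter_upwards [hpos] with p h1 h2
      simp [h1 h2])
  have e2 := eventually_eq_zero_of_closure (a := p₀)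
    (A := fun p => partialGradient (inclSnd l m) (genFun t s g) p + (g p).1.2.1) (by fun_prop)
    hopen (by
      filter_upwards [hpos] with p h1 h2
      rw [add_eq_zero_iff_eq_neg]
      refine eq_partialGradient fun v => ?_
      rw [h1 h2, inclSnd_apply]
      simp)
  have e3 := eventually_eq_zero_of_closure (a := p₀)
    (A := fun p => partialGradient (inclThd l m) (genFun t s g) p + p.1 • (g p).1.2.2)
    (by fun_prop) hopen (by
      filter_upwards [hpos] with p h1 h2
      rw [add_eq_zero_iff_eq_neg]
      refine eq_partialGradient fun v => ?_
      rw [h1 h2, inclThd_apply]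
      simp [real_inner_smul_left])
  filter_upwards [e1, e2, e3] with p h1 h2 h3 h0
  exact ⟨sub_eq_zero.1 (h1 h0), add_eq_zero_iff_eq_neg.1 (h2 h0), add_eq_zero_iff_eq_neg.1 (h3 h0)⟩

/-- The generating function splits as `h(v) + xt θ₂(xt, v, w)`. -/
theorem exists_genFun_split {t s : ℝ} {g : ℝ × EE l × EE m → CornerPt l m}
    (hg : ContDiff ℝ ∞ g) {p₀ : ℝ × EE l × EE m} (hp₀ : p₀.1 = 0)
    (hbase : ∀ᶠ p in 𝓝 p₀, p.1 = 0 → baseProj (g p) = baseProj (g (0, p.2.1, p₀.2.2))) :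
    ∃ (h : EE l → ℝ) (θ₂ : ℝ × EE l × EE m → ℝ), ContDiff ℝ ∞ h ∧ ContDiff ℝ ∞ θ₂ ∧
      ∀ᶠ p in 𝓝 p₀, genFun t s g p = h p.2.1 + p.1 * θ₂ p := by
  have hθ := contDiff_genFun (t := t) (s := s) hg
  obtain ⟨θ₂, hθ₂, hsplit⟩ := exists_contDiff_eq_add_smul hθ
    (ContinuousLinearMap.fst ℝ ℝ (EE l × EE m)) ((1 : ℝ), (0 : EE l × EE m))
  -- At `xt = 0` the generating function involves only `τ` and `y'`, which are functions on the base
  -- and so do not depend on `w`. The last variable may therefore be frozen at its value at `p₀`.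
  refine ⟨fun v => genFun t s g (0, v, p₀.2.2), θ₂, hθ.comp (by fun_prop), hθ₂, ?_⟩
  have hc : Tendsto (fun p : ℝ × EE l × EE m => ((0 : ℝ), p.2)) (𝓝 p₀) (𝓝 p₀) := by
    have h2 := (by fun_prop : Continuous fun p : ℝ × EE l × EE m => ((0 : ℝ), p.2)).tendsto p₀
    rwa [show ((0 : ℝ), p₀.2) = p₀ from Prod.ext hp₀.symm rfl] at h2
  filter_upwards [hc.eventually hbase] with p hp
  rw [hsplit p, show p - ContinuousLinearMap.fst ℝ ℝ (EE l × EE m) p • ((1 : ℝ), (0 : EE l × EE m))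
    = (0, p.2) by ext <;> simp]
  have hb := hp rfl
  simp only [baseProj, Prod.mk.injEq] at hb
  simp [genFun, hb.1, hb.2.1]

/-- Near the corner, a fibred Legendre submanifold has a non-degenerate parametrization. -/
theorem IsCornerFibred.exists_isParametrization {Γ : Set (CornerPt l m)} {Γ₁ : Set (ScPt l)}
    (hΓ : ∀ a ∈ Γ, ∃ T, IsCornerLegendreAt Γ a T)
    (hfib : IsCornerFibred Γ Γ₁) (h₁ : IsScLegendre Γ₁) {q : CornerPt l m} (hq : q ∈ Γ)
    (hq0 : q.1.1 = 0) :
    ∃ (k k' : ℕ) (φ₁ : EE l → EE k → ℝ) (φ₂ : ℝ → EE l → EE m → EE k → EE k' → ℝ)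
      (v₀ : EE k) (w₀ : EE k'), IsParametrization Γ q φ₁ φ₂ v₀ w₀ := by
  obtain ⟨t, s, g, hg, hgq, hgp, hga, hbase⟩ := hfib.exists_chart h₁ hq hq0
  set p₀ := cornerCoord l m t s q with hp₀
  have hp₀1 : p₀.1 = 0 := hq0
  have hcontact : ∀ᶠ p in 𝓝 p₀, 0 < p.1 → ∀ u, cornerContact (g p) (fderiv ℝ g p u) = 0 := by
    filter_upwards [hgp.eventually_nhds] with p hp h0 u
    obtain ⟨T, hT⟩ := hΓ _ (hp.self_of_nhds.1 h0.le)
    refine hT.contact_eq_zero ((hg.differentiable (by simp)) p) rfl ?_ u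
    filter_upwards [hp, continuousAt_fst.eventually (lt_mem_nhds h0)] with p' h1 h2
    exact h1.1 (le_of_lt h2)
  have hgrad := partialGradient_genFun hg (hgp.mono fun p hp => hp.2) hcontact
  obtain ⟨h, θ₂, hh, hθ₂, hsplit⟩ := exists_genFun_split (t := t) (s := s) hg hp₀1 hbase
  have hθ := contDiff_genFun (t := t) (s := s) hg
  -- the `w`-gradient of `θ₂`
  have hθ₂w : ∀ᶠ p in 𝓝 p₀, 0 ≤ p.1 → partialGradient (inclThd l m) θ₂ p = -(g p).1.2.2 := by
    have e := eventually_eq_zero_of_closure (a := p₀) (u := ((1 : ℝ), (0 : EE l × EE m)))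
      (A := fun p => partialGradient (inclThd l m) θ₂ p + (g p).1.2.2)
      (R := {p : ℝ × EE l × EE m | 0 < p.1}) (R' := {p : ℝ × EE l × EE m | 0 ≤ p.1})
      ((contDiff_partialGradient _ hθ₂).continuous.add hg.continuous.fst.snd.snd)
      (fun p hp ε hε => by
        simp only [Set.mem_ofPred_eq] at hp ⊢
        simp only [Prod.fst_add, Prod.smul_fst, smul_eq_mul, mul_one]
        linarith)
      (by
        filter_upwards [hgrad, hsplit.eventually_nhds] with p h1 h2 h0
        have h0 : 0 < p.1 := h0
        have h3 := (h1 h0.le).2.2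
        -- The term `h` does not involve `w`, so `∂_w θ = -xt Y''` becomes `xt ∂_w θ₂ = -xt Y''`.
        -- The factor `xt > 0` is cancelled before passing to the closure.
        rw [partialGradient_congr h2] at h3
        have h4 : partialGradient (inclThd l m) (fun p => h p.2.1 + p.1 * θ₂ p) p =
            p.1 • partialGradient (inclThd l m) θ₂ p := by
          refine eq_partialGradient fun v => ?_
          have e0 : HasFDerivAt (fun p : ℝ × EE l × EE m => p) (ContinuousLinearMap.id ℝ _) p :=
            hasFDerivAt_id p
          have e1 := (((hh.differentiable (by simp)) p.2.1).hasFDerivAt.comp p e0.snd.fst).add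
            (e0.fst.mul ((hθ₂.differentiable (by simp)) p).hasFDerivAt)
          have e2 : fderiv ℝ (fun p => h p.2.1 + p.1 * θ₂ p) p = _ := e1.fderiv
          rw [e2, real_inner_smul_left, inner_partialGradient]
          simp [inclThd_apply]
        rw [h4, ← smul_neg] at h3
        rw [add_eq_zero_iff_eq_neg]
        exact smul_right_injective _ h0.ne' h3)
    filter_upwards [e] with p hp h0
    exact add_eq_zero_iff_eq_neg.1 (hp h0)
  -- The inverse Legendre transform. The phase variables `v`, `w` correspond on `Γ` to `μ' - t y'`
  -- and `μ'' - s y''`, whence `k = l` and `k' = m`.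
  set φ₁ : EE l → EE l → ℝ := fun y' v => ⟪y', v⟫_ℝ + t / 2 * ⟪y', y'⟫_ℝ + h v with hφ₁
  set φ₂ : ℝ → EE l → EE m → EE l → EE m → ℝ := fun xt _ y'' v w =>
    ⟪y'', w⟫_ℝ + s / 2 * ⟪y'', y''⟫_ℝ + θ₂ (xt, v, w) with hφ₂
  have hgradv : ∀ᶠ p in 𝓝 p₀, 0 ≤ p.1 → ∀ (y' : EE l) (y'' : EE m),
      gradient (fun v => φ₁ y' v + p.1 * φ₂ p.1 y' y'' v p.2.2) p.2.1 = y' - (g p).1.2.1 := by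
    filter_upwards [hgrad, hsplit.eventually_nhds] with p h1 h2 h0 y' y''
    have e1 := (hasGradientAt_inner_left y' p.2.1).add' ((hasGradientAt_const'
      (t / 2 * ⟪y', y'⟫_ℝ + p.1 * (⟪y'', p.2.2⟫_ℝ + s / 2 * ⟪y'', y''⟫_ℝ)) p.2.1).add'
      (hasGradientAt_comp (f := genFun t s g) ((hθ.differentiable (by simp)) _)
        (hasFDerivAt_mk_snd p.1 p.2.2 p.2.1)))
    have e2 := e1.congr_of_eventuallyEq (f₁ := fun v => φ₁ y' v + p.1 * φ₂ p.1 y' y'' v p.2.2) (by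
      filter_upwards [(tendsto_mk_snd p.1 p.2.2 p.2.1).eventually h2] with v hv
      simp only [hφ₁, hφ₂, hv]
      ring)
    rw [e2.gradient, (h1 h0).2.1]
    abel
  have hgradw : ∀ᶠ p in 𝓝 p₀, 0 ≤ p.1 → ∀ (y' : EE l) (y'' : EE m),
      gradient (fun w => φ₂ p.1 y' y'' p.2.1 w) p.2.2 = y'' - (g p).1.2.2 := by
    filter_upwards [hθ₂w] with p h1 h0 y' y''
    have e1 := ((hasGradientAt_inner_left y'' p.2.2).add' (hasGradientAt_const'
      (s / 2 * ⟪y'', y''⟫_ℝ) p.2.2)).add'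
      (hasGradientAt_comp (f := θ₂) ((hθ₂.differentiable (by simp)) _)
        (hasFDerivAt_mk_thd p.1 p.2.1 p.2.2))
    rw [HasGradientAt.gradient (f := fun w => φ₂ p.1 y' y'' p.2.1 w) e1, h1 h0]
    abel
  -- At the critical base point `(Y', Y'')` the differential of the phase returns the point `g p`:
  -- its four entries are the definition of `θ`, the `xt`-derivative of `θ`, and `μ' = v + t Y'`,
  -- `μ'' = w + s Y''`.
  have hdiff : ∀ᶠ p in 𝓝 p₀, 0 ≤ p.1 → cornerDiff (fun y' => φ₁ y' p.2.1)
      (fun t y' y'' => φ₂ t y' y'' p.2.1 p.2.2) p.1 (g p).1.2.1 (g p).1.2.2 = g p := by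
    filter_upwards [hgrad, hsplit.eventually_nhds, hgp] with p h1 h2 h3 h0
    obtain ⟨c1, c2, c3⟩ := eq_of_cornerCoord_eq h3.2
    have d1 : deriv (fun r => φ₁ (g p).1.2.1 p.2.1 +
        r * φ₂ r (g p).1.2.1 (g p).1.2.2 p.2.1 p.2.2) p.1 = (g p).2.2.1 := by
      have e1 := (((hasDerivAt_id p.1).mul_const (⟪(g p).1.2.2, p.2.2⟫_ℝ +
        s / 2 * ⟪(g p).1.2.2, (g p).1.2.2⟫_ℝ)).const_add (⟪(g p).1.2.1, p.2.1⟫_ℝ +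
        t / 2 * ⟪(g p).1.2.1, (g p).1.2.1⟫_ℝ)).add
        (hasDerivAt_comp_fst (f := genFun t s g) ((hθ.differentiable (by simp)) (p.1, p.2)))
      have e2 : HasDerivAt (fun r => φ₁ (g p).1.2.1 p.2.1 +
        r * φ₂ r (g p).1.2.1 (g p).1.2.2 p.2.1 p.2.2) _ p.1 := e1.congr_of_eventuallyEq (by
          have hc : Tendsto (fun r : ℝ => (r, p.2)) (𝓝 p.1) (𝓝 p) :=
            (by fun_prop : Continuous fun r : ℝ => (r, p.2)).tendsto p.1
          filter_upwards [hc.eventually h2] with r hr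
          simp only [hφ₁, hφ₂, hr, Pi.add_apply, id_eq]
          ring)
      rw [e2.deriv, (h1 h0).1]
      ring
    have d2 : gradient (fun z => φ₁ z p.2.1 + p.1 * φ₂ p.1 z (g p).1.2.2 p.2.1 p.2.2)
        (g p).1.2.1 = (g p).2.2.2.1 := by
      have e1 := ((hasGradientAt_inner_right p.2.1 (g p).1.2.1).add'
        (hasGradientAt_half_inner_self t (g p).1.2.1)).add' (hasGradientAt_const'
        (h p.2.1 + p.1 * φ₂ p.1 (g p).1.2.1 (g p).1.2.2 p.2.1 p.2.2) (g p).1.2.1)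
      have e2 := e1.congr_of_eventuallyEq (f₁ := fun z => φ₁ z p.2.1 +
        p.1 * φ₂ p.1 z (g p).1.2.2 p.2.1 p.2.2) (Eventually.of_forall fun z => by
          simp only [hφ₁, hφ₂]; ring)
      rw [e2.gradient, c2, add_zero]
    have d3 : gradient (fun z => φ₂ p.1 (g p).1.2.1 z p.2.1 p.2.2) (g p).1.2.2
        = (g p).2.2.2.2 := by
      have e1 := ((hasGradientAt_inner_right p.2.2 (g p).1.2.2).add'
        (hasGradientAt_half_inner_self s (g p).1.2.2)).add' (hasGradientAt_const'
        (θ₂ p) (g p).1.2.2)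
      rw [HasGradientAt.gradient (f := fun z => φ₂ p.1 (g p).1.2.1 z p.2.1 p.2.2) e1, c3, add_zero]
    have d4 : -(φ₁ (g p).1.2.1 p.2.1 +
        p.1 * φ₂ p.1 (g p).1.2.1 (g p).1.2.2 p.2.1 p.2.2) = (g p).2.1 := by
      have e := h2.self_of_nhds
      simp only [genFun] at e
      simp only [hφ₁, hφ₂]
      linear_combination e
    simp only [cornerDiff, d1, d2, d3, d4]
    exact Prod.ext (Prod.ext c1.symm rfl) rfl
  obtain ⟨N, hN, hNo, hp₀N⟩ := eventually_nhds_iff.1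
    (hgradv.and (hgradw.and (hdiff.and hgp)))
  have hpe : ((0 : ℝ), p₀.2.1, p₀.2.2) = p₀ := Prod.ext hp₀1.symm rfl
  refine ⟨l, m, φ₁, φ₂, p₀.2.1, p₀.2.2, Set.univ,
    (fun z : ℝ × EE l × EE m × EE l × EE m => (z.1, z.2.2.2.1, z.2.2.2.2)) ⁻¹' N, isOpen_univ,
    hNo.preimage (by fun_prop), trivial, ?_, fun _ _ => trivial, ?_, ?_, ?_, ?_, ?_, ?_, ?_, ?_⟩
  · change ((0 : ℝ), p₀.2.1, p₀.2.2) ∈ N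
    rw [hpe]; exact hp₀N
  · refine ContDiff.contDiffOn ?_
    have h1 : ContDiff ℝ ∞ fun z : EE l × EE l => z.1 := contDiff_fst
    exact ((h1.inner ℝ contDiff_snd).add (contDiff_const.mul (h1.inner ℝ h1))).add
      (hh.comp contDiff_snd)
  · refine ContDiff.contDiffOn ?_
    have h1 : ContDiff ℝ ∞ fun z : ℝ × EE l × EE m × EE l × EE m => z.2.2.1 := by fun_prop
    have h2 : ContDiff ℝ ∞ fun z : ℝ × EE l × EE m × EE l × EE m => z.2.2.2.2 := by fun_prop
    have h3 : ContDiff ℝ ∞ fun z : ℝ × EE l × EE m × EE l × EE m =>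
      (z.1, z.2.2.2.1, z.2.2.2.2) := by fun_prop
    exact ((h1.inner ℝ h2).add (contDiff_const.mul (h1.inner ℝ h1))).add (hθ₂.comp h3)
  · have := (hN p₀ hp₀N).2.2.1 hp₀1.ge
    rw [hgq, hp₀1] at this
    exact this.symm
  · have := (hN p₀ hp₀N).1 hp₀1.ge q.1.2.1 q.1.2.2
    rw [hgq, hp₀1] at this
    simpa using this
  · have := (hN p₀ hp₀N).2.1 hp₀1.ge q.1.2.1 q.1.2.2
    rw [hgq, hp₀1, sub_self] at this
    exact this
  · have hfun : ∀ (j : Fin l) (z : EE l × EE l), gradient (fun v => φ₁ z.1 v) z.2 j =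
        (ContinuousLinearMap.id ℝ (EE l) z.1 +
          partialGradient (ContinuousLinearMap.id ℝ (EE l)) h z.2) j := by
      intro j z
      have e1 := ((hasGradientAt_inner_left z.1 z.2).add' (hasGradientAt_const'
        (t / 2 * ⟪z.1, z.1⟫_ℝ) z.2)).add' (hasGradientAt_comp (f := h)
        ((hh.differentiable (by simp)) _) (hasFDerivAt_id z.2))
      rw [HasGradientAt.gradient (f := fun v => φ₁ z.1 v) e1, add_zero]
      rfl
    -- The `y'`-part of `d(∂φ₁/∂v_j)` is `dy'_j`, so the coordinate directions of `y'` form a dual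
    -- family; the variables `v` are not needed.
    refine linearIndependent_of_dual (fun i => (EuclideanSpace.single i 1, 0)) fun i j => ?_
    rw [funext (hfun j), fderiv_add_comp_apply _ (contDiff_partialGradient _ hh)]
    simp [PiLp.single_apply, eq_comm]
  · have hfun : ∀ (j : Fin m) (z : EE m × EE m),
        gradient (fun w => φ₂ 0 q.1.2.1 z.1 p₀.2.1 w) z.2 j =
        (ContinuousLinearMap.id ℝ (EE m) z.1 +
          (fun w => partialGradient (inclThd l m) θ₂ (0, p₀.2.1, w)) z.2) j := by
      intro j z
      have e1 := ((hasGradientAt_inner_left z.1 z.2).add' (hasGradientAt_const'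
        (s / 2 * ⟪z.1, z.1⟫_ℝ) z.2)).add' (hasGradientAt_comp (f := θ₂)
        ((hθ₂.differentiable (by simp)) _) (hasFDerivAt_mk_thd 0 p₀.2.1 z.2))
      rw [HasGradientAt.gradient (f := fun w => φ₂ 0 q.1.2.1 z.1 p₀.2.1 w) e1, add_zero]
      rfl
    refine linearIndependent_of_dual (fun i => (EuclideanSpace.single i 1, 0)) fun i j => ?_
    have hR : ContDiff ℝ ∞ (fun w => partialGradient (inclThd l m) θ₂ (0, p₀.2.1, w)) :=
      (contDiff_partialGradient (inclThd l m) hθ₂).comp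
        (by fun_prop : ContDiff ℝ ∞ fun w : EE m => ((0 : ℝ), p₀.2.1, w))
    rw [funext (hfun j), fderiv_add_comp_apply _ hR]
    simp [PiLp.single_apply, eq_comm]
  · have hcN : ∀ᶠ a in 𝓝 q, cornerCoord l m t s a ∈ N :=
      (cornerCoord l m t s).continuous.continuousAt.eventually (hNo.mem_nhds hp₀N)
    obtain ⟨O, hO, hOo, hqO⟩ := eventually_nhds_iff.1 (hga.and hcN)
    refine ⟨O, hOo, hqO, fun a ha => ⟨fun haΓ => ?_, ?_⟩⟩
    · obtain ⟨h1, h2⟩ := hO a ha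
      obtain ⟨h0, h3⟩ := h1 haΓ
      obtain ⟨n1, n2, n3, -⟩ := hN _ h2
      refine ⟨a.1.1, a.1.2.1, a.1.2.2, (cornerCoord l m t s a).2.1, (cornerCoord l m t s a).2.2,
        h2, h0, ?_, ?_, ?_⟩
      · have := n1 h0 a.1.2.1 a.1.2.2
        rw [h3, sub_self] at this
        exact this
      · have := n2 h0 a.1.2.1 a.1.2.2
        rw [h3, sub_self] at this
        exact this
      · have := n3 h0
        rw [h3] at this
        exact this.symm
    · rintro ⟨xt, y', y'', v, w, hU, h0, hv, hw, rfl⟩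
      -- Conversely, the critical equations say that `y'` and `y''` are those of `g (xt, v, w)`, and
      -- this point belongs to `Γ`.
      obtain ⟨n1, n2, n3, n4⟩ := hN (xt, v, w) hU
      have f1 := (n1 h0 y' y'').symm.trans hv
      have f2 := (n2 h0 y' y'').symm.trans hw
      rw [sub_eq_zero] at f1 f2
      have f3 := n3 h0
      rw [← f1, ← f2] at f3
      have f4 := n4.1 h0
      rw [← f3] at f4
      exact f4

end Parametrization

/-! ### Sections and blow-ups -/

section Section

open Filter

variable {l m : ℕ}

/-- The coefficients `(η, μ', μ'')` of `d(f/x)` for `f = f₁(y') + xt f₂(xt, y', y'')`. -/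
def graphCovec (f₁ : EE l → ℝ) (f₂ : Corner l m → ℝ) (b : Corner l m) : Corner l m :=
  (f₂ b + b.1 * fderiv ℝ f₂ b (1, 0),
    partialGradient (ContinuousLinearMap.id ℝ (EE l)) f₁ b.2.1 +
      b.1 • partialGradient (inclSnd l m) f₂ b,
    partialGradient (inclThd l m) f₂ b)

theorem contDiff_graphCovec {f₁ : EE l → ℝ} {f₂ : Corner l m → ℝ} (h₁ : ContDiff ℝ ∞ f₁)
    (h₂ : ContDiff ℝ ∞ f₂) : ContDiff ℝ ∞ (graphCovec f₁ f₂) := by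
  have e1 : ContDiff ℝ ∞ (fun b : Corner l m => fderiv ℝ f₂ b (1, 0)) :=
    (h₂.fderiv_right (by simp)).clm_apply contDiff_const
  have e2 : ContDiff ℝ ∞ (fun b : Corner l m => b.2.1) := by fun_prop
  exact (h₂.add (contDiff_fst.mul e1)).prodMk
    ((((contDiff_partialGradient _ h₁).comp e2).add
      (contDiff_fst.smul (contDiff_partialGradient _ h₂))).prodMk (contDiff_partialGradient _ h₂))

/-- Rewriting the one-variable derivatives as components of Fréchet derivatives makes the smooth
dependence of the covector on the base point available. -/
theorem cornerDiff_eq {f₁ : EE l → ℝ} {f₂ : Corner l m → ℝ} (h₁ : ContDiff ℝ ∞ f₁)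
    (h₂ : ContDiff ℝ ∞ f₂) (b : Corner l m) :
    cornerDiff f₁ (fun t y' y'' => f₂ (t, y', y'')) b.1 b.2.1 b.2.2 =
      (b, -(f₁ b.2.1 + b.1 * f₂ b), graphCovec f₁ f₂ b) := by
  have d₂ := h₂.differentiable (n := ∞) (by simp)
  have d₁ := h₁.differentiable (n := ∞) (by simp)
  have e1 : deriv (fun t => f₁ b.2.1 + t * f₂ (t, b.2.1, b.2.2)) b.1 =
      f₂ b + b.1 * fderiv ℝ f₂ b (1, 0) := by
    have h := ((hasDerivAt_id b.1).mul (hasDerivAt_comp_fst (d₂ (b.1, b.2)))).const_add (f₁ b.2.1)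
    have h' : HasDerivAt (fun t => f₁ b.2.1 + t * f₂ (t, b.2.1, b.2.2)) _ b.1 := h
    rw [h'.deriv]
    simp
  have e2 : gradient (fun z => f₁ z + b.1 * f₂ (b.1, z, b.2.2)) b.2.1 =
      partialGradient (ContinuousLinearMap.id ℝ (EE l)) f₁ b.2.1 +
        b.1 • partialGradient (inclSnd l m) f₂ b := by
    have g1 := hasGradientAt_comp (f := f₁) (c := fun z => z) (d₁ b.2.1) (hasFDerivAt_id b.2.1)
    have g2 := hasGradientAt_comp (f := f₂) (c := fun z => (b.1, z, b.2.2))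
      (d₂ (b.1, b.2.1, b.2.2)) (hasFDerivAt_mk_snd b.1 b.2.2 b.2.1)
    have g3 : HasGradientAt (fun z => b.1 * f₂ (b.1, z, b.2.2))
        (b.1 • partialGradient (inclSnd l m) f₂ b) b.2.1 := by
      rw [hasGradientAt_iff_hasFDerivAt] at g2 ⊢
      rw [map_smul]
      exact g2.const_mul b.1
    exact (g1.add' g3).gradient
  have e3 : gradient (fun z => f₂ (b.1, b.2.1, z)) b.2.2 = partialGradient (inclThd l m) f₂ b :=
    (hasGradientAt_comp (f := f₂) (c := fun z => (b.1, b.2.1, z)) (d₂ (b.1, b.2.1, b.2.2))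
      (hasFDerivAt_mk_thd b.1 b.2.1 b.2.2)).gradient
  simp only [cornerDiff, e1, e2, e3, graphCovec]

/-- The differential of `f₁ + xt f₂` in terms of the coefficients of `d(f/x)`. -/
theorem hasFDerivAt_section {f₁ : EE l → ℝ} {f₂ : Corner l m → ℝ} (h₁ : ContDiff ℝ ∞ f₁)
    (h₂ : ContDiff ℝ ∞ f₂) (b : Corner l m) :
    ∃ L : Corner l m →L[ℝ] ℝ, HasFDerivAt (fun b : Corner l m => f₁ b.2.1 + b.1 * f₂ b) L b ∧
      ∀ u, L u = (graphCovec f₁ f₂ b).1 * u.1 + ⟪(graphCovec f₁ f₂ b).2.1, u.2.1⟫_ℝ +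
        b.1 * ⟪(graphCovec f₁ f₂ b).2.2, u.2.2⟫_ℝ := by
  have d₂ := h₂.differentiable (n := ∞) (by simp)
  have d₁ := h₁.differentiable (n := ∞) (by simp)
  have e0 : HasFDerivAt (fun b : Corner l m => b) (ContinuousLinearMap.id ℝ _) b :=
    hasFDerivAt_id b
  refine ⟨_, ((d₁ b.2.1).hasFDerivAt.comp b e0.snd.fst).add (e0.fst.mul (d₂ b).hasFDerivAt),
    fun u => ?_⟩
  have hu : fderiv ℝ f₂ b u = fderiv ℝ f₂ b (1, 0) * u.1 +
      fderiv ℝ f₂ b (inclSnd l m u.2.1) + fderiv ℝ f₂ b (inclThd l m u.2.2) := by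
    rw [mul_comm, ← smul_eq_mul, ← map_smul, ← map_add, ← map_add]
    congr 1
    ext <;> simp [inclSnd_apply, inclThd_apply]
  simp only [graphCovec, inner_add_left, real_inner_smul_left, inner_partialGradient,
    ContinuousLinearMap.id_apply, _root_.add_apply, _root_.smul_apply,
    ContinuousLinearMap.comp_apply, ContinuousLinearMap.coe_fst', ContinuousLinearMap.coe_snd',
    smul_eq_mul, hu]
  ring

/-- The functions defining a section may be taken smooth everywhere. -/
theorem IsCornerGraphOn.exists_contDiff {Γs : Set (CornerPt l m)} {W₁ : Set (EE l)}
    {W : Set (Corner l m)} {f₁ : EE l → ℝ} {f₂ : ℝ → EE l → EE m → ℝ}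
    (h : IsCornerGraphOn Γs W₁ W f₁ f₂) {b : Corner l m} (hb : b ∈ W) :
    ∃ (W₁' : Set (EE l)) (W' : Set (Corner l m)) (f₁' : EE l → ℝ) (f₂' : Corner l m → ℝ),
      ContDiff ℝ ∞ f₁' ∧ ContDiff ℝ ∞ f₂' ∧ b ∈ W' ∧
      IsCornerGraphOn Γs W₁' W' f₁' (fun t y' y'' => f₂' (t, y', y'')) := by
  obtain ⟨hW₁, hW, hWW, hf₁, hf₂, hΓ⟩ := h
  obtain ⟨f₁', hf₁', he₁⟩ := exists_contDiff_eventuallyEq hW₁ hf₁ (hWW b hb)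
  obtain ⟨f₂', hf₂', he₂⟩ := exists_contDiff_eventuallyEq hW hf₂ hb
  obtain ⟨N₁, hN₁, hN₁o, hbN₁⟩ := eventually_nhds_iff.1 he₁
  obtain ⟨N₂, hN₂, hN₂o, hbN₂⟩ := eventually_nhds_iff.1 (he₂.and (hW.mem_nhds hb))
  refine ⟨N₁, N₂ ∩ (fun b : Corner l m => b.2.1) ⁻¹' N₁, f₁', f₂', hf₁', hf₂', ⟨hbN₂, hbN₁⟩,
    hN₁o, hN₂o.inter (hN₁o.preimage (by fun_prop)), fun b hb => hb.2, hf₁'.contDiffOn,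
    hf₂'.contDiffOn, fun c hc hc0 τ ζ => ?_⟩
  rw [hΓ c (hN₂ c hc.1).2 hc0]
  suffices cornerDiff f₁ f₂ c.1 c.2.1 c.2.2 =
      cornerDiff f₁' (fun t y' y'' => f₂' (t, y', y'')) c.1 c.2.1 c.2.2 by rw [this]
  have a₁ : ∀ᶠ y in 𝓝 c.2.1, f₁' y = f₁ y := by
    filter_upwards [hN₁o.mem_nhds hc.2] with y hy using hN₁ y hy
  have a₂ : ∀ᶠ z in 𝓝 c, f₂' z = f₂ z.1 z.2.1 z.2.2 := by
    filter_upwards [hN₂o.mem_nhds hc.1] with y hy using (hN₂ y hy).1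
  have t1 : Tendsto (fun t : ℝ => (t, c.2.1, c.2.2)) (𝓝 c.1) (𝓝 c) :=
    (by fun_prop : Continuous fun t : ℝ => (t, c.2.1, c.2.2)).tendsto c.1
  have t2 : Tendsto (fun z : EE l => (c.1, z, c.2.2)) (𝓝 c.2.1) (𝓝 c) :=
    (by fun_prop : Continuous fun z : EE l => (c.1, z, c.2.2)).tendsto c.2.1
  have t3 : Tendsto (fun z : EE m => (c.1, c.2.1, z)) (𝓝 c.2.2) (𝓝 c) :=
    (by fun_prop : Continuous fun z : EE m => (c.1, c.2.1, z)).tendsto c.2.2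
  have b1 : (fun t => f₁ c.2.1 + t * f₂ t c.2.1 c.2.2) =ᶠ[𝓝 c.1]
      fun t => f₁' c.2.1 + t * f₂' (t, c.2.1, c.2.2) := by
    filter_upwards [t1.eventually a₂] with t ht
    rw [ht, a₁.self_of_nhds]
  have b2 : (fun z => f₁ z + c.1 * f₂ c.1 z c.2.2) =ᶠ[𝓝 c.2.1]
      fun z => f₁' z + c.1 * f₂' (c.1, z, c.2.2) := by
    filter_upwards [a₁, t2.eventually a₂] with z h1 h2
    rw [h2, h1]
  have b3 : (fun z => f₂ c.1 c.2.1 z) =ᶠ[𝓝 c.2.2] fun z => f₂' (c.1, c.2.1, z) := by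
    filter_upwards [t3.eventually a₂] with z h2
    rw [h2]
  have hb1 := b1.self_of_nhds
  simp only at hb1
  simp only [cornerDiff, gradient, b1.deriv_eq, b2.fderiv_eq, b3.fderiv_eq, hb1]

/-- If the corner part of a section has the base `Γ₁`, then `Γ₁` is a section, too. -/
theorem IsCornerGraphOn.base_eq {Γs : Set (CornerPt l m)} {Γ₁ : Set (ScPt l)} {W₁ : Set (EE l)}
    {W : Set (Corner l m)} {f₁ : EE l → ℝ} {f₂ : Corner l m → ℝ} (h₁ : ContDiff ℝ ∞ f₁)
    (h₂ : ContDiff ℝ ∞ f₂)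
    (h : IsCornerGraphOn Γs W₁ W f₁ (fun t y' y'' => f₂ (t, y', y'')))
    (hfib : IsCornerFibred Γs Γ₁) (hΓ₁ : IsScLegendre Γ₁) {b : Corner l m} (hb : b ∈ W)
    (hb0 : b.1 = 0) :
    ∀ᶠ z in 𝓝 ((b.2.1, -f₁ b.2.1,
        partialGradient (ContinuousLinearMap.id ℝ (EE l)) f₁ b.2.1) : ScPt l), z ∈ Γ₁ →
      z.2.1 = -f₁ z.1 ∧ z.2.2 = partialGradient (ContinuousLinearMap.id ℝ (EE l)) f₁ z.1 := by
  -- The graph of `d(f₁/x)`. It is the base projection of the section over the corner and hence lies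
  -- in `Γ₁`.
  set j : EE l → ScPt l := fun y => (y, -f₁ y,
    partialGradient (ContinuousLinearMap.id ℝ (EE l)) f₁ y) with hj
  have hjs : ContDiff ℝ ∞ j :=
    contDiff_id.prodMk (h₁.neg.prodMk (contDiff_partialGradient _ h₁))
  have hjΓ : ∀ᶠ y in 𝓝 b.2.1, j y ∈ Γ₁ := by
    have t2 : Tendsto (fun z : EE l => (b.1, z, b.2.2)) (𝓝 b.2.1) (𝓝 b) :=
      (by fun_prop : Continuous fun z : EE l => (b.1, z, b.2.2)).tendsto b.2.1
    filter_upwards [t2.eventually (h.2.1.mem_nhds hb)] with y hy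
    have h1 := (h.2.2.2.2.2 _ hy hb0.ge _ _).2 (cornerDiff_eq h₁ h₂ (b.1, y, b.2.2)).symm
    have h2 := (hfib.1 _ h1 hb0).1
    simp only [baseProj, graphCovec, hb0, zero_mul, add_zero, zero_smul] at h2
    exact h2
  have hb₁ := hjΓ.self_of_nhds
  obtain ⟨T, hT, hTd, -⟩ := hΓ₁ _ hb₁
  have hTmem := hT.fderiv_mem ((hjs.differentiable (by simp)) b.2.1) rfl hjΓ
  have hj1 : ∀ u, (fderiv ℝ j b.2.1 u).1 = u := by
    intro u
    have e1 := ((hjs.differentiable (by simp)) b.2.1).hasFDerivAt.fst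
    exact DFunLike.congr_fun (e1.unique (hasFDerivAt_id b.2.1)) u
  let J : EE l →ₗ[ℝ] ScPt l := (fderiv ℝ j b.2.1).toLinearMap
  have hJinj : Function.Injective J := fun u u' huu => by
    rw [← hj1 u, ← hj1 u']
    exact congrArg Prod.fst huu
  -- Both spaces have dimension `l`, so the tangent space of `Γ₁` is that of the graph and `y'` is a
  -- local coordinate on `Γ₁`.
  have hrange : LinearMap.range J = T := by
    refine Submodule.eq_of_le_of_finrank_eq ?_ ?_
    · rintro _ ⟨u, rfl⟩
      exact hTmem u
    · rw [LinearMap.finrank_range_of_inj hJinj, hTd]; simp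
  obtain ⟨c, F, U, hU, hbU, hF, hS, hsurj, rfl⟩ := hT
  obtain ⟨g, -, -, -, hgz⟩ := exists_levelSet_chart
    (Φ := ContinuousLinearMap.fst ℝ (EE l) (ℝ × EE l)) hU hbU hF
    (ContinuousLinearMap.contDiff _).contDiffOn ((hS _ hbU).1 hb₁).2 (by
      rw [ContinuousLinearMap.fderiv]
      refine bijective_prod_of_finrank (fun y => ?_) ?_ fun v h1 h2 => ?_
      · obtain ⟨v, -, hv⟩ := hsurj y
        exact ⟨v, hv⟩
      · rw [hTd]; simp
      · obtain ⟨u, rfl⟩ : v ∈ LinearMap.range J := by rw [hrange]; exact h1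
        have h3 : (fderiv ℝ j b.2.1 u).1 = 0 := h2
        rw [hj1] at h3
        rw [h3, map_zero])
  have hjc : Tendsto (fun z : ScPt l => j z.1) (𝓝 (j b.2.1)) (𝓝 (j b.2.1)) :=
    (hjs.continuous.comp continuous_fst).tendsto (j b.2.1)
  have hfst : Tendsto (fun z : ScPt l => z.1) (𝓝 (j b.2.1)) (𝓝 b.2.1) :=
    continuous_fst.tendsto (j b.2.1)
  filter_upwards [hgz, hjc.eventually hgz, hfst.eventually hjΓ, hU.mem_nhds hbU,
    hjc.eventually (hU.mem_nhds hbU)] with z z1 z2 z3 z4 z5 z6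
  -- The points `z` and `j z.1` both lie on `Γ₁` over the same `y'`, hence coincide.
  have e1 := z1 ((hS _ z4).1 z6).2
  have e2 := z2 ((hS _ z5).1 z3).2
  have e3 : z = j z.1 := e1.symm.trans e2
  exact ⟨congrArg (fun a : ScPt l => a.2.1) e3, congrArg (fun a : ScPt l => a.2.2) e3⟩

end Section

/-! ### Division by `xt` and `s` on a quadrant, and the contact form at its corner -/

section DoubleDivision

open Filter

variable {Z : Type} [NormedAddCommGroup Z] [NormedSpace ℝ Z]

theorem quadrant_add_mem (p : (ℝ × ℝ) × Z) (hp : p ∈ {p : (ℝ × ℝ) × Z | 0 ≤ p.1.1 ∧ 0 ≤ p.1.2})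
    (ε : ℝ) (hε : 0 < ε) : p + ε • ((1, 1), (0 : Z)) ∈ {p : (ℝ × ℝ) × Z | 0 < p.1.1 ∧ 0 < p.1.2} := by
  simp only [Set.mem_ofPred_eq] at hp ⊢
  simp only [Prod.fst_add, Prod.snd_add, Prod.smul_fst, Prod.smul_snd, smul_eq_mul, mul_one]
  exact ⟨by linarith, by linarith⟩

/-- A smooth function that vanishes for `xt = 0 < s` is, for `s ≥ 0`, a multiple of `xt`. -/
theorem exists_contDiff_eq_fst_smul [FiniteDimensional ℝ Z] {V : Type} [NormedAddCommGroup V]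
    [NormedSpace ℝ V] [CompleteSpace V] {f : (ℝ × ℝ) × Z → V} (hf : ContDiff ℝ ∞ f) {z₀ : Z}
    (h0 : ∀ᶠ p in 𝓝 ((0 : ℝ × ℝ), z₀), 0 < p.1.2 → p.1.1 = 0 → f p = 0) :
    ∃ h : (ℝ × ℝ) × Z → V, ContDiff ℝ ∞ h ∧
      ∀ᶠ p in 𝓝 ((0 : ℝ × ℝ), z₀), 0 ≤ p.1.2 → f p = p.1.1 • h p := by
  obtain ⟨h, hh, hfh⟩ := exists_contDiff_eq_add_smul hf
    ((ContinuousLinearMap.fst ℝ ℝ ℝ).comp (ContinuousLinearMap.fst ℝ (ℝ × ℝ) Z))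
    (((1, 0), 0) : (ℝ × ℝ) × Z)
  refine ⟨h, hh, ?_⟩
  have hcont : Continuous fun p : (ℝ × ℝ) × Z => (((0 : ℝ), p.1.2), p.2) := by fun_prop
  have ht : Tendsto (fun p : (ℝ × ℝ) × Z => (((0 : ℝ), p.1.2), p.2)) (𝓝 ((0 : ℝ × ℝ), z₀))
    (𝓝 ((0 : ℝ × ℝ), z₀)) := hcont.tendsto ((0 : ℝ × ℝ), z₀)
  -- The restriction of `f` to `xt = 0` vanishes for `s > 0` by hypothesis, and for `s = 0` by
  -- continuity, so nothing but the multiple of `xt` remains.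
  have e := eventually_eq_zero_of_closure (a := ((0 : ℝ × ℝ), z₀)) (u := ((0, 1), (0 : Z)))
    (A := fun p : (ℝ × ℝ) × Z => f (((0 : ℝ), p.1.2), p.2))
    (R := {p : (ℝ × ℝ) × Z | 0 < p.1.2}) (R' := {p : (ℝ × ℝ) × Z | 0 ≤ p.1.2})
    (hf.continuous.comp hcont)
    (fun p hp ε hε => by
      simp only [Set.mem_ofPred_eq] at hp ⊢
      simp only [Prod.fst_add, Prod.snd_add, Prod.smul_fst, Prod.smul_snd, smul_eq_mul, mul_one]
      linarith)
    (by filter_upwards [ht.eventually h0] with p hp hp0 using hp hp0 rfl)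
  filter_upwards [e] with p hp hp0
  rw [hfh p]
  have : p - ((ContinuousLinearMap.fst ℝ ℝ ℝ).comp (ContinuousLinearMap.fst ℝ (ℝ × ℝ) Z)) p •
      (((1, 0), 0) : (ℝ × ℝ) × Z) = ((0, p.1.2), p.2) := by
    ext <;> simp
  rw [this, hp hp0, zero_add]
  rfl

/-- A smooth function that vanishes on the two faces of a quadrant is a multiple of `xt s`. -/
theorem exists_contDiff_eq_mul_mul [FiniteDimensional ℝ Z] {f : (ℝ × ℝ) × Z → ℝ}
    (hf : ContDiff ℝ ∞ f) {z₀ : Z}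
    (h1 : ∀ᶠ p in 𝓝 ((0 : ℝ × ℝ), z₀), 0 < p.1.2 → p.1.1 = 0 → f p = 0)
    (h2 : ∀ᶠ p in 𝓝 ((0 : ℝ × ℝ), z₀), 0 < p.1.1 → p.1.2 = 0 → f p = 0) :
    ∃ κ : (ℝ × ℝ) × Z → ℝ, ContDiff ℝ ∞ κ ∧
      ∀ᶠ p in 𝓝 ((0 : ℝ × ℝ), z₀), 0 ≤ p.1.1 → 0 ≤ p.1.2 → f p = p.1.1 * p.1.2 * κ p := by
  obtain ⟨h, hh, hfh⟩ := exists_contDiff_eq_fst_smul hf h1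
  obtain ⟨κ, hκ, hhκ⟩ := exists_contDiff_eq_add_smul hh
    ((ContinuousLinearMap.snd ℝ ℝ ℝ).comp (ContinuousLinearMap.fst ℝ (ℝ × ℝ) Z))
    (((0, 1), 0) : (ℝ × ℝ) × Z)
  refine ⟨κ, hκ, ?_⟩
  have hcont : Continuous fun p : (ℝ × ℝ) × Z => ((p.1.1, (0 : ℝ)), p.2) := by fun_prop
  have ht : Tendsto (fun p : (ℝ × ℝ) × Z => ((p.1.1, (0 : ℝ)), p.2)) (𝓝 ((0 : ℝ × ℝ), z₀))
    (𝓝 ((0 : ℝ × ℝ), z₀)) := hcont.tendsto ((0 : ℝ × ℝ), z₀)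
  -- On `s = 0 < xt` the equation `f = xt h` forces `h = 0`; continuity gives the same at `xt = 0`,
  -- so `h` can be divided by `s`.
  have e := eventually_eq_zero_of_closure (a := ((0 : ℝ × ℝ), z₀)) (u := ((1, 0), (0 : Z)))
    (A := fun p : (ℝ × ℝ) × Z => h ((p.1.1, (0 : ℝ)), p.2))
    (R := {p : (ℝ × ℝ) × Z | 0 < p.1.1}) (R' := {p : (ℝ × ℝ) × Z | 0 ≤ p.1.1})
    (hh.continuous.comp hcont)
    (fun p hp ε hε => by
      simp only [Set.mem_ofPred_eq] at hp ⊢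
      simp only [Prod.fst_add, Prod.smul_fst, smul_eq_mul, mul_one]
      linarith)
    (by
      filter_upwards [ht.eventually h2, ht.eventually hfh] with p hp hp' hp0
      have hp0 : 0 < p.1.1 := hp0
      have e1 := hp' le_rfl
      rw [hp hp0 rfl] at e1
      exact (smul_eq_zero.1 e1.symm).resolve_left hp0.ne')
  filter_upwards [e, hfh] with p hp hp' hx hs
  rw [hp' hs, hhκ p]
  have : p - ((ContinuousLinearMap.snd ℝ ℝ ℝ).comp (ContinuousLinearMap.fst ℝ (ℝ × ℝ) Z)) p •
      (((0, 1), 0) : (ℝ × ℝ) × Z) = ((p.1.1, 0), p.2) := by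
    ext <;> simp
  rw [this, hp hx, zero_add]
  simp only [ContinuousLinearMap.comp_apply, ContinuousLinearMap.coe_fst',
    ContinuousLinearMap.coe_snd', smul_eq_mul]
  ring

/-- On the front face over the corner, a one-form `dτ + r (ω₀ dxt + ω'·dy' + xt ω''·dy'')` that
vanishes for `xt, r > 0` reduces to `ν·dy' + ω''·dy''`. -/
theorem exists_frontFace_oneForm [FiniteDimensional ℝ Z] {l m : ℕ} {τ ω₀ : (ℝ × ℝ) × Z → ℝ}
    {y₁ ω₁ : (ℝ × ℝ) × Z → EE l} {y₂ ω₂ : (ℝ × ℝ) × Z → EE m} {z₀ : Z} (hτ : ContDiff ℝ ∞ τ)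
    (hω₀ : ContDiff ℝ ∞ ω₀) (hy₁ : ContDiff ℝ ∞ y₁) (hω₁ : ContDiff ℝ ∞ ω₁)
    (hy₂ : ContDiff ℝ ∞ y₂) (hω₂ : ContDiff ℝ ∞ ω₂)
    (h1 : ∀ᶠ p in 𝓝 ((0 : ℝ × ℝ), z₀), 0 < p.1.2 → p.1.1 = 0 → τ p = 0 ∧ ω₁ p = 0)
    (h2 : ∀ᶠ p in 𝓝 ((0 : ℝ × ℝ), z₀), 0 < p.1.1 → p.1.2 = 0 → τ p = 0)
    (hc : ∀ᶠ p in 𝓝 ((0 : ℝ × ℝ), z₀), 0 < p.1.1 ∧ 0 < p.1.2 → ∀ u, fderiv ℝ τ p u +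
      p.1.2 * (ω₀ p * u.1.1 + ⟪ω₁ p, fderiv ℝ y₁ p u⟫_ℝ + p.1.1 * ⟪ω₂ p, fderiv ℝ y₂ p u⟫_ℝ) = 0) :
    ∃ ν : (ℝ × ℝ) × Z → EE l, ContDiff ℝ ∞ ν ∧ ∀ᶠ z in 𝓝 z₀, ω₀ (0, z) = 0 ∧ ω₁ (0, z) = 0 ∧
      ∀ v, ⟪ν (0, z), fderiv ℝ y₁ (0, z) (0, v)⟫_ℝ + ⟪ω₂ (0, z), fderiv ℝ y₂ (0, z) (0, v)⟫_ℝ = 0 := by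
  obtain ⟨ν, hν, hων⟩ := exists_contDiff_eq_fst_smul hω₁
    (h1.mono fun p hp a b => (hp a b).2)
  obtain ⟨κ, hκ, hτκ⟩ := exists_contDiff_eq_mul_mul hτ (h1.mono fun p hp a b => (hp a b).1) h2
  -- the rescaled form
  let β : (ℝ × ℝ) × Z → ((ℝ × ℝ) × Z →L[ℝ] ℝ) := fun p => fderiv ℝ κ p +
    (innerSL ℝ (ν p)).comp (fderiv ℝ y₁ p) + (innerSL ℝ (ω₂ p)).comp (fderiv ℝ y₂ p)
  have hβ : ∀ p u, β p u = fderiv ℝ κ p u + ⟪ν p, fderiv ℝ y₁ p u⟫_ℝ +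
    ⟪ω₂ p, fderiv ℝ y₂ p u⟫_ℝ := fun p u => rfl
  have hβc : Continuous β :=
    ((hκ.continuous_fderiv (by simp)).add
      (((innerSL ℝ).continuous.comp hν.continuous).clm_comp (hy₁.continuous_fderiv (by simp)))).add
      (((innerSL ℝ).continuous.comp hω₂.continuous).clm_comp (hy₂.continuous_fderiv (by simp)))
  -- With `τ = xt s κ` and `ω' = xt ν` the contact form is `s (κ + ω₀) dxt + xt κ ds + xt s β`. Each
  -- coefficient contains a different monomial, which is divided out separately before going to the
  -- boundary.
  have hpos : ∀ᶠ p in 𝓝 ((0 : ℝ × ℝ), z₀), 0 < p.1.1 ∧ 0 < p.1.2 → ∀ u,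
      p.1.2 * (κ p + ω₀ p) * u.1.1 + p.1.1 * κ p * u.1.2 + p.1.1 * p.1.2 * β p u = 0 := by
    filter_upwards [hc, hτκ.eventually_nhds, hων] with p c1 c2 c3 c0 u
    have e0 : HasFDerivAt (fun p : (ℝ × ℝ) × Z => p) (ContinuousLinearMap.id ℝ _) p :=
      hasFDerivAt_id p
    have e1 := (e0.fst.fst.mul e0.fst.snd).mul ((hκ.differentiable (by simp)) p).hasFDerivAt
    have e2 : HasFDerivAt τ _ p := e1.congr_of_eventuallyEq (by
      have t1 : ∀ᶠ p' in 𝓝 p, 0 < p'.1.1 :=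
        (by fun_prop : Continuous fun p : (ℝ × ℝ) × Z => p.1.1).continuousAt.eventually
          (lt_mem_nhds c0.1)
      have t2 : ∀ᶠ p' in 𝓝 p, 0 < p'.1.2 :=
        (by fun_prop : Continuous fun p : (ℝ × ℝ) × Z => p.1.2).continuousAt.eventually
          (lt_mem_nhds c0.2)
      filter_upwards [c2, t1, t2] with p' a1 a2 a3 using a1 a2.le a3.le)
    have e3 := c1 c0 u
    rw [e2.fderiv, c3 c0.2.le] at e3
    simp only [_root_.add_apply, _root_.smul_apply, ContinuousLinearMap.comp_apply,
      ContinuousLinearMap.coe_fst', ContinuousLinearMap.coe_snd', ContinuousLinearMap.id_apply,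
      smul_eq_mul, real_inner_smul_left, Pi.mul_apply] at e3
    rw [hβ]
    linear_combination e3
  have k1 := eventually_eq_zero_of_closure (a := ((0 : ℝ × ℝ), z₀))
    (A := fun p => (β p).comp (ContinuousLinearMap.inr ℝ (ℝ × ℝ) Z))
    (hβc.clm_comp continuous_const) quadrant_add_mem (by
      filter_upwards [hpos] with p hp h0
      ext v
      have e := hp h0 (0, v)
      simp only [Prod.fst_zero, mul_zero, Prod.snd_zero, zero_add, mul_eq_zero] at e
      exact e.resolve_left (by simp [h0.1.ne', h0.2.ne']))
  have k2 := eventually_eq_zero_of_closure (a := ((0 : ℝ × ℝ), z₀))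
    (A := fun p => κ p + p.1.2 * β p ((0, 1), 0))
    (hκ.continuous.add ((by fun_prop : Continuous fun p : (ℝ × ℝ) × Z => p.1.2).mul
      (hβc.clm_apply continuous_const))) quadrant_add_mem (by
      filter_upwards [hpos] with p hp h0
      have e := hp h0 ((0, 1), 0)
      have e' : p.1.1 * (κ p + p.1.2 * β p ((0, 1), 0)) = 0 := by linear_combination e
      exact (mul_eq_zero.1 e').resolve_left h0.1.ne')
  have k3 := eventually_eq_zero_of_closure (a := ((0 : ℝ × ℝ), z₀))
    (A := fun p => κ p + ω₀ p + p.1.1 * β p ((1, 0), 0))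
    ((hκ.continuous.add hω₀.continuous).add
      ((by fun_prop : Continuous fun p : (ℝ × ℝ) × Z => p.1.1).mul
      (hβc.clm_apply continuous_const))) quadrant_add_mem (by
      filter_upwards [hpos] with p hp h0
      have e := hp h0 ((1, 0), 0)
      have e' : p.1.2 * (κ p + ω₀ p + p.1.1 * β p ((1, 0), 0)) = 0 := by linear_combination e
      exact (mul_eq_zero.1 e').resolve_left h0.2.ne')
  have ht : Tendsto (fun z : Z => ((0 : ℝ × ℝ), z)) (𝓝 z₀) (𝓝 ((0 : ℝ × ℝ), z₀)) :=
    (by fun_prop : Continuous fun z : Z => ((0 : ℝ × ℝ), z)).tendsto z₀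
  -- At the corner the `ds`-coefficient gives `κ = 0`, and then the `dxt`-coefficient gives `ω₀ =
  -- 0`. Since `κ` vanishes along the whole corner, `dκ` drops out of `β` there.
  have hκ0 : ∀ᶠ z in 𝓝 z₀, κ (0, z) = 0 := by
    filter_upwards [ht.eventually k2] with z hz
    simpa using hz ⟨le_rfl, le_rfl⟩
  refine ⟨ν, hν, ?_⟩
  filter_upwards [ht.eventually k1, hκ0.eventually_nhds, ht.eventually k3, ht.eventually hων] with
    z a1 a2 a3 a4
  refine ⟨?_, ?_, fun v => ?_⟩
  · have := a3 ⟨le_rfl, le_rfl⟩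
    simpa [a2.self_of_nhds] using this
  · have := a4 le_rfl
    simpa using this
  · have e := DFunLike.congr_fun (a1 ⟨le_rfl, le_rfl⟩) v
    have e' : β (0, z) (0, v) = 0 := e
    have e1 := ((hκ.differentiable (by simp)) ((0 : ℝ × ℝ), z)).hasFDerivAt.comp z
      (hasFDerivAt_prodMk_right (0 : ℝ × ℝ) z)
    have e2 := DFunLike.congr_fun (e1.unique
      ((hasFDerivAt_const (0 : ℝ) z).congr_of_eventuallyEq a2)) v
    have e3 : fderiv ℝ κ (0, z) (0, v) = 0 := e2
    rw [hβ, e3, zero_add] at e'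
    exact e'

end DoubleDivision

/-! ### The lift of a Legendre pair with conic points near the corner -/

section Lift

open Filter

variable {l m : ℕ}

/-- A fibred Legendre submanifold `Γ` and a section `Γs` with the same base `Γ₁`, and a point `q` of
the boundary of the lift of `Γ`, over the corner. -/
structure IsConicCorner (Γ Γs : Set (CornerPt l m)) (Γ₁ : Set (ScPt l)) (W₁ : Set (EE l))
    (W : Set (Corner l m)) (f₁ : EE l → ℝ) (f₂ : Corner l m → ℝ) (q : CornerBl l m) : Prop where
  legendre : ∀ a ∈ Γ, ∃ T, IsCornerLegendreAt Γ a T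
  fibred : IsCornerFibred Γ Γ₁
  fibred_section : IsCornerFibred Γs Γ₁
  base : IsScLegendre Γ₁
  smooth_fst : ContDiff ℝ ∞ f₁
  smooth_snd : ContDiff ℝ ∞ f₂
  graph : IsCornerGraphOn Γs W₁ W f₁ (fun t y' y'' => f₂ (t, y', y''))
  mem_lift : q ∈ liftBoundary cnorm Γ Γs
  mem_patch : q.1 ∈ W
  corner : q.1.1 = 0

/-- The function `τ + f₁ + xt f₂`, which vanishes on the section. -/
def phaseShift (f₁ : EE l → ℝ) (f₂ : Corner l m → ℝ) (z : CornerBl l m) : ℝ :=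
  z.2.1 + (f₁ z.1.2.1 + z.1.1 * f₂ z.1)

theorem contDiff_phaseShift {f₁ : EE l → ℝ} {f₂ : Corner l m → ℝ} (h₁ : ContDiff ℝ ∞ f₁)
    (h₂ : ContDiff ℝ ∞ f₂) : ContDiff ℝ ∞ (phaseShift f₁ f₂) := by
  have e1 : ContDiff ℝ ∞ fun z : CornerBl l m => z.1.2.1 := by fun_prop
  have e2 : ContDiff ℝ ∞ fun z : CornerBl l m => z.1.1 := by fun_prop
  have e3 : ContDiff ℝ ∞ fun z : CornerBl l m => z.2.1 := by fun_prop
  exact e3.add ((h₁.comp e1).add (e2.mul (h₂.comp contDiff_fst)))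

theorem cnorm_sq (ζ : Corner l m) : cnorm ζ ^ 2 = ζ.1 ^ 2 + ‖ζ.2.1‖ ^ 2 + ‖ζ.2.2‖ ^ 2 :=
  Real.sq_sqrt (by positivity)

theorem continuous_cnorm : Continuous (cnorm : Corner l m → ℝ) := by
  unfold cnorm
  fun_prop

theorem cnorm_smul {c : ℝ} (hc : 0 ≤ c) (ζ : Corner l m) : cnorm (c • ζ) = c * cnorm ζ := by
  have h : cnorm (c • ζ) ^ 2 = (c * cnorm ζ) ^ 2 := by
    rw [mul_pow, cnorm_sq, cnorm_sq]
    simp only [Prod.smul_fst, Prod.smul_snd, norm_smul, smul_eq_mul, mul_pow, Real.norm_eq_abs,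
      sq_abs]
    ring
  exact (pow_left_inj₀ (Real.sqrt_nonneg _) (mul_nonneg hc (Real.sqrt_nonneg _)) two_ne_zero).1 h

theorem cnorm_eq_one_of_mem_hat {Γ Γs : Set (CornerPt l m)} {z : CornerBl l m}
    (hz : z ∈ hat cnorm Γ Γs) : cnorm z.2.2.2 = 1 := by
  rcases hz with hz | hz
  · exact hz.2.1
  · have hcl : IsClosed {z : CornerBl l m | cnorm z.2.2.2 = 1} :=
      isClosed_eq (continuous_cnorm.comp (by fun_prop)) continuous_const
    exact closure_minimal (fun z hz => hz.2.1) hcl hz.1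

namespace IsConicCorner

variable {Γ Γs : Set (CornerPt l m)} {Γ₁ : Set (ScPt l)} {W₁ : Set (EE l)}
    {W : Set (Corner l m)} {f₁ : EE l → ℝ} {f₂ : Corner l m → ℝ} {q : CornerBl l m}

theorem eq_of_mem_section (h : IsConicCorner Γ Γs Γ₁ W₁ W f₁ f₂ q) {b : Corner l m} (hb : b ∈ W)
    (hb0 : 0 ≤ b.1) {τ : ℝ} {ζ : Corner l m} (hΓ : (b, τ, ζ) ∈ Γs) :
    τ = -(f₁ b.2.1 + b.1 * f₂ b) ∧ ζ = graphCovec f₁ f₂ b := by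
  have h1 := (h.graph.2.2.2.2.2 b hb hb0 τ ζ).1 hΓ
  rw [cornerDiff_eq h.smooth_fst h.smooth_snd] at h1
  simpa only [Prod.mk.injEq, true_and] using h1

theorem mem_of_pos (h : IsConicCorner Γ Γs Γ₁ W₁ W f₁ f₂ q) {z : CornerBl l m}
    (hz : z ∈ hat cnorm Γ Γs) (hzW : z.1 ∈ W) (h0 : 0 ≤ z.1.1) (hr : 0 < z.2.2.1) :
    (z.1, z.2.1, graphCovec f₁ f₂ z.1 + z.2.2.1 • z.2.2.2) ∈ Γ := by
  rcases hz with hz | hz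
  · obtain ⟨-, -, τ₀, ζ₀, h1, h2⟩ := hz
    rwa [(h.eq_of_mem_section hzW h0 h1).2] at h2
  · exact absurd hz.2.1 hr.ne'

/-- Points of the lift with `r = 0` lie, by definition of `liftBoundary`, over `Γs`, where `τ = -(f₁
+ xt f₂)`. -/
theorem phaseShift_of_radius_eq_zero (h : IsConicCorner Γ Γs Γ₁ W₁ W f₁ f₂ q) {z : CornerBl l m}
    (hz : z ∈ hat cnorm Γ Γs) (hzW : z.1 ∈ W) (h0 : 0 ≤ z.1.1) (hr : z.2.2.1 = 0) :
    phaseShift f₁ f₂ z = 0 := by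
  rcases hz with hz | hz
  · exact absurd hr hz.1.ne'
  · obtain ⟨-, -, ζ₀, h1⟩ := hz
    rw [phaseShift, (h.eq_of_mem_section hzW h0 h1).1]
    ring

theorem phaseShift_self (h : IsConicCorner Γ Γs Γ₁ W₁ W f₁ f₂ q) : phaseShift f₁ f₂ q = 0 :=
  h.phaseShift_of_radius_eq_zero (Or.inr h.mem_lift) h.mem_patch h.corner.ge h.mem_lift.2.1

/-- This is where the common base enters: near the point in question `Γ₁` is the graph of `d(f₁/x)`
because it is the base of the section. Points of `Γ` over the corner project into it, which gives `τ
= -f₁` and `r ω' = 0`. -/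
theorem eventually_corner (h : IsConicCorner Γ Γs Γ₁ W₁ W f₁ f₂ q) :
    ∀ᶠ z in 𝓝 q, z ∈ hat cnorm Γ Γs → 0 < z.2.2.1 → z.1.1 = 0 →
      phaseShift f₁ f₂ z = 0 ∧ z.2.2.2.2.1 = 0 := by
  have hq := h.phaseShift_self
  set B : CornerBl l m → ScPt l := fun z =>
    (z.1.2.1, z.2.1, (graphCovec f₁ f₂ z.1).2.1 + z.2.2.1 • z.2.2.2.2.1) with hB
  have hBc : Continuous B := by
    have e1 : Continuous fun z : CornerBl l m => (graphCovec f₁ f₂ z.1).2.1 :=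
      (by fun_prop : Continuous fun b : Corner l m => b.2.1).comp
        ((contDiff_graphCovec h.smooth_fst h.smooth_snd).continuous.comp continuous_fst)
    have e2 : Continuous fun z : CornerBl l m => z.2.2.1 • z.2.2.2.2.1 := by fun_prop
    have e3 : Continuous fun z : CornerBl l m => z.1.2.1 := by fun_prop
    have e4 : Continuous fun z : CornerBl l m => z.2.1 := by fun_prop
    exact e3.prodMk (e4.prodMk (e1.add e2))
  have hBq : B q = (q.1.2.1, -f₁ q.1.2.1,
      partialGradient (ContinuousLinearMap.id ℝ (EE l)) f₁ q.1.2.1) := by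
    simp only [phaseShift, h.corner, zero_mul, add_zero] at hq
    simp only [hB, graphCovec, h.corner, h.mem_lift.2.1, zero_smul, add_zero, Prod.mk.injEq,
      true_and, and_true]
    linarith
  have hbase := h.graph.base_eq h.smooth_fst h.smooth_snd h.fibred_section h.base h.mem_patch
    h.corner
  rw [← hBq] at hbase
  have hW : ∀ᶠ z in 𝓝 q, z.1 ∈ W := continuousAt_fst.eventually (h.graph.2.1.mem_nhds h.mem_patch)
  filter_upwards [hBc.continuousAt.eventually hbase, hW] with z h1 h2 h3 h4 h5
  have h6 := h.mem_of_pos h3 h2 h5.ge h4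
  have h7 := (h.fibred.1 _ h6 h5).1
  obtain ⟨h8, h9⟩ := h1 h7
  simp only [hB, graphCovec, h5, zero_smul, add_zero, add_eq_left, smul_eq_zero] at h8 h9
  refine ⟨?_, h9.resolve_left h4.ne'⟩
  rw [phaseShift, h8, h5]
  ring

/-- The contact form on the lift. -/
theorem contact_eq_zero (h : IsConicCorner Γ Γs Γ₁ W₁ W f₁ f₂ q) {X : Type*}
    [NormedAddCommGroup X] [NormedSpace ℝ X] {G : X → CornerBl l m} {p : X}
    (hG : DifferentiableAt ℝ G p)
    (hev : ∀ᶠ p' in 𝓝 p, G p' ∈ hat cnorm Γ Γs ∧ (G p').1 ∈ W ∧ 0 ≤ (G p').1.1 ∧ 0 < (G p').2.2.1)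
    (u : X) :
    fderiv ℝ (fun p => phaseShift f₁ f₂ (G p)) p u + (G p).2.2.1 *
      ((G p).2.2.2.1 * (fderiv ℝ G p u).1.1 + ⟪(G p).2.2.2.2.1, (fderiv ℝ G p u).1.2.1⟫_ℝ +
        (G p).1.1 * ⟪(G p).2.2.2.2.2, (fderiv ℝ G p u).1.2.2⟫_ℝ) = 0 := by
  have hd := hG.hasFDerivAt
  set D := fderiv ℝ G p with hD
  -- The composition with the blow-down map, which takes values in `Γ` for `r > 0`. The differential
  -- of `f₁ + xt f₂` absorbs the part of the contact form belonging to the section, leaving `r`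
  -- times the part of `ω`.
  set A : X → CornerPt l m := fun p => ((G p).1, (G p).2.1,
    graphCovec f₁ f₂ (G p).1 + (G p).2.2.1 • (G p).2.2.2) with hA
  have hgc := ((contDiff_graphCovec h.smooth_fst h.smooth_snd).differentiable (by simp)) (G p).1
  have hAd := hd.fst.prodMk (hd.snd.fst.prodMk ((hgc.hasFDerivAt.comp p hd.fst).add
    (hd.snd.snd.fst.smul hd.snd.snd.snd)))
  have hAd' : HasFDerivAt A _ p := hAd
  have hAΓ : ∀ᶠ p' in 𝓝 p, A p' ∈ Γ :=
    hev.mono fun p' hp' => h.mem_of_pos hp'.1 hp'.2.1 hp'.2.2.1 hp'.2.2.2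
  obtain ⟨T, hT⟩ := h.legendre _ hAΓ.self_of_nhds
  have hc := hT.contact_eq_zero hAd'.differentiableAt rfl hAΓ u
  rw [hAd'.fderiv] at hc
  obtain ⟨L, hL, hLu⟩ := hasFDerivAt_section h.smooth_fst h.smooth_snd (G p).1
  have hLG := hL.comp p hd.fst
  have hps' := hd.snd.fst.add hLG
  have hps : HasFDerivAt (fun p => phaseShift f₁ f₂ (G p)) _ p := hps'
  rw [hps.fderiv]
  simp only [cornerContact, hA, ContinuousLinearMap.prod_apply, ContinuousLinearMap.comp_apply,
    ContinuousLinearMap.coe_fst', ContinuousLinearMap.coe_snd', Prod.fst_add, Prod.snd_add,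
    Prod.smul_fst, Prod.smul_snd, inner_add_left, real_inner_smul_left, smul_eq_mul] at hc
  simp only [_root_.add_apply, ContinuousLinearMap.comp_apply,
    ContinuousLinearMap.coe_fst', ContinuousLinearMap.coe_snd', hLu]
  linear_combination hc

end IsConicCorner

/-- The hyperplane orthogonal to a unit vector. -/
theorem exists_orthogonal_splitting {e : EE m} (he : ‖e‖ = 1) :
    ∃ (k : ℕ) (P : EE m →L[ℝ] EE k) (ι : EE k →L[ℝ] EE m), m = k + 1 ∧ P e = 0 ∧
      (∀ w, P (ι w) = w) ∧ (∀ y, ⟪y, e⟫_ℝ • e + ι (P y) = y) ∧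
      ∀ y w, ⟪y, ι w⟫_ℝ = ⟪P y, w⟫_ℝ := by
  have he0 : e ≠ 0 := fun h => by simp [h] at he
  obtain ⟨k, rfl⟩ : ∃ k, m = k + 1 := by
    rcases m with _ | k
    · exact absurd (Subsingleton.elim e 0) he0
    · exact ⟨k, rfl⟩
  have : Fact (Module.finrank ℝ (EE (k + 1)) = k + 1) := ⟨by simp⟩
  -- `ι` is an isometry onto the orthogonal complement of `e`, and `P` is its adjoint.
  let b := OrthonormalBasis.fromOrthogonalSpanSingleton (𝕜 := ℝ) k he0
  let ι : EE k →L[ℝ] EE (k + 1) := (Submodule.subtypeL (Submodule.span ℝ {e})ᗮ).comp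
    b.repr.symm.toContinuousLinearEquiv.toContinuousLinearMap
  have hι : ∀ w w', ⟪ι w, ι w'⟫_ℝ = ⟪w, w'⟫_ℝ := fun w w' =>
    b.repr.symm.inner_map_map w w'
  have hιe : ∀ w, ⟪ι w, e⟫_ℝ = 0 := fun w => by
    rw [real_inner_comm]
    exact Submodule.mem_orthogonal_singleton_iff_inner_right.1 (b.repr.symm w).2
  have hadj : ∀ y w, ⟪y, ι w⟫_ℝ = ⟪ContinuousLinearMap.adjoint ι y, w⟫_ℝ := fun y w => by
    rw [ContinuousLinearMap.adjoint_inner_left]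
  have hPι : ∀ w, ContinuousLinearMap.adjoint ι (ι w) = w := fun w =>
    ext_inner_right ℝ fun w' => by rw [← hadj, hι]
  have hPe : ContinuousLinearMap.adjoint ι e = 0 :=
    ext_inner_right ℝ fun w' => by rw [← hadj, real_inner_comm, hιe, inner_zero_left]
  refine ⟨k, ContinuousLinearMap.adjoint ι, ι, rfl, hPe, hPι, fun y => ?_, hadj⟩
  have hee : ⟪e, e⟫_ℝ = 1 := by rw [real_inner_self_eq_norm_sq, he, one_pow]
  have hmem : y - ⟪y, e⟫_ℝ • e ∈ (Submodule.span ℝ {e})ᗮ := by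
    rw [Submodule.mem_orthogonal_singleton_iff_inner_right, inner_sub_right, real_inner_smul_right,
      hee, mul_one, real_inner_comm, sub_self]
  obtain ⟨w, hw⟩ : ∃ w, ι w = y - ⟪y, e⟫_ℝ • e := ⟨b.repr ⟨_, hmem⟩, by simp [ι]⟩
  have h1 : ContinuousLinearMap.adjoint ι y = w := by
    have := hPι w
    rw [hw, map_sub, map_smul, hPe, smul_zero, sub_zero] at this
    exact this
  rw [h1, hw]
  abel

end Lift

/-! ### The tangent space of the lift at the corner of the front face -/

section ConicCoordinates

open Filter

variable {l m : ℕ}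

theorem radius_apply (z : CornerBl l m) : radius (Corner l m) (Corner l m) z = z.2.2.1 := rfl

theorem eq_zero_of_slice {Z V : Type*} [NormedAddCommGroup Z] [NormedSpace ℝ Z]
    [NormedAddCommGroup V] [NormedSpace ℝ V] {f : (ℝ × ℝ) × Z → V} {z₀ : Z}
    {f' : (ℝ × ℝ) × Z →L[ℝ] V} (c : V)
    (hf : HasFDerivAt f f' (0, z₀)) (h : ∀ᶠ z in 𝓝 z₀, f (0, z) = c) (v : Z) :
    f' (0, v) = 0 := by
  have e1 := hf.comp z₀ (hasFDerivAt_prodMk_right (0 : ℝ × ℝ) z₀)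
  exact DFunLike.congr_fun (e1.unique ((hasFDerivAt_const c z₀).congr_of_eventuallyEq h)) v

theorem fderiv_slice {Z V : Type*} [NormedAddCommGroup Z] [NormedSpace ℝ Z]
    [NormedAddCommGroup V] [NormedSpace ℝ V] {f : (ℝ × ℝ) × Z → V} {z : Z}
    (hf : DifferentiableAt ℝ f (0, z)) (v : Z) :
    fderiv ℝ (fun z => f (0, z)) z v = fderiv ℝ f (0, z) (0, v) := by
  have e1 := hf.hasFDerivAt.comp z (hasFDerivAt_prodMk_right (0 : ℝ × ℝ) z)
  have e2 : fderiv ℝ (fun z => f (0, z)) z = _ := e1.fderiv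
  rw [e2]
  rfl

theorem norm_eq_one_of_cnorm_eq_one {ζ : Corner l m} (h : cnorm ζ = 1) (h0 : ζ.1 = 0)
    (h1 : ζ.2.1 = 0) : ‖ζ.2.2‖ = 1 := by
  have := cnorm_sq ζ
  rw [h, h0, h1, norm_zero] at this
  have h2 : ‖ζ.2.2‖ ^ 2 = 1 := by linarith
  exact (pow_eq_one_iff_of_nonneg (norm_nonneg _) two_ne_zero).1 h2

theorem mem_iff_of_cornerFaces {S : Set (CornerBl l m)} {z : CornerBl l m} {c : ℕ}
    {F : CornerBl l m → Fin c → ℝ} (h : z ∈ S ↔ (∀ f ∈ [xtFun l m (ℝ × ℝ × Corner l m),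
      radius (Corner l m) (Corner l m)], 0 ≤ f z) ∧ F z = 0) :
    z ∈ S ↔ 0 ≤ z.1.1 ∧ 0 ≤ z.2.2.1 ∧ F z = 0 := by
  rw [h]
  simp [xtFun_apply, radius_apply, and_assoc]

/-- A smooth family of points, near `q`, of the lift of `Γ`, over a quadrant whose faces correspond to
the corner and to the front face. -/
structure IsLiftChart (Γ Γs : Set (CornerPt l m)) (W : Set (Corner l m)) (q : CornerBl l m)
    {Z : Type} [NormedAddCommGroup Z] [NormedSpace ℝ Z] (g : (ℝ × ℝ) × Z → CornerBl l m) (z₀ : Z) :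
    Prop where
  smooth : ContDiff ℝ ∞ g
  point : g (0, z₀) = q
  patch : ∀ᶠ p in 𝓝 ((0 : ℝ × ℝ), z₀), (g p).1 ∈ W
  coord : ∀ᶠ p in 𝓝 ((0 : ℝ × ℝ), z₀), (g p).1.1 = p.1.1
  mem_hat : ∀ᶠ p in 𝓝 ((0 : ℝ × ℝ), z₀), 0 ≤ p.1.1 → 0 ≤ p.1.2 → g p ∈ hat cnorm Γ Γs
  radius_pos : ∀ᶠ p in 𝓝 ((0 : ℝ × ℝ), z₀), 0 < p.1.2 → 0 < (g p).2.2.1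
  radius_zero : ∀ᶠ p in 𝓝 ((0 : ℝ × ℝ), z₀), p.1.2 = 0 → (g p).2.2.1 = 0

namespace IsLiftChart

variable {Γ Γs : Set (CornerPt l m)} {Γ₁ : Set (ScPt l)} {W₁ : Set (EE l)}
    {W : Set (Corner l m)} {f₁ : EE l → ℝ} {f₂ : Corner l m → ℝ} {q : CornerBl l m}
    {Z : Type} [NormedAddCommGroup Z] [NormedSpace ℝ Z] {g : (ℝ × ℝ) × Z → CornerBl l m} {z₀ : Z}

theorem tendsto (hg : IsLiftChart Γ Γs W q g z₀) : Tendsto g (𝓝 ((0 : ℝ × ℝ), z₀)) (𝓝 q) := by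
  have := hg.smooth.continuous.tendsto ((0 : ℝ × ℝ), z₀)
  rwa [hg.point] at this

theorem hasFDerivAt (hg : IsLiftChart Γ Γs W q g z₀) (p : (ℝ × ℝ) × Z) :
    HasFDerivAt g (fderiv ℝ g p) p := ((hg.smooth.differentiable (by simp)) p).hasFDerivAt

/-- Only the sign and the zeros of the radius in terms of the second coordinate matter, so this
applies both to charts with coordinate `r` and to those with the rescaled coordinate `s`. -/
theorem eventually_corner (hg : IsLiftChart Γ Γs W q g z₀)
    (h : IsConicCorner Γ Γs Γ₁ W₁ W f₁ f₂ q) :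
    ∀ᶠ p in 𝓝 ((0 : ℝ × ℝ), z₀), 0 < p.1.2 → p.1.1 = 0 →
      phaseShift f₁ f₂ (g p) = 0 ∧ (g p).2.2.2.2.1 = 0 := by
  filter_upwards [hg.mem_hat, hg.coord, hg.radius_pos, hg.tendsto.eventually h.eventually_corner]
    with p a1 a2 a3 a4 a5 a6
  exact a4 (a1 a6.ge a5.le) (a3 a5) (by rwa [a2])

theorem eventually_front (hg : IsLiftChart Γ Γs W q g z₀)
    (h : IsConicCorner Γ Γs Γ₁ W₁ W f₁ f₂ q) :
    ∀ᶠ p in 𝓝 ((0 : ℝ × ℝ), z₀), 0 ≤ p.1.1 → p.1.2 = 0 → phaseShift f₁ f₂ (g p) = 0 := by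
  filter_upwards [hg.mem_hat, hg.coord, hg.patch, hg.radius_zero] with p a1 a2 a3 a4 a5 a6
  exact h.phaseShift_of_radius_eq_zero (a1 a5 a6.ge) a3 (by rwa [a2]) (a4 a6)

theorem fderiv_fst (hg : IsLiftChart Γ Γs W q g z₀) {p : (ℝ × ℝ) × Z}
    (hp : ∀ᶠ p' in 𝓝 p, (g p').1.1 = p'.1.1) (u : (ℝ × ℝ) × Z) :
    (fderiv ℝ g p u).1.1 = u.1.1 := by
  have e0 : HasFDerivAt (fun p : (ℝ × ℝ) × Z => p) (ContinuousLinearMap.id ℝ _) p :=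
    hasFDerivAt_id p
  exact DFunLike.congr_fun ((hg.hasFDerivAt p).fst.fst.unique
    (e0.fst.fst.congr_of_eventuallyEq hp)) u

/-- The contact form on the lift. -/
theorem eventually_contact (hg : IsLiftChart Γ Γs W q g z₀)
    (h : IsConicCorner Γ Γs Γ₁ W₁ W f₁ f₂ q) :
    ∀ᶠ p in 𝓝 ((0 : ℝ × ℝ), z₀), 0 < p.1.1 ∧ 0 < p.1.2 → ∀ u,
      fderiv ℝ (fun p => phaseShift f₁ f₂ (g p)) p u + (g p).2.2.1 *
        ((g p).2.2.2.1 * u.1.1 + ⟪(g p).2.2.2.2.1, fderiv ℝ (fun p => (g p).1.2.1) p u⟫_ℝ +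
        p.1.1 * ⟪(g p).2.2.2.2.2, fderiv ℝ (fun p => (g p).1.2.2) p u⟫_ℝ) = 0 := by
  filter_upwards [hg.mem_hat.eventually_nhds, hg.coord.eventually_nhds, hg.patch.eventually_nhds,
    hg.radius_pos.eventually_nhds] with p a1 a2 a3 a4 a5 u
  have hd := hg.hasFDerivAt p
  have e := h.contact_eq_zero hd.differentiableAt (by
    have t1 : ∀ᶠ p' in 𝓝 p, 0 < p'.1.1 :=
      (by fun_prop : Continuous fun p : (ℝ × ℝ) × Z => p.1.1).continuousAt.eventually
        (lt_mem_nhds a5.1)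
    have t2 : ∀ᶠ p' in 𝓝 p, 0 < p'.1.2 :=
      (by fun_prop : Continuous fun p : (ℝ × ℝ) × Z => p.1.2).continuousAt.eventually
        (lt_mem_nhds a5.2)
    filter_upwards [a1, a2, a3, a4, t1, t2] with p' b1 b2 b3 b4 b5 b6
    exact ⟨b1 b5.le b6.le, b3, by rw [b2]; exact b5.le, b4 b6⟩) u
  have c2 : fderiv ℝ (fun p => (g p).1.2.1) p u = (fderiv ℝ g p u).1.2.1 := by
    rw [hd.fst.snd.fst.fderiv]; rfl
  have c3 : fderiv ℝ (fun p => (g p).1.2.2) p u = (fderiv ℝ g p u).1.2.2 := by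
    rw [hd.fst.snd.snd.fderiv]; rfl
  rw [hg.fderiv_fst a2, a2.self_of_nhds] at e
  rw [c2, c3]
  exact e

/-- The contact form on the front face over the corner. -/
theorem exists_frontFace (hg : IsLiftChart Γ Γs W q g z₀) [FiniteDimensional ℝ Z]
    (h : IsConicCorner Γ Γs Γ₁ W₁ W f₁ f₂ q)
    (hr : ∀ᶠ p in 𝓝 ((0 : ℝ × ℝ), z₀), (g p).2.2.1 = p.1.2) :
    ∃ ν : (ℝ × ℝ) × Z → EE l, ContDiff ℝ ∞ ν ∧ ∀ᶠ z in 𝓝 z₀, (g (0, z)).2.2.2.1 = 0 ∧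
      (g (0, z)).2.2.2.2.1 = 0 ∧ ∀ v, ⟪ν (0, z), fderiv ℝ (fun p => (g p).1.2.1) (0, z) (0, v)⟫_ℝ +
        ⟪(g (0, z)).2.2.2.2.2, fderiv ℝ (fun p => (g p).1.2.2) (0, z) (0, v)⟫_ℝ = 0 := by
  have hs := hg.smooth
  have hps : ContDiff ℝ ∞ (fun p => phaseShift f₁ f₂ (g p)) :=
    (contDiff_phaseShift h.smooth_fst h.smooth_snd).comp hs
  refine exists_frontFace_oneForm (z₀ := z₀) hps hs.snd.snd.snd.fst hs.fst.snd.fst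
    hs.snd.snd.snd.snd.fst hs.fst.snd.snd hs.snd.snd.snd.snd.snd (hg.eventually_corner h)
    ((hg.eventually_front h).mono fun p hp a b => hp a.le b) ?_
  filter_upwards [hg.eventually_contact h, hr] with p a1 a2 a3 u
  have := a1 a3 u
  rwa [a2] at this

end IsLiftChart

/-- Near a point over the corner, the lift is parametrized by `xt`, `r` and the tangent space of its
intersection with the corner and the front face. -/
theorem IsConicCorner.exists_liftChart {Γ Γs : Set (CornerPt l m)} {Γ₁ : Set (ScPt l)}
    {W₁ : Set (EE l)} {W : Set (Corner l m)} {f₁ : EE l → ℝ} {f₂ : Corner l m → ℝ}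
    {q : CornerBl l m} (h : IsConicCorner Γ Γs Γ₁ W₁ W f₁ f₂ q) {T : Submodule ℝ (CornerBl l m)}
    (hT : IsSubmanifoldAt [xtFun l m (ℝ × ℝ × Corner l m), radius (Corner l m) (Corner l m)]
      (hat cnorm Γ Γs) q T) :
    ∃ (K : Submodule ℝ (CornerBl l m)) (g : (ℝ × ℝ) × K → CornerBl l m) (z₀ : K),
      (∀ v, v ∈ K ↔ v ∈ T ∧ v.1.1 = 0 ∧ v.2.2.1 = 0) ∧ IsLiftChart Γ Γs W q g z₀ ∧
      (∀ᶠ p in 𝓝 ((0 : ℝ × ℝ), z₀), (g p).2.2.1 = p.1.2) ∧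
      ∀ u : K, fderiv ℝ g (0, z₀) (0, u) = u := by
  obtain ⟨c, F, U, hU, hqU, hF, hS, hsurj, rfl⟩ := hT
  have hmem : ∀ z ∈ U, z ∈ hat cnorm Γ Γs ↔ 0 ≤ z.1.1 ∧ 0 ≤ z.2.2.1 ∧ F z = 0 :=
    fun z hz => mem_iff_of_cornerFaces (hS z hz)
  have hqhat : q ∈ hat cnorm Γ Γs := Or.inr h.mem_lift
  have hr : q.2.2.1 = 0 := h.mem_lift.2.1
  -- This auxiliary chart uses `xt`, `r` and the tangent directions in which both are constant.
  -- Transversality to both faces makes `xt` and `r` independent on the lift.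
  set L : CornerBl l m →L[ℝ] ℝ × ℝ :=
    (xtFun l m (ℝ × ℝ × Corner l m)).prod (radius (Corner l m) (Corner l m)) with hLdef
  have hL : ∀ z, L z = (z.1.1, z.2.2.1) := fun z => rfl
  have hLq : L q = 0 := by rw [hL, h.corner, hr]; rfl
  set K : Submodule ℝ (CornerBl l m) :=
    LinearMap.ker (fderiv ℝ F q).toLinearMap ⊓ LinearMap.ker L.toLinearMap with hK
  obtain ⟨g, z₀, hg, hga, hgp, hgd⟩ := exists_tangent_chart hU hqU hF ((hmem q hqU).1 hqhat).2.2 L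
    (fun t' y => by
      obtain ⟨v', hv1, hv2⟩ := hsurj (t' - fderiv ℝ F q ((y.1, 0, 0), 0, y.2, 0))
      have hv3 : v'.1.1 = 0 := hv1 (xtFun l m (ℝ × ℝ × Corner l m)) (by simp) h.corner
      have hv4 : v'.2.2.1 = 0 := hv1 (radius (Corner l m) (Corner l m)) (by simp) hr
      refine ⟨v' + ((y.1, 0, 0), 0, y.2, 0), by rw [map_add, hv2]; abel, ?_⟩
      rw [hL]
      simp [hv3, hv4]) K (fun v => by simp [hK])
  rw [hLq] at hga hgp hgd
  have hgt : Tendsto g (𝓝 ((0 : ℝ × ℝ), z₀)) (𝓝 q) := by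
    have := hg.continuous.tendsto ((0 : ℝ × ℝ), z₀)
    rwa [hga] at this
  have hx : ∀ᶠ p in 𝓝 ((0 : ℝ × ℝ), z₀), (g p).1.1 = p.1.1 ∧ (g p).2.2.1 = p.1.2 := by
    filter_upwards [hgp] with p hp
    rw [← hp.2.2]
    exact ⟨rfl, rfl⟩
  refine ⟨K, g, z₀, fun v => ?_, ⟨hg, hga,
    hgt.fst_nhds.eventually (h.graph.2.1.mem_nhds h.mem_patch), hx.mono fun p hp => hp.1, ?_,
    hx.mono fun p hp a => by rwa [hp.2], hx.mono fun p hp a => by rwa [hp.2]⟩,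
    hx.mono fun p hp => hp.2, hgd⟩
  · rw [hK, Submodule.mem_inf, LinearMap.mem_ker (f := L.toLinearMap)]
    exact and_congr Iff.rfl Prod.ext_iff
  · filter_upwards [hgp, hx] with p hp hp' a b
    exact (hmem _ hp.1).2 ⟨by rwa [hp'.1], by rwa [hp'.2], hp.2.1⟩

set_option maxHeartbeats 1000000 in
/-- Relations in the tangent space of the intersection of the lift with the corner and the front
face. -/
theorem IsLiftChart.tangent_relations {Γ Γs : Set (CornerPt l m)} {Γ₁ : Set (ScPt l)}
    {W₁ : Set (EE l)} {W : Set (Corner l m)} {f₁ : EE l → ℝ} {f₂ : Corner l m → ℝ}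
    {q : CornerBl l m} (h : IsConicCorner Γ Γs Γ₁ W₁ W f₁ f₂ q) {K : Submodule ℝ (CornerBl l m)}
    {g : (ℝ × ℝ) × K → CornerBl l m} {z₀ : K} (hg : IsLiftChart Γ Γs W q g z₀)
    (hr : ∀ᶠ p in 𝓝 ((0 : ℝ × ℝ), z₀), (g p).2.2.1 = p.1.2)
    (hK : ∀ v ∈ K, v.1.1 = 0) (hgd : ∀ u : K, fderiv ℝ g (0, z₀) (0, u) = u) :
    q.2.2.2.1 = 0 ∧ q.2.2.2.2.1 = 0 ∧ ∀ u ∈ K, u.1.2.1 = 0 → u.2.1 = 0 ∧ u.2.2.2.1 = 0 ∧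
      u.2.2.2.2.1 = 0 ∧ ⟪u.2.2.2.2.2, q.2.2.2.2.2⟫_ℝ = 0 ∧ ⟪u.1.2.2, q.2.2.2.2.2⟫_ℝ = 0 ∧
      ∀ v ∈ K, v.1.2.1 = 0 → ⟪u.2.2.2.2.2, v.1.2.2⟫_ℝ = ⟪v.2.2.2.2.2, u.1.2.2⟫_ℝ := by
  -- Along `xt = r = 0` the lift satisfies `ω₀ = 0`, `ω' = 0`, `|ω''| = 1`, `σ = 0` and `ν·dy' +
  -- ω''·dy'' = 0`. The relations are the linearizations of these, together with the exterior
  -- derivative of the last one, on vectors with `dy' = 0`.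
  obtain ⟨ν, hν, hface⟩ := hg.exists_frontFace h hr
  have hq0 := hface.self_of_nhds
  rw [hg.point] at hq0
  have ht : Tendsto (fun z : K => ((0 : ℝ × ℝ), z)) (𝓝 z₀) (𝓝 ((0 : ℝ × ℝ), z₀)) :=
    (by fun_prop : Continuous fun z : K => ((0 : ℝ × ℝ), z)).tendsto z₀
  have hd := hg.hasFDerivAt ((0 : ℝ × ℝ), z₀)
  have dy₁ : ∀ u : K, fderiv ℝ (fun p => (g p).1.2.1) (0, z₀) (0, u) = (u : CornerBl l m).1.2.1 := by
    intro u
    rw [hd.fst.snd.fst.fderiv, ← hgd u]; rfl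
  have dy₂ : ∀ u : K, fderiv ℝ (fun p => (g p).1.2.2) (0, z₀) (0, u) = (u : CornerBl l m).1.2.2 := by
    intro u
    rw [hd.fst.snd.snd.fderiv, ← hgd u]; rfl
  have dω₂ : ∀ u : K, fderiv ℝ (fun p => (g p).2.2.2.2.2) (0, z₀) (0, u) =
      (u : CornerBl l m).2.2.2.2.2 := by
    intro u
    rw [hd.snd.snd.snd.snd.snd.fderiv, ← hgd u]; rfl
  have hiso := isotropic_of_oneForm_eq_zero (a := z₀) (κ := fun _ : K => (0 : ℝ))
    (A := fun z : K => ν (0, z)) (B := fun z : K => (g (0, z)).1.2.1)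
    (C := fun z : K => (g (0, z)).2.2.2.2.2) (D := fun z : K => (g (0, z)).1.2.2)
    contDiff_const (hν.comp (contDiff_const.prodMk contDiff_id))
    (hg.smooth.fst.snd.fst.comp (contDiff_const.prodMk contDiff_id))
    (hg.smooth.snd.snd.snd.snd.snd.comp (contDiff_const.prodMk contDiff_id))
    (hg.smooth.fst.snd.snd.comp (contDiff_const.prodMk contDiff_id)) (by
      filter_upwards [hface] with z hz u
      have hdz := hg.hasFDerivAt ((0 : ℝ × ℝ), z)
      rw [fderiv_slice (f := fun p => (g p).1.2.1) hdz.fst.snd.fst.differentiableAt,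
        fderiv_slice (f := fun p => (g p).1.2.2) hdz.fst.snd.snd.differentiableAt]
      simpa using hz.2.2 u)
  refine ⟨hq0.1, hq0.2.1, fun u hu hu1 => ⟨?_, ?_, ?_, ?_, ?_, fun v hv hv1 => ?_⟩⟩
  · obtain ⟨M, hM, hMu⟩ := hasFDerivAt_section h.smooth_fst h.smooth_snd (g (0, z₀)).1
    have e1 := hd.snd.fst.add (hM.comp ((0 : ℝ × ℝ), z₀) hd.fst)
    have e1' : HasFDerivAt (fun p => phaseShift f₁ f₂ (g p)) _ ((0 : ℝ × ℝ), z₀) := e1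
    have e2 := eq_zero_of_slice 0 e1'
      ((ht.eventually (hg.eventually_front h)).mono fun z hz => hz le_rfl rfl) ⟨u, hu⟩
    have e3 : (fderiv ℝ g (0, z₀) (0, ⟨u, hu⟩)).2.1 + M (fderiv ℝ g (0, z₀) (0, ⟨u, hu⟩)).1 = 0 := e2
    rw [hgd, hMu, hg.point, hu1, h.corner, hK u hu] at e3
    simpa using e3
  · have := eq_zero_of_slice 0 hd.snd.snd.snd.fst
      (hface.mono fun z hz => hz.1) ⟨u, hu⟩
    have e3 : (fderiv ℝ g (0, z₀) (0, ⟨u, hu⟩)).2.2.2.1 = 0 := this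
    rwa [hgd] at e3
  · have := eq_zero_of_slice 0 hd.snd.snd.snd.snd.fst
      (hface.mono fun z hz => hz.2.1) ⟨u, hu⟩
    have e3 : (fderiv ℝ g (0, z₀) (0, ⟨u, hu⟩)).2.2.2.2.1 = 0 := this
    rwa [hgd] at e3
  · have e1 := hd.snd.snd.snd.snd.snd.inner ℝ hd.snd.snd.snd.snd.snd
    have e2 := eq_zero_of_slice 1 e1 (by
      filter_upwards [hface, ht.eventually hg.mem_hat] with z a1 a2
      rw [real_inner_self_eq_norm_sq, norm_eq_one_of_cnorm_eq_one
        (cnorm_eq_one_of_mem_hat (a2 le_rfl le_rfl)) a1.1 a1.2.1, one_pow]) ⟨u, hu⟩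
    have e3 : ⟪(g (0, z₀)).2.2.2.2.2, (fderiv ℝ g (0, z₀) (0, ⟨u, hu⟩)).2.2.2.2.2⟫_ℝ +
      ⟪(fderiv ℝ g (0, z₀) (0, ⟨u, hu⟩)).2.2.2.2.2, (g (0, z₀)).2.2.2.2.2⟫_ℝ = 0 := e2
    rw [hgd, hg.point, real_inner_comm] at e3
    linarith
  · have e := hface.self_of_nhds.2.2 ⟨u, hu⟩
    rw [dy₁, dy₂, hu1, inner_zero_right, zero_add, hg.point] at e
    rwa [real_inner_comm]
  · have e := hiso ⟨u, hu⟩ ⟨v, hv⟩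
    rw [fderiv_slice (f := fun p => (g p).1.2.1) hd.fst.snd.fst.differentiableAt,
      fderiv_slice (f := fun p => (g p).1.2.1) hd.fst.snd.fst.differentiableAt,
      fderiv_slice (f := fun p => (g p).1.2.2) hd.fst.snd.snd.differentiableAt,
      fderiv_slice (f := fun p => (g p).1.2.2) hd.fst.snd.snd.differentiableAt,
      fderiv_slice (f := fun p => (g p).2.2.2.2.2) hd.snd.snd.snd.snd.snd.differentiableAt,
      fderiv_slice (f := fun p => (g p).2.2.2.2.2) hd.snd.snd.snd.snd.snd.differentiableAt,
      dy₁, dy₁, dy₂, dy₂, dω₂, dω₂, hu1, hv1, inner_zero_right, inner_zero_right, zero_add,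
      zero_add] at e
    exact e

/-- Linear coordinates on the tangent space of the lift at a point over the corner. -/
theorem IsConicCorner.exists_coord {Γ Γs : Set (CornerPt l m)} {Γ₁ : Set (ScPt l)} {W₁ : Set (EE l)}
    {W : Set (Corner l m)} {f₁ : EE l → ℝ} {f₂ : Corner l m → ℝ} {q : CornerBl l m}
    (h : IsConicCorner Γ Γs Γ₁ W₁ W f₁ f₂ q) {T : Submodule ℝ (CornerBl l m)}
    (hT : IsSubmanifoldAt [xtFun l m (ℝ × ℝ × Corner l m), radius (Corner l m) (Corner l m)]
      (hat cnorm Γ Γs) q T) :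
    q.2.2.2.1 = 0 ∧ q.2.2.2.2.1 = 0 ∧
    ∀ (k : ℕ) (P : EE m →L[ℝ] EE k) (ι : EE k →L[ℝ] EE m),
      (∀ y, ⟪y, q.2.2.2.2.2⟫_ℝ • q.2.2.2.2.2 + ι (P y) = y) →
      (∀ y w, ⟪y, ι w⟫_ℝ = ⟪P y, w⟫_ℝ) →
      ∃ t : ℝ, ∀ v ∈ T, v.1.1 = 0 → v.2.2.1 = 0 → v.1.2.1 = 0 →
        P v.2.2.2.2.2 = t • P v.1.2.2 → v = 0 := by
  obtain ⟨K, g, z₀, hK, hg, hr, hgd⟩ := h.exists_liftChart hT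
  obtain ⟨h1, h2, h3⟩ := hg.tangent_relations h hr (fun v hv => ((hK v).1 hv).2.1) hgd
  refine ⟨h1, h2, fun k P ι hsplit hadj => ?_⟩
  let K' : Submodule ℝ (CornerBl l m) := K ⊓ LinearMap.ker
    ((ContinuousLinearMap.fst ℝ (EE l) (EE m)).comp ((ContinuousLinearMap.snd ℝ ℝ (EE l × EE m)).comp
      (ContinuousLinearMap.fst ℝ (Corner l m) (ℝ × ℝ × Corner l m)))).toLinearMap
  let A : K' →ₗ[ℝ] EE k := P.toLinearMap.comp
    (((ContinuousLinearMap.snd ℝ (EE l) (EE m)).comp ((ContinuousLinearMap.snd ℝ ℝ (EE l × EE m)).comp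
      (ContinuousLinearMap.fst ℝ (Corner l m) (ℝ × ℝ × Corner l m)))).toLinearMap.comp K'.subtype)
  let B : K' →ₗ[ℝ] EE k := P.toLinearMap.comp
    (((ContinuousLinearMap.snd ℝ (EE l) (EE m)).comp ((ContinuousLinearMap.snd ℝ ℝ (EE l × EE m)).comp
      ((ContinuousLinearMap.snd ℝ ℝ (Corner l m)).comp ((ContinuousLinearMap.snd ℝ ℝ
      (ℝ × Corner l m)).comp
      (ContinuousLinearMap.snd ℝ (Corner l m) (ℝ × ℝ × Corner l m)))))).toLinearMap.comp K'.subtype)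
  have hA : ∀ u : K', A u = P (u : CornerBl l m).1.2.2 := fun u => rfl
  have hB : ∀ u : K', B u = P (u : CornerBl l m).2.2.2.2.2 := fun u => rfl
  have hperp : ∀ y, ⟪y, q.2.2.2.2.2⟫_ℝ = 0 → ι (P y) = y := by
    intro y hy
    have := hsplit y
    rwa [hy, zero_smul, zero_add] at this
  -- On vectors with `dy' = 0` both `dy''` and `dω''` are orthogonal to `e`, so `P` loses nothing.
  -- All other components vanish, and `P dy''`, `P dω''` satisfy the isotropy condition in dimension
  -- `k`.
  obtain ⟨t, ht'⟩ := exists_injective_sub_smul A B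
    (fun u hu1 hu2 => by
      obtain ⟨b1, b2, b3, b4, b5, -⟩ := h3 u u.2.1 u.2.2
      have e1 := hperp _ b5
      have e2 := hperp _ b4
      rw [hA] at hu1
      rw [hB] at hu2
      rw [hu1, map_zero] at e1
      rw [hu2, map_zero] at e2
      obtain ⟨-, f1, f2⟩ := (hK u).1 u.2.1
      refine Subtype.ext ?_
      exact Prod.ext (Prod.ext f1 (Prod.ext u.2.2 e1.symm)) (Prod.ext b1
        (Prod.ext f2 (Prod.ext b2 (Prod.ext b3 e2.symm)))))
    (fun u v => by
      obtain ⟨-, -, -, -, b5, b6⟩ := h3 u u.2.1 u.2.2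
      obtain ⟨-, -, -, -, c5, -⟩ := h3 v v.2.1 v.2.2
      have e := b6 v v.2.1 v.2.2
      rw [← hperp _ b5, ← hperp _ c5, hadj, hadj] at e
      exact e)
  refine ⟨t, fun v hv hv1 hv2 hv3 hv4 => ?_⟩
  exact congrArg Subtype.val (ht' ⟨v, (hK v).2 ⟨hv, hv1, hv2⟩, hv3⟩ hv4)

end ConicCoordinates

/-! ### The phase function of the lift -/

section ConePhase

open Filter

variable {l m k : ℕ}

/-- Inclusion of the variables `y'`. -/
def inclBase (l k : ℕ) : EE l →L[ℝ] (ℝ × ℝ) × (EE l × EE k) :=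
  (ContinuousLinearMap.inr ℝ (ℝ × ℝ) (EE l × EE k)).comp (ContinuousLinearMap.inl ℝ (EE l) (EE k))

/-- Inclusion of the phase variables `w`. -/
def inclPhase (l k : ℕ) : EE k →L[ℝ] (ℝ × ℝ) × (EE l × EE k) :=
  (ContinuousLinearMap.inr ℝ (ℝ × ℝ) (EE l × EE k)).comp (ContinuousLinearMap.inr ℝ (EE l) (EE k))

theorem inclBase_apply (v : EE l) : inclBase l k v = (0, (v, 0)) := rfl

theorem inclPhase_apply (v : EE k) : inclPhase l k v = (0, (0, v)) := rfl

/-- The function `⟪y'', e⟫ + ⟪P y'', w⟫ + t/2 ⟪P y'', P y''⟫`. -/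
def coneQuad (e : EE m) (P : EE m →L[ℝ] EE k) (t : ℝ) (y'' : EE m) (w : EE k) : ℝ :=
  ⟪y'', e⟫_ℝ + ⟪P y'', w⟫_ℝ + t / 2 * ⟪P y'', P y''⟫_ℝ

theorem contDiff_coneQuad (e : EE m) (P : EE m →L[ℝ] EE k) (t : ℝ) :
    ContDiff ℝ ∞ fun z : EE m × EE k => coneQuad e P t z.1 z.2 := by
  have h1 : ContDiff ℝ ∞ fun z : EE m × EE k => P z.1 := P.contDiff.comp contDiff_fst
  exact ((contDiff_fst.inner ℝ contDiff_const).add (h1.inner ℝ contDiff_snd)).add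
    (contDiff_const.mul (h1.inner ℝ h1))

theorem hasGradientAt_coneQuad_left {e : EE m} {P : EE m →L[ℝ] EE k} {ι : EE k →L[ℝ] EE m}
    (hadj : ∀ y w, ⟪y, ι w⟫_ℝ = ⟪P y, w⟫_ℝ) (t : ℝ) (y : EE m) (w : EE k) :
    HasGradientAt (fun y => coneQuad e P t y w) (e + ι (w + t • P y)) y := by
  have hP := P.hasFDerivAt (x := y)
  have h1 := (hP.inner ℝ hP).const_mul (t / 2)
  have h2 : HasGradientAt (fun y => t / 2 * ⟪P y, P y⟫_ℝ) (t • ι (P y)) y := by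
    rw [hasGradientAt_iff_hasFDerivAt]
    refine h1.congr_fderiv ?_
    ext u
    simp only [InnerProductSpace.toDual_apply_apply, _root_.smul_apply,
      ContinuousLinearMap.comp_apply, fderivInnerCLM_apply, ContinuousLinearMap.prod_apply,
      smul_eq_mul, real_inner_smul_left]
    rw [real_inner_comm u (ι (P y)), hadj, real_inner_comm (P y) (P u)]
    ring
  have h3 : HasGradientAt (fun y => ⟪P y, w⟫_ℝ) (ι w) y := by
    simpa only [hadj] using hasGradientAt_inner_right (ι w) y
  have h4 := ((hasGradientAt_inner_right e y).add' h3).add' h2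
  rw [map_add, map_smul, ← add_assoc]
  exact h4

theorem hasGradientAt_coneQuad_right (e : EE m) (P : EE m →L[ℝ] EE k) (t : ℝ) (y : EE m)
    (w : EE k) : HasGradientAt (fun w => coneQuad e P t y w) (P y) w := by
  have h := ((hasGradientAt_const' ⟪y, e⟫_ℝ w).add' (hasGradientAt_inner_left (P y) w)).add'
    (hasGradientAt_const' (t / 2 * ⟪P y, P y⟫_ℝ) w)
  rw [zero_add, add_zero] at h
  exact h

theorem hasFDerivAt_coneQuad {X : Type*} [NormedAddCommGroup X] [NormedSpace ℝ X] {e : EE m}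
    {P : EE m →L[ℝ] EE k} {ι : EE k →L[ℝ] EE m} (hadj : ∀ y w, ⟪y, ι w⟫_ℝ = ⟪P y, w⟫_ℝ) (t : ℝ)
    {Y : X → EE m} {w : X → EE k} {Y' : X →L[ℝ] EE m} {w' : X →L[ℝ] EE k} {p : X}
    (hY : HasFDerivAt Y Y' p) (hw : HasFDerivAt w w' p) :
    ∃ L : X →L[ℝ] ℝ, HasFDerivAt (fun p => coneQuad e P t (Y p) (w p)) L p ∧
      ∀ u, L u = ⟪e + ι (w p + t • P (Y p)), Y' u⟫_ℝ + ⟪P (Y p), w' u⟫_ℝ := by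
  have hP := P.hasFDerivAt.comp p hY
  refine ⟨_, ((hY.inner ℝ (hasFDerivAt_const e p)).add (hP.inner ℝ hw)).add
    ((hP.inner ℝ hP).const_mul (t / 2)), fun u => ?_⟩
  have h1 : ⟪e + ι (w p + t • P (Y p)), Y' u⟫_ℝ =
      ⟪Y' u, e⟫_ℝ + ⟪P (Y' u), w p⟫_ℝ + t * ⟪P (Y' u), P (Y p)⟫_ℝ := by
    rw [real_inner_comm, inner_add_right, hadj, inner_add_right, real_inner_smul_right]
    ring
  rw [h1]
  simp only [_root_.add_apply, _root_.smul_apply, _root_.zero_apply,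
    ContinuousLinearMap.comp_apply, fderivInnerCLM_apply, ContinuousLinearMap.prod_apply,
    smul_eq_mul, inner_zero_right, zero_add, Function.comp_apply]
  rw [real_inner_comm (P (Y p)) (P (Y' u))]
  ring

/-- The generating function of a family of covectors `s D` over the points `(xt, y', Y'')`: if
`dτ + s (D₀ dxt + D'·dy' + xt D''·dY'')` vanishes and `D'' = e + ι (w + t P Y'')`, then `-τ/(xt s)`
is, up to `coneQuad`, a function with prescribed derivatives. -/
theorem exists_coneFun {e : EE m} {P : EE m →L[ℝ] EE k} {ι : EE k →L[ℝ] EE m}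
    (hadj : ∀ y w, ⟪y, ι w⟫_ℝ = ⟪P y, w⟫_ℝ) (t : ℝ)
    {τ : (ℝ × ℝ) × (EE l × EE k) → ℝ} {Y : (ℝ × ℝ) × (EE l × EE k) → EE m}
    {D : (ℝ × ℝ) × (EE l × EE k) → Corner l m} {z₀ : EE l × EE k}
    (hτ : ContDiff ℝ ∞ τ) (hY : ContDiff ℝ ∞ Y) (hD : ContDiff ℝ ∞ D)
    (h1 : ∀ᶠ p in 𝓝 ((0 : ℝ × ℝ), z₀), 0 < p.1.2 → p.1.1 = 0 → τ p = 0)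
    (h2 : ∀ᶠ p in 𝓝 ((0 : ℝ × ℝ), z₀), 0 < p.1.1 → p.1.2 = 0 → τ p = 0)
    (hD₂ : ∀ᶠ p in 𝓝 ((0 : ℝ × ℝ), z₀), (D p).2.2 = e + ι (p.2.2 + t • P (Y p)))
    (hc : ∀ᶠ p in 𝓝 ((0 : ℝ × ℝ), z₀), 0 < p.1.1 ∧ 0 < p.1.2 → ∀ u, fderiv ℝ τ p u +
      p.1.2 * ((D p).1 * u.1.1 + ⟪(D p).2.1, u.2.1⟫_ℝ + p.1.1 * ⟪(D p).2.2, fderiv ℝ Y p u⟫_ℝ) = 0) :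
    ∃ h : (ℝ × ℝ) × (EE l × EE k) → ℝ, ContDiff ℝ ∞ h ∧
      ∀ᶠ p in 𝓝 ((0 : ℝ × ℝ), z₀), 0 ≤ p.1.1 ∧ 0 ≤ p.1.2 →
        τ p = -(p.1.2 * p.1.1 * (coneQuad e P t (Y p) p.2.2 + h p)) ∧
        (coneQuad e P t (Y p) p.2.2 + h p) + p.1.1 * fderiv ℝ h p ((1, 0), 0) = (D p).1 ∧
        (coneQuad e P t (Y p) p.2.2 + h p) + p.1.2 * fderiv ℝ h p ((0, 1), 0) = 0 ∧
        p.1.1 • partialGradient (inclBase l k) h p = (D p).2.1 ∧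
        P (Y p) + partialGradient (inclPhase l k) h p = 0 := by
  obtain ⟨κ, hκ, hτκ⟩ := exists_contDiff_eq_mul_mul hτ h1 h2
  have hw : ContDiff ℝ ∞ fun p : (ℝ × ℝ) × (EE l × EE k) => p.2.2 := by fun_prop
  have hQ : ContDiff ℝ ∞ fun p : (ℝ × ℝ) × (EE l × EE k) => coneQuad e P t (Y p) p.2.2 :=
    (contDiff_coneQuad e P t).comp (hY.prodMk hw)
  -- With `τ = xt s κ` the phase must take the value `-κ` at the critical point `y'' = Y`; this
  -- determines `h`.
  set h : (ℝ × ℝ) × (EE l × EE k) → ℝ := fun p => -κ p - coneQuad e P t (Y p) p.2.2 with hh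
  have hs : ContDiff ℝ ∞ h := hκ.neg.sub hQ
  have hG : ∀ p, coneQuad e P t (Y p) p.2.2 + h p = -κ p := fun p => by simp only [hh]; ring
  refine ⟨h, hs, ?_⟩
  -- Since `D''` is the `y''`-gradient of `coneQuad`, the terms containing `dY` cancel, and the
  -- contact form prescribes the derivatives of `h` in `xt`, `s`, `y'` and `w`. The five identities
  -- follow by dividing by the respective monomials.
  have hpos : ∀ᶠ p in 𝓝 ((0 : ℝ × ℝ), z₀), 0 < p.1.1 ∧ 0 < p.1.2 → ∀ u,
      p.1.1 * p.1.2 * fderiv ℝ h p u = p.1.2 * (κ p + (D p).1) * u.1.1 + p.1.1 * κ p * u.1.2 +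
        p.1.2 * ⟪(D p).2.1, u.2.1⟫_ℝ - p.1.1 * p.1.2 * ⟪P (Y p), u.2.2⟫_ℝ := by
    filter_upwards [hc, hτκ.eventually_nhds, hD₂] with p c1 c2 c3 c0 u
    have e0 : HasFDerivAt (fun p : (ℝ × ℝ) × (EE l × EE k) => p) (ContinuousLinearMap.id ℝ _) p :=
      hasFDerivAt_id p
    have hκd := ((hκ.differentiable (by simp)) p).hasFDerivAt
    have e1 := (e0.fst.fst.mul e0.fst.snd).mul hκd
    have e2 : HasFDerivAt τ _ p := e1.congr_of_eventuallyEq (by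
      have t1 : ∀ᶠ p' in 𝓝 p, 0 < p'.1.1 :=
        (by fun_prop : Continuous fun p : (ℝ × ℝ) × (EE l × EE k) => p.1.1).continuousAt.eventually
          (lt_mem_nhds c0.1)
      have t2 : ∀ᶠ p' in 𝓝 p, 0 < p'.1.2 :=
        (by fun_prop : Continuous fun p : (ℝ × ℝ) × (EE l × EE k) => p.1.2).continuousAt.eventually
          (lt_mem_nhds c0.2)
      filter_upwards [c2, t1, t2] with p' a1 a2 a3 using a1 a2.le a3.le)
    obtain ⟨L, hL, hLu⟩ := hasFDerivAt_coneQuad (e := e) hadj t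
      ((hY.differentiable (by simp)) p).hasFDerivAt e0.snd.snd
    have hhd : HasFDerivAt h _ p := hκd.neg.sub hL
    have e3 := c1 c0 u
    rw [e2.fderiv] at e3
    simp only [_root_.add_apply, _root_.smul_apply, ContinuousLinearMap.comp_apply,
      ContinuousLinearMap.coe_fst', ContinuousLinearMap.coe_snd', ContinuousLinearMap.id_apply,
      smul_eq_mul, Pi.mul_apply] at e3
    rw [hhd.fderiv]
    simp only [_root_.sub_apply, _root_.neg_apply, hLu, ContinuousLinearMap.comp_apply,
      ContinuousLinearMap.coe_snd', ContinuousLinearMap.id_apply]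
    rw [c3] at e3
    linear_combination (-1 : ℝ) * e3
  have hfd : ∀ v, Continuous fun p => fderiv ℝ h p v := fun v =>
    (hs.continuous_fderiv (by simp)).clm_apply continuous_const
  have hc1 : Continuous fun p : (ℝ × ℝ) × (EE l × EE k) => p.1.1 := by fun_prop
  have hc2 : Continuous fun p : (ℝ × ℝ) × (EE l × EE k) => p.1.2 := by fun_prop
  have k1 := eventually_eq_zero_of_closure (a := ((0 : ℝ × ℝ), z₀))
    (A := fun p => -κ p + p.1.1 * fderiv ℝ h p ((1, 0), 0) - (D p).1)
    ((hκ.continuous.neg.add (hc1.mul (hfd _))).sub hD.continuous.fst) quadrant_add_mem (by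
      filter_upwards [hpos] with p hp h0
      have e := hp h0 ((1, 0), 0)
      simp only [mul_one, mul_zero, Prod.fst_zero, Prod.snd_zero, inner_zero_right] at e
      have e' : p.1.2 * (-κ p + p.1.1 * fderiv ℝ h p ((1, 0), 0) - (D p).1) = 0 := by
        linear_combination e
      exact (mul_eq_zero.1 e').resolve_left h0.2.ne')
  have k2 := eventually_eq_zero_of_closure (a := ((0 : ℝ × ℝ), z₀))
    (A := fun p => -κ p + p.1.2 * fderiv ℝ h p ((0, 1), 0))
    (hκ.continuous.neg.add (hc2.mul (hfd _))) quadrant_add_mem (by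
      filter_upwards [hpos] with p hp h0
      have e := hp h0 ((0, 1), 0)
      simp only [mul_one, mul_zero, Prod.fst_zero, Prod.snd_zero, inner_zero_right] at e
      have e' : p.1.1 * (-κ p + p.1.2 * fderiv ℝ h p ((0, 1), 0)) = 0 := by
        linear_combination e
      exact (mul_eq_zero.1 e').resolve_left h0.1.ne')
  have k3 := eventually_eq_zero_of_closure (a := ((0 : ℝ × ℝ), z₀))
    (A := fun p => p.1.1 • partialGradient (inclBase l k) h p - (D p).2.1)
    ((hc1.smul (contDiff_partialGradient _ hs).continuous).sub hD.continuous.snd.fst)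
    quadrant_add_mem (by
      filter_upwards [hpos] with p hp h0
      rw [sub_eq_zero]
      refine ext_inner_right ℝ fun v => ?_
      have e := hp h0 (inclBase l k v)
      rw [real_inner_smul_left, inner_partialGradient]
      simp only [inclBase_apply, mul_zero, Prod.fst_zero, Prod.snd_zero, inner_zero_right] at e ⊢
      refine mul_left_cancel₀ h0.2.ne' ?_
      linear_combination e)
  have k4 := eventually_eq_zero_of_closure (a := ((0 : ℝ × ℝ), z₀))
    (A := fun p => P (Y p) + partialGradient (inclPhase l k) h p)
    ((P.continuous.comp hY.continuous).add (contDiff_partialGradient _ hs).continuous)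
    quadrant_add_mem (by
      filter_upwards [hpos] with p hp h0
      refine ext_inner_right ℝ fun v => ?_
      have e := hp h0 (inclPhase l k v)
      rw [inner_add_left, inner_partialGradient, inner_zero_left]
      simp only [inclPhase_apply, mul_zero, Prod.fst_zero, Prod.snd_zero, inner_zero_right] at e ⊢
      refine mul_left_cancel₀ (mul_pos h0.1 h0.2).ne' ?_
      linear_combination e)
  filter_upwards [k1, k2, k3, k4, hτκ] with p a1 a2 a3 a4 a5 a0
  rw [hG]
  exact ⟨by rw [a5 a0.1 a0.2]; ring, sub_eq_zero.1 (a1 a0), a2 a0, sub_eq_zero.1 (a3 a0), a4 a0⟩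

/-- The phase function `coneQuad + h`. -/
def conePhase (e : EE m) (P : EE m →L[ℝ] EE k) (t : ℝ) (h : (ℝ × ℝ) × (EE l × EE k) → ℝ)
    (xt : ℝ) (y' : EE l) (y'' : EE m) (s : ℝ) (w : EE k) : ℝ :=
  coneQuad e P t y'' w + h ((xt, s), (y', w))

variable {e : EE m} {P : EE m →L[ℝ] EE k} {ι : EE k →L[ℝ] EE m} {t : ℝ}
  {h : (ℝ × ℝ) × (EE l × EE k) → ℝ}

theorem contDiff_conePhase (hs : ContDiff ℝ ∞ h) :
    ContDiff ℝ ∞ fun z : ℝ × EE l × EE m × ℝ × EE k =>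
      conePhase e P t h z.1 z.2.1 z.2.2.1 z.2.2.2.1 z.2.2.2.2 := by
  have h1 : ContDiff ℝ ∞ fun z : ℝ × EE l × EE m × ℝ × EE k => (z.2.2.1, z.2.2.2.2) := by fun_prop
  have h2 : ContDiff ℝ ∞ fun z : ℝ × EE l × EE m × ℝ × EE k =>
    ((z.1, z.2.2.2.1), (z.2.1, z.2.2.2.2)) := by fun_prop
  exact ((contDiff_coneQuad e P t).comp h1).add (hs.comp h2)

theorem gradient_conePhase (hs : ContDiff ℝ ∞ h) (xt : ℝ) (y' : EE l) (y'' : EE m) (s : ℝ)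
    (w : EE k) : gradient (fun w => conePhase e P t h xt y' y'' s w) w =
      P y'' + partialGradient (inclPhase l k) h ((xt, s), (y', w)) := by
  have h1 := hasGradientAt_comp (f := h) (c := fun w => ((xt, s), (y', w)))
    ((hs.differentiable (by simp)) _)
    ((hasFDerivAt_prodMk_right (xt, s) (y', w)).comp w (hasFDerivAt_prodMk_right y' w))
  exact ((hasGradientAt_coneQuad_right e P t y'' w).add' h1).gradient

theorem deriv_conePhase (hs : ContDiff ℝ ∞ h) (xt : ℝ) (y' : EE l) (y'' : EE m) (s : ℝ)
    (w : EE k) : deriv (fun s => conePhase e P t h xt y' y'' s w) s =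
      fderiv ℝ h ((xt, s), (y', w)) ((0, 1), 0) := by
  have h1 := ((hs.differentiable (n := ∞) (by simp)) ((xt, s), (y', w))).hasFDerivAt.comp_hasDerivAt s
    (((hasDerivAt_const s xt).prodMk (hasDerivAt_id s)).prodMk (hasDerivAt_const s (y', w)))
  exact (h1.const_add (coneQuad e P t y'' w)).deriv

/-- As `h` does not involve `y''`, the last component is the gradient of `coneQuad`, which has the
form of the rescaled direction `D''` on the lift. -/
theorem coneDir_conePhase (hadj : ∀ y w, ⟪y, ι w⟫_ℝ = ⟪P y, w⟫_ℝ) (hs : ContDiff ℝ ∞ h) (xt : ℝ)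
    (y' : EE l) (y'' : EE m) (s : ℝ) (w : EE k) :
    coneDir (fun xt y' y'' => conePhase e P t h xt y' y'' s w) xt y' y'' =
      ((coneQuad e P t y'' w + h ((xt, s), (y', w))) +
          xt * fderiv ℝ h ((xt, s), (y', w)) ((1, 0), 0),
        xt • partialGradient (inclBase l k) h ((xt, s), (y', w)), e + ι (w + t • P y'')) := by
  have hd := hs.differentiable (n := ∞) (by simp)
  have h1 := (hd ((xt, s), (y', w))).hasFDerivAt.comp_hasDerivAt xt
    (((hasDerivAt_id xt).prodMk (hasDerivAt_const xt s)).prodMk (hasDerivAt_const xt (y', w)))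
  have h2 := hasGradientAt_comp (f := h) (c := fun y' => ((xt, s), (y', w))) (hd _)
    ((hasFDerivAt_prodMk_right (xt, s) (y', w)).comp y' (hasFDerivAt_prodMk_left y' w))
  have e1 : deriv (fun xt => conePhase e P t h xt y' y'' s w) xt = _ :=
    (h1.const_add (coneQuad e P t y'' w)).deriv
  have e2 : gradient (fun y' => conePhase e P t h xt y' y'' s w) y' =
      partialGradient (inclBase l k) h ((xt, s), (y', w)) := by
    have := ((hasGradientAt_const' (coneQuad e P t y'' w) y').add' h2).gradient
    rw [zero_add] at this
    exact this
  have e3 : gradient (fun y'' => conePhase e P t h xt y' y'' s w) y'' = e + ι (w + t • P y'') := by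
    have := ((hasGradientAt_coneQuad_left (e := e) hadj t y'' w).add'
      (hasGradientAt_const' (h ((xt, s), (y', w))) y'')).gradient
    rw [add_zero] at this
    exact this
  simp only [coneDir, e1, e2, e3]
  rfl

theorem fderiv_conePhase_apply (hadj : ∀ y w, ⟪y, ι w⟫_ℝ = ⟪P y, w⟫_ℝ) (hs : ContDiff ℝ ∞ h)
    (xt : ℝ) (y' : EE l) (s : ℝ) (z : EE m × EE k) (v : EE m) :
    fderiv ℝ (fun z : EE m × EE k => conePhase e P t h xt y' z.1 s z.2) z (v, 0) =
      ⟪e + ι (z.2 + t • P z.1), v⟫_ℝ := by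
  have e0 : HasFDerivAt (fun z : EE m × EE k => z) (ContinuousLinearMap.id ℝ _) z :=
    hasFDerivAt_id z
  obtain ⟨L, hL, hLu⟩ := hasFDerivAt_coneQuad (e := e) hadj t e0.fst e0.snd
  have h1 := ((hs.differentiable (n := ∞) (by simp)) ((xt, s), (y', z.2))).hasFDerivAt.comp z
    ((hasFDerivAt_const (xt, s) z).prodMk ((hasFDerivAt_const y' z).prodMk e0.snd))
  have h2 : fderiv ℝ (fun z : EE m × EE k => conePhase e P t h xt y' z.1 s z.2) z = _ :=
    (hL.add h1).fderiv
  rw [h2]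
  simp only [_root_.add_apply, hLu, ContinuousLinearMap.comp_apply,
    ContinuousLinearMap.prod_apply, ContinuousLinearMap.id_apply, ContinuousLinearMap.coe_fst',
    ContinuousLinearMap.coe_snd', _root_.zero_apply, inner_zero_right, add_zero]
  exact add_eq_left.2 (map_zero (fderiv ℝ h ((xt, s), (y', z.2))))

end ConePhase

/-! ### Rescaled coordinates on the lift -/

section ConicChart

open Filter

variable {l m k : ℕ}

/-- The coordinates `xt`, `s = r ⟪ω'', e⟫`, `y'`, `w = P ω'' / ⟪ω'', e⟫ - t P y''` on the lift. -/
def conicCoord (e : EE m) (P : EE m →L[ℝ] EE k) (t : ℝ) (z : CornerBl l m) :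
    (ℝ × ℝ) × (EE l × EE k) :=
  ((z.1.1, z.2.2.1 * ⟪z.2.2.2.2.2, e⟫_ℝ),
    (z.1.2.1, (⟪z.2.2.2.2.2, e⟫_ℝ)⁻¹ • P z.2.2.2.2.2 - t • P z.1.2.2))

theorem contDiffOn_conicCoord (e : EE m) (P : EE m →L[ℝ] EE k) (t : ℝ) :
    ContDiffOn ℝ ∞ (conicCoord e P t) {z : CornerBl l m | 0 < ⟪z.2.2.2.2.2, e⟫_ℝ} := by
  have h1 : ContDiff ℝ ∞ fun z : CornerBl l m => z.2.2.2.2.2 := by fun_prop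
  have h2 : ContDiff ℝ ∞ fun z : CornerBl l m => ⟪z.2.2.2.2.2, e⟫_ℝ := h1.inner ℝ contDiff_const
  have h3 : ContDiff ℝ ∞ fun z : CornerBl l m => z.1.2.2 := by fun_prop
  have h4 : ContDiff ℝ ∞ fun z : CornerBl l m => z.1.1 := by fun_prop
  have h5 : ContDiff ℝ ∞ fun z : CornerBl l m => z.2.2.1 := by fun_prop
  have h6 : ContDiff ℝ ∞ fun z : CornerBl l m => z.1.2.1 := by fun_prop
  have h7 : ContDiff ℝ ∞ fun z : CornerBl l m => t • P z.1.2.2 :=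
    (P.contDiff.comp h3).const_smul t
  exact (h4.prodMk (h5.mul h2)).contDiffOn.prodMk (h6.contDiffOn.prodMk
    (((h2.contDiffOn.inv fun z hz => ne_of_gt hz).smul (P.contDiff.comp h1).contDiffOn).sub
      h7.contDiffOn))

/-- At `q` the equations `r = 0` and `P ω'' = 0` suppress the derivative of the scaling factor
`⟪ω'', e⟫`, whose value is `1`. The linearization is therefore the system of linear coordinates
already found on the tangent space. -/
theorem hasFDerivAt_conicCoord {P : EE m →L[ℝ] EE k} (t : ℝ) {q : CornerBl l m}
    (hr : q.2.2.1 = 0) (he : ‖q.2.2.2.2.2‖ = 1) (hP : P q.2.2.2.2.2 = 0) :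
    ∃ L : CornerBl l m →L[ℝ] (ℝ × ℝ) × (EE l × EE k),
      HasFDerivAt (conicCoord q.2.2.2.2.2 P t) L q ∧
      ∀ v, L v = ((v.1.1, v.2.2.1), (v.1.2.1, P v.2.2.2.2.2 - t • P v.1.2.2)) := by
  have e0 : HasFDerivAt (fun z : CornerBl l m => z) (ContinuousLinearMap.id ℝ _) q :=
    hasFDerivAt_id q
  have hω := e0.snd.snd.snd.snd.snd
  have hc := hω.inner ℝ (hasFDerivAt_const q.2.2.2.2.2 q)
  have hee : ⟪q.2.2.2.2.2, q.2.2.2.2.2⟫_ℝ = 1 := by rw [real_inner_self_eq_norm_sq, he, one_pow]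
  have hi := (hasDerivAt_inv (x := ⟪q.2.2.2.2.2, q.2.2.2.2.2⟫_ℝ)
    (by rw [hee]; exact one_ne_zero)).comp_hasFDerivAt q hc
  refine ⟨_, (e0.fst.fst.prodMk (e0.snd.snd.fst.mul hc)).prodMk (e0.fst.snd.fst.prodMk
    ((hi.smul (P.hasFDerivAt.comp q hω)).sub ((P.hasFDerivAt.comp q e0.fst.snd.snd).const_smul t))),
    fun v => ?_⟩
  simp only [ContinuousLinearMap.prod_apply, ContinuousLinearMap.comp_apply,
    ContinuousLinearMap.id_apply, ContinuousLinearMap.coe_fst', ContinuousLinearMap.coe_snd',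
    _root_.add_apply, _root_.sub_apply, _root_.smul_apply, ContinuousLinearMap.smulRight_apply,
    Function.comp_apply, hr, hee, hP, smul_zero, add_zero, zero_smul, zero_add, inv_one, one_smul]

/-- A point of the lift whose coordinates are `p`, in terms of the rescaled direction
`D = ω / ⟪ω'', e⟫`. -/
theorem eq_of_conicCoord_eq {e : EE m} {P : EE m →L[ℝ] EE k} {ι : EE k →L[ℝ] EE m} {t : ℝ}
    (hsplit : ∀ y, ⟪y, e⟫_ℝ • e + ι (P y) = y) {z : CornerBl l m} {p : (ℝ × ℝ) × (EE l × EE k)}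
    (hz : 0 < ⟪z.2.2.2.2.2, e⟫_ℝ) (h : conicCoord e P t z = p) :
    z.1.1 = p.1.1 ∧ z.1.2.1 = p.2.1 ∧ z.2.2.1 = p.1.2 * (⟪z.2.2.2.2.2, e⟫_ℝ)⁻¹ ∧
      (⟪z.2.2.2.2.2, e⟫_ℝ)⁻¹ • z.2.2.2.2.2 = e + ι (p.2.2 + t • P z.1.2.2) := by
  subst h
  refine ⟨rfl, rfl, ?_, ?_⟩
  · simp only [conicCoord]
    rw [mul_assoc, mul_inv_cancel₀ hz.ne', mul_one]
  · simp only [conicCoord, sub_add_cancel, map_smul]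
    have := congrArg (fun y => (⟪z.2.2.2.2.2, e⟫_ℝ)⁻¹ • y) (hsplit z.2.2.2.2.2)
    simp only [smul_add, smul_smul, inv_mul_cancel₀ hz.ne', one_smul] at this
    exact this.symm

/-- Near a point over the corner, `conicCoord` are coordinates on the lift. -/
theorem IsConicCorner.exists_conicChart {Γ Γs : Set (CornerPt l m)} {Γ₁ : Set (ScPt l)}
    {W₁ : Set (EE l)} {W : Set (Corner l m)} {f₁ : EE l → ℝ} {f₂ : Corner l m → ℝ}
    {q : CornerBl l m} (h : IsConicCorner Γ Γs Γ₁ W₁ W f₁ f₂ q) {T : Submodule ℝ (CornerBl l m)}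
    (hT : IsSubmanifoldAt [xtFun l m (ℝ × ℝ × Corner l m), radius (Corner l m) (Corner l m)]
      (hat cnorm Γ Γs) q T) (hTd : Module.finrank ℝ T = l + m + 1) (hm : m = k + 1)
    {P : EE m →L[ℝ] EE k} (hP : P q.2.2.2.2.2 = 0) (he : ‖q.2.2.2.2.2‖ = 1) {t : ℝ}
    (ht : ∀ v ∈ T, v.1.1 = 0 → v.2.2.1 = 0 → v.1.2.1 = 0 →
      P v.2.2.2.2.2 = t • P v.1.2.2 → v = 0) :
    ∃ g : (ℝ × ℝ) × (EE l × EE k) → CornerBl l m,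
      IsLiftChart Γ Γs W q g (q.1.2.1, -(t • P q.1.2.2)) ∧
      (∀ᶠ p in 𝓝 ((0 : ℝ × ℝ), (q.1.2.1, -(t • P q.1.2.2))),
        0 < ⟪(g p).2.2.2.2.2, q.2.2.2.2.2⟫_ℝ ∧ conicCoord q.2.2.2.2.2 P t (g p) = p) ∧
      ∀ᶠ z in 𝓝 q, z ∈ hat cnorm Γ Γs →
        0 ≤ z.1.1 ∧ 0 ≤ z.2.2.1 ∧ g (conicCoord q.2.2.2.2.2 P t z) = z := by
  obtain ⟨c, F, U, hU, hqU, hF, hS, hsurj, rfl⟩ := hT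
  have hmem : ∀ z ∈ U, z ∈ hat cnorm Γ Γs ↔ 0 ≤ z.1.1 ∧ 0 ≤ z.2.2.1 ∧ F z = 0 :=
    fun z hz => mem_iff_of_cornerFaces (hS z hz)
  have hr : q.2.2.1 = 0 := h.mem_lift.2.1
  have hee : ⟪q.2.2.2.2.2, q.2.2.2.2.2⟫_ℝ = 1 := by rw [real_inner_self_eq_norm_sq, he, one_pow]
  set e := q.2.2.2.2.2 with hedef
  set V : Set (CornerBl l m) := {z | 0 < ⟪z.2.2.2.2.2, e⟫_ℝ} with hV
  have hVo : IsOpen V := isOpen_lt continuous_const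
    ((by fun_prop : Continuous fun z : CornerBl l m => z.2.2.2.2.2).inner continuous_const)
  have hqV : q ∈ V := by
    rw [hV, Set.mem_ofPred_eq, ← hedef, hee]; exact one_pos
  obtain ⟨L, hL, hLv⟩ := hasFDerivAt_conicCoord t hr he hP
  have hΦq : conicCoord e P t q = ((0 : ℝ × ℝ), (q.1.2.1, -(t • P q.1.2.2))) := by
    simp only [conicCoord, h.corner, hr, zero_mul, ← hedef, hP, smul_zero, zero_sub]
    rfl
  obtain ⟨g, hg, hga, hgp, hgz⟩ := exists_levelSet_chart (Φ := conicCoord e P t)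
    (hU.inter hVo) ⟨hqU, hqV⟩ (hF.mono Set.inter_subset_left)
    ((contDiffOn_conicCoord e P t).mono Set.inter_subset_right)
    ((hmem q hqU).1 (Or.inr h.mem_lift)).2.2 (by
      rw [hL.fderiv]
      refine bijective_prod_of_finrank (fun y => ?_) ?_ fun v h1 h2 => ?_
      · obtain ⟨v, -, hv⟩ := hsurj y
        exact ⟨v, hv⟩
      -- The coordinates number `1 + 1 + l + k`, which is `l + m + 1` because `m = k + 1`.
      · rw [hTd, hm]
        simp
        omega
      · rw [hLv] at h2
        simp only [Prod.mk_eq_zero, sub_eq_zero] at h2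
        exact ht v h1 h2.1.1 h2.1.2 h2.2.1 h2.2.2)
  rw [hΦq] at hga hgp
  have hgt : Tendsto g (𝓝 ((0 : ℝ × ℝ), (q.1.2.1, -(t • P q.1.2.2)))) (𝓝 q) := by
    have := hg.continuous.tendsto ((0 : ℝ × ℝ), (q.1.2.1, -(t • P q.1.2.2)))
    rwa [hga] at this
  have hx : ∀ᶠ p in 𝓝 ((0 : ℝ × ℝ), (q.1.2.1, -(t • P q.1.2.2))), 0 < ⟪(g p).2.2.2.2.2, e⟫_ℝ ∧
      (g p).1.1 = p.1.1 ∧ (g p).2.2.1 * ⟪(g p).2.2.2.2.2, e⟫_ℝ = p.1.2 := by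
    filter_upwards [hgp] with p hp
    exact ⟨hp.1.2, congrArg (fun p => p.1.1) hp.2.2, congrArg (fun p => p.1.2) hp.2.2⟩
  refine ⟨g, ⟨hg, hga, hgt.fst_nhds.eventually (h.graph.2.1.mem_nhds h.mem_patch),
    hx.mono fun p hp => hp.2.1, ?_, ?_, ?_⟩, hgp.mono fun p hp => ⟨hp.1.2, hp.2.2⟩, ?_⟩
  · filter_upwards [hgp, hx] with p hp hp' a b
    refine (hmem _ hp.1.1).2 ⟨by rwa [hp'.2.1], ?_, hp.2.1⟩
    rw [← hp'.2.2] at b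
    -- Since `s = r ⟪ω'', e⟫` with a positive factor, `s` and `r` have the same sign and the same
    -- zeros.
    exact nonneg_of_mul_nonneg_left b hp'.1
  · filter_upwards [hx] with p hp a
    rw [← hp.2.2] at a
    exact pos_of_mul_pos_left a hp.1.le
  · filter_upwards [hx] with p hp a
    rw [← hp.2.2] at a
    exact (mul_eq_zero.1 a).resolve_right hp.1.ne'
  · filter_upwards [hgz, hU.mem_nhds hqU] with z a1 a2 a3
    obtain ⟨b1, b2, b3⟩ := (hmem z a2).1 a3
    exact ⟨b1, b2, a1 b3⟩

end ConicChart

/-! ### Non-degenerate parametrization of the lift -/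

section ConicParametrization

open Filter

variable {l m k : ℕ}

/-- The lift is the image of the critical points of `conePhase`, for a suitable `h`. -/
theorem IsLiftChart.exists_conePhase {Γ Γs : Set (CornerPt l m)} {Γ₁ : Set (ScPt l)}
    {W₁ : Set (EE l)} {W : Set (Corner l m)} {f₁ : EE l → ℝ} {f₂ : Corner l m → ℝ}
    {q : CornerBl l m} (h : IsConicCorner Γ Γs Γ₁ W₁ W f₁ f₂ q) {e : EE m}
    {P : EE m →L[ℝ] EE k} {ι : EE k →L[ℝ] EE m} {t : ℝ}
    (hsplit : ∀ y, ⟪y, e⟫_ℝ • e + ι (P y) = y) (hadj : ∀ y w, ⟪y, ι w⟫_ℝ = ⟪P y, w⟫_ℝ)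
    {g : (ℝ × ℝ) × (EE l × EE k) → CornerBl l m} {z₀ : EE l × EE k}
    (hg : IsLiftChart Γ Γs W q g z₀)
    (hcoord : ∀ᶠ p in 𝓝 ((0 : ℝ × ℝ), z₀), 0 < ⟪(g p).2.2.2.2.2, e⟫_ℝ ∧ conicCoord e P t (g p) = p) :
    ∃ h : (ℝ × ℝ) × (EE l × EE k) → ℝ, ContDiff ℝ ∞ h ∧
      ∀ᶠ p in 𝓝 ((0 : ℝ × ℝ), z₀), 0 ≤ p.1.1 → 0 ≤ p.1.2 →
        g p = conicPoint f₁ (fun t y' y'' => f₂ (t, y', y''))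
          (fun xt y' y'' => conePhase e P t h xt y' y'' p.1.2 p.2.2) p.1.1 p.2.1 (g p).1.2.2 p.1.2 ∧
        (coneQuad e P t (g p).1.2.2 p.2.2 + h p) + p.1.2 * fderiv ℝ h p ((0, 1), 0) = 0 ∧
        P (g p).1.2.2 + partialGradient (inclPhase l k) h p = 0 := by
  have hc : ContDiff ℝ ∞ fun p => ⟪(g p).2.2.2.2.2, e⟫_ℝ :=
    hg.smooth.snd.snd.snd.snd.snd.inner ℝ contDiff_const
  -- A globally smooth version of `1 / ⟪ω'', e⟫`, so that the rescaled direction is `D = c ω` and `r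
  -- = s c`.
  obtain ⟨c, hcs, hce⟩ := exists_contDiff_eventuallyEq
    (isOpen_lt continuous_const hc.continuous : IsOpen {p | 0 < ⟪(g p).2.2.2.2.2, e⟫_ℝ})
    (f := fun p => (⟪(g p).2.2.2.2.2, e⟫_ℝ)⁻¹)
    (hc.contDiffOn.inv fun p hp => ne_of_gt hp) hcoord.self_of_nhds.1
  have hps : ContDiff ℝ ∞ (fun p => phaseShift f₁ f₂ (g p)) :=
    (contDiff_phaseShift h.smooth_fst h.smooth_snd).comp hg.smooth
  have hpt : ∀ᶠ p in 𝓝 ((0 : ℝ × ℝ), z₀), 0 < c p ∧ (g p).1.1 = p.1.1 ∧ (g p).1.2.1 = p.2.1 ∧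
      (g p).2.2.1 = p.1.2 * c p ∧
      c p • (g p).2.2.2.2.2 = e + ι (p.2.2 + t • P (g p).1.2.2) := by
    filter_upwards [hcoord, hce] with p h1 h2
    rw [h2]
    exact ⟨inv_pos.2 h1.1, eq_of_conicCoord_eq hsplit h1.1 h1.2⟩
  obtain ⟨η, hη, hηp⟩ := exists_coneFun (e := e) hadj t (z₀ := z₀) hps hg.smooth.fst.snd.snd
    (hcs.smul hg.smooth.snd.snd.snd)
    ((hg.eventually_corner h).mono fun p hp a b => (hp a b).1)
    ((hg.eventually_front h).mono fun p hp a b => hp a.le b)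
    (hpt.mono fun p hp => hp.2.2.2.2) (by
      filter_upwards [hg.eventually_contact h, hpt.eventually_nhds] with p a1 a2 a0 u
      have e1 := a1 a0 u
      have e0 : HasFDerivAt (fun p : (ℝ × ℝ) × (EE l × EE k) => p) (ContinuousLinearMap.id ℝ _) p :=
        hasFDerivAt_id p
      have e2 : HasFDerivAt (fun p => (g p).1.2.1) _ p :=
        e0.snd.fst.congr_of_eventuallyEq (a2.mono fun p' hp' => hp'.2.2.1)
      rw [e2.fderiv, a2.self_of_nhds.2.2.2.1] at e1
      simp only [ContinuousLinearMap.comp_apply, ContinuousLinearMap.coe_fst',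
        ContinuousLinearMap.coe_snd', ContinuousLinearMap.id_apply] at e1
      simp only [Pi.smul_apply', Prod.smul_fst, Prod.smul_snd, smul_eq_mul, real_inner_smul_left]
      linear_combination e1)
  refine ⟨η, hη, ?_⟩
  filter_upwards [hηp, hpt, hg.mem_hat] with p a1 a2 a3 hx hs
  obtain ⟨b1, b2, b3, b4, b5⟩ := a1 ⟨hx, hs⟩
  obtain ⟨c1, c2, c3, c4, c5⟩ := a2
  refine ⟨?_, b3, b5⟩
  -- The identities for `h` say that `coneDir` of the phase is `c ω`. As `|ω| = 1` and `c > 0`, its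
  -- length is `c`; hence `s |D| = r` and `D / |D| = ω`.
  have hdir : coneDir (fun xt y' y'' => conePhase e P t η xt y' y'' p.1.2 p.2.2) p.1.1 p.2.1
      (g p).1.2.2 = c p • (g p).2.2.2 := by
    rw [coneDir_conePhase hadj hη]
    exact Prod.ext b2 (Prod.ext b4 c5.symm)
  rw [conicPoint, hdir, cnorm_smul c1.le, cnorm_eq_one_of_mem_hat (a3 hx hs), mul_one, smul_smul,
    inv_mul_cancel₀ c1.ne', one_smul, ← c4]
  refine Prod.ext (Prod.ext c2 (Prod.ext c3 rfl)) (Prod.ext ?_ rfl)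
  have hb : (g p).1 = (p.1.1, p.2.1, (g p).1.2.2) := Prod.ext c2 (Prod.ext c3 rfl)
  simp only [phaseShift] at b1
  rw [c2, c3, hb] at b1
  simp only [conePhase]
  linear_combination b1

/-- At `w₀ = -t P y''` the `y''`-derivative of the phase is `⟪e, ·⟫`, and those of the `∂ψ/∂w_j` are
the components of `P`. The vector `e` and the images under `ι` of the standard basis form a dual
family in the `y''`-directions. -/
theorem linearIndependent_conePhase {e : EE m} {P : EE m →L[ℝ] EE k} {ι : EE k →L[ℝ] EE m} {t : ℝ}
    {h : (ℝ × ℝ) × (EE l × EE k) → ℝ} (hs : ContDiff ℝ ∞ h) (hee : ⟪e, e⟫_ℝ = 1) (hP : P e = 0)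
    (hPι : ∀ w, P (ι w) = w) (hadj : ∀ y w, ⟪y, ι w⟫_ℝ = ⟪P y, w⟫_ℝ) (y' : EE l) (y'' : EE m)
    {w₀ : EE k} (hw₀ : w₀ = -(t • P y'')) :
    LinearIndependent ℝ (Fin.cons
      (fderiv ℝ (fun z : EE m × EE k => conePhase e P t h 0 y' z.1 0 z.2) (y'', w₀))
      (fun j : Fin k => fderiv ℝ
        (fun z : EE m × EE k => gradient (fun w => conePhase e P t h 0 y' z.1 0 w) z.2 j) (y'', w₀)) :
      Fin (k + 1) → (EE m × EE k →L[ℝ] ℝ)) := by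
  have hR : ContDiff ℝ ∞ (fun w => partialGradient (inclPhase l k) h (((0 : ℝ), (0 : ℝ)), (y', w))) :=
    (contDiff_partialGradient (inclPhase l k) hs).comp
      (by fun_prop : ContDiff ℝ ∞ fun w : EE k => (((0 : ℝ), (0 : ℝ)), (y', w)))
  have h0 : ∀ v, fderiv ℝ (fun z : EE m × EE k => conePhase e P t h 0 y' z.1 0 z.2) (y'', w₀)
      (v, 0) = ⟪e, v⟫_ℝ := fun v => by
    rw [fderiv_conePhase_apply hadj hs, hw₀, neg_add_cancel, map_zero, add_zero]
  have h1 : ∀ (j : Fin k) v, fderiv ℝ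
        (fun z : EE m × EE k => gradient (fun w => conePhase e P t h 0 y' z.1 0 w) z.2 j) (y'', w₀)
      (v, 0) = P v j := fun j v => by
    rw [funext fun z : EE m × EE k => congrArg (fun x : EE k => x j)
      (gradient_conePhase (e := e) (P := P) (t := t) hs 0 y' z.1 0 z.2)]
    exact fderiv_add_comp_apply P hR j (y'', w₀) v
  refine linearIndependent_of_dual
    (Fin.cons (e, 0) fun i => (ι (EuclideanSpace.single i 1), 0)) fun i j => ?_
  refine Fin.cases ?_ (fun i => ?_) i <;> refine Fin.cases ?_ (fun j => ?_) j
  · simp only [Fin.cons_zero, h0, hee, if_true]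
  · simp only [Fin.cons_zero, Fin.cons_succ, h1, hP, PiLp.zero_apply]
    rw [if_neg (Fin.succ_ne_zero j).symm]
  · simp only [Fin.cons_zero, Fin.cons_succ, h0]
    rw [hadj, hP, inner_zero_left, if_neg (Fin.succ_ne_zero i)]
  · simp only [Fin.cons_succ, h1, hPι, Fin.succ_inj, PiLp.single_apply, eq_comm]

/-- Near a point over the corner, the lift of a Legendre pair with conic points has a
non-degenerate parametrization. -/
theorem IsConicCorner.exists_isConicParametrization {Γ Γs : Set (CornerPt l m)} {Γ₁ : Set (ScPt l)}
    {W₁ : Set (EE l)} {W : Set (Corner l m)} {f₁ : EE l → ℝ} {f₂ : Corner l m → ℝ}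
    {q : CornerBl l m} (h : IsConicCorner Γ Γs Γ₁ W₁ W f₁ f₂ q) {T : Submodule ℝ (CornerBl l m)}
    (hT : IsSubmanifoldAt [xtFun l m (ℝ × ℝ × Corner l m), radius (Corner l m) (Corner l m)]
      (hat cnorm Γ Γs) q T) (hTd : Module.finrank ℝ T = l + m + 1) :
    ∃ (k : ℕ) (ψ : ℝ → EE l → EE m → ℝ → EE k → ℝ) (w₀ : EE k),
      IsConicParametrization Γ Γs q f₁ (fun t y' y'' => f₂ (t, y', y'')) ψ w₀ := by
  obtain ⟨hω₀, hω₁, hex⟩ := h.exists_coord hT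
  have he : ‖q.2.2.2.2.2‖ = 1 := norm_eq_one_of_cnorm_eq_one
    (cnorm_eq_one_of_mem_hat (Or.inr h.mem_lift)) hω₀ hω₁
  obtain ⟨k, P, ι, hm, hP, hPι, hsplit, hadj⟩ := exists_orthogonal_splitting he
  obtain ⟨t, ht⟩ := hex k P ι hsplit hadj
  obtain ⟨g, hg, hcoord, hgz⟩ := h.exists_conicChart hT hTd hm hP he ht
  obtain ⟨η, hη, hηp⟩ := hg.exists_conePhase h hsplit hadj hcoord
  have hee : ⟪q.2.2.2.2.2, q.2.2.2.2.2⟫_ℝ = 1 := by rw [real_inner_self_eq_norm_sq, he, one_pow]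
  set e := q.2.2.2.2.2 with hedef
  -- The value of the coordinate `w` at `q`, where `P ω'' = P e = 0`.
  set w₀ : EE k := -(t • P q.1.2.2) with hw₀
  obtain ⟨N, hN, hNo, hp₀N⟩ := eventually_nhds_iff.1 (hηp.and (hcoord.and hg.mem_hat))
  have hgrad : ∀ (p : (ℝ × ℝ) × (EE l × EE k)) (y'' : EE m),
      gradient (fun w => conePhase e P t η p.1.1 p.2.1 y'' p.1.2 w) p.2.2 =
        P y'' + partialGradient (inclPhase l k) η p := fun p y'' =>
    gradient_conePhase hη p.1.1 p.2.1 y'' p.1.2 p.2.2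
  have hder : ∀ (p : (ℝ × ℝ) × (EE l × EE k)) (y'' : EE m),
      deriv (fun s => conePhase e P t η p.1.1 p.2.1 y'' s p.2.2) p.1.2 =
        fderiv ℝ η p ((0, 1), 0) := fun p y'' => deriv_conePhase hη p.1.1 p.2.1 y'' p.1.2 p.2.2
  obtain ⟨n1, n2, n3⟩ := (hN _ hp₀N).1 le_rfl le_rfl
  rw [hg.point] at n1 n2 n3
  have hqW : ((0 : ℝ), q.1.2.1, q.1.2.2) ∈ W := by
    have : q.1 = ((0 : ℝ), q.1.2.1, q.1.2.2) := Prod.ext h.corner rfl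
    rw [← this]; exact h.mem_patch
  refine ⟨k, conePhase e P t η, w₀, W₁, W,
    (fun z : ℝ × EE l × EE m × ℝ × EE k => ((z.1, z.2.2.2.1), (z.2.1, z.2.2.2.2))) ⁻¹' N ∩
      (fun z : ℝ × EE l × EE m × ℝ × EE k => (z.1, z.2.1, z.2.2.1)) ⁻¹' W, hqW,
    (hNo.preimage (by fun_prop)).inter (h.graph.2.1.preimage (by fun_prop)), ⟨hp₀N, hqW⟩,
    fun z hz => hz.2, h.graph, (contDiff_conePhase hη).contDiffOn, n1, ?_, ?_, ?_, ?_⟩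
  · simp only [Prod.snd_zero, zero_mul, add_zero] at n2
    exact n2
  · exact (hgrad ((0, 0), (q.1.2.1, w₀)) q.1.2.2).trans n3
  · exact linearIndependent_conePhase hη hee hP hPι hadj q.1.2.1 q.1.2.2 rfl
  · have hΦc : ContinuousAt (conicCoord e P t) q := by
      have hV : IsOpen {z : CornerBl l m | 0 < ⟪z.2.2.2.2.2, e⟫_ℝ} := isOpen_lt continuous_const
        ((by fun_prop : Continuous fun z : CornerBl l m => z.2.2.2.2.2).inner continuous_const)
      refine (contDiffOn_conicCoord e P t).continuousOn.continuousAt (hV.mem_nhds ?_)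
      rw [Set.mem_ofPred_eq, ← hedef, hee]
      exact one_pos
    have hΦq : conicCoord e P t q = ((0 : ℝ × ℝ), (q.1.2.1, w₀)) := by
      have := hcoord.self_of_nhds.2
      rwa [hg.point] at this
    have hΦN : ∀ᶠ a in 𝓝 q, conicCoord e P t a ∈ N := by
      refine hΦc.eventually ?_
      rw [hΦq]
      exact hNo.mem_nhds hp₀N
    have hW : ∀ᶠ a in 𝓝 q, a.1 ∈ W :=
      continuousAt_fst.eventually (h.graph.2.1.mem_nhds h.mem_patch)
    have hc0 : ∀ᶠ a in 𝓝 q, 0 < ⟪a.2.2.2.2.2, e⟫_ℝ := by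
      refine ((by fun_prop : Continuous fun z : CornerBl l m => z.2.2.2.2.2).inner
        continuous_const).continuousAt.eventually (lt_mem_nhds ?_)
      exact one_pos.trans_eq hee.symm
    obtain ⟨O, hO, hOo, hqO⟩ := eventually_nhds_iff.1 (hgz.and (hΦN.and (hW.and hc0)))
    refine ⟨O, hOo, hqO, fun a ha => ⟨fun haΓ => ?_, ?_⟩⟩
    · obtain ⟨o1, o2, o3, o4⟩ := hO a ha
      obtain ⟨hx, hr, hga⟩ := o1 haΓ
      have hs : 0 ≤ (conicCoord e P t a).1.2 := mul_nonneg hr o4.le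
      obtain ⟨m1, m2, m3⟩ := (hN _ o2).1 hx hs
      rw [hga] at m1 m2 m3
      exact ⟨a.1.1, a.1.2.1, a.1.2.2, (conicCoord e P t a).1.2, (conicCoord e P t a).2.2,
        ⟨o2, o3⟩, hx, hs, (congrArg (fun x => _ + _ * x) (hder _ _)).trans m2,
        (hgrad (conicCoord e P t a) a.1.2.2).trans m3, m1⟩
    · rintro ⟨xt, y', y'', s, w, ⟨hU, -⟩, hx, hs, hv, hw, rfl⟩
      obtain ⟨m1, m2, m3⟩ := (hN _ hU).1 hx hs
      have f1 := (hgrad ((xt, s), (y', w)) y'').symm.trans hw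
      have f2 := (congrArg (fun x => conePhase e P t η xt y' y'' s w + s * x)
        (hder ((xt, s), (y', w)) y'')).symm.trans hv
      set Y := (g ((xt, s), (y', w))).1.2.2 with hY
      -- The equation `∂_w ψ = 0` fixes `P y''`; given this, `ψ + s ∂_s ψ = 0` fixes `⟪y'', e⟫`.
      -- Together they force `y'' = Y`, so the critical point is the one belonging to `g`.
      have f3 : P y'' = P Y := add_right_cancel (f1.trans m3.symm)
      simp only [conePhase, coneQuad, f3] at f2 m2
      have f4 : ⟪y'', e⟫_ℝ = ⟪Y, e⟫_ℝ := by linear_combination f2 - m2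
      have f5 : y'' = Y := by rw [← hsplit y'', ← hsplit Y, f3, f4]
      have f6 := (hN _ hU).2.2 hx hs
      rw [f5]
      rw [m1] at f6
      exact f6

end ConicParametrization

end FibredScattering

end

/-! ### Reduction of the two statements to adapted coordinates -/

theorem proposition3p3 {d : ℕ} {M : Type*} [TopologicalSpace M] [T2Space M]
    [SecondCountableTopology M] [ChartedSpace (CModel d) M] [IsManifold (CI d) ∞ M]
    (B : BoundaryFibration d M) (hB : B.IsFibred) :
    (∀ G : Set B.CotBundle, B.IsLegendre G →
      ∀ (i : B.Face) (e : OpenPartialHomeomorph M (CModel d))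
        (κ : OpenPartialHomeomorph (B.Z i) (EE (B.l i))), B.IsCornerChart i e κ →
      ∀ P ∈ G, P.1 ∈ B.face i → ∀ q : CornerPt (B.l i) (B.m i), B.HasCornerCoords i e P q →
        ∃ (k k' : ℕ) (φ₁ : EE (B.l i) → EE k → ℝ)
          (φ₂ : ℝ → EE (B.l i) → EE (B.m i) → EE k → EE k' → ℝ) (v₀ : EE k) (w₀ : EE k'),
          IsParametrization (B.cornerImage i e G) q φ₁ φ₂ v₀ w₀) ∧
    (∀ G Gs : Set B.CotBundle, B.IsLegendrePair G Gs →
      ∀ (i : B.Face) (e : OpenPartialHomeomorph M (CModel d))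
        (κ : OpenPartialHomeomorph (B.Z i) (EE (B.l i))), B.IsCornerChart i e κ →
      ∀ q ∈ liftBoundary cnorm (B.cornerImage i e G) (B.cornerImage i e Gs), q.1.1 = 0 →
        ∃ (k : ℕ) (φ₁ : EE (B.l i) → ℝ) (φ₂ : ℝ → EE (B.l i) → EE (B.m i) → ℝ)
          (ψ : ℝ → EE (B.l i) → EE (B.m i) → ℝ → EE k → ℝ) (w₀ : EE k),
          IsConicParametrization (B.cornerImage i e G) (B.cornerImage i e Gs) q φ₁ φ₂ ψ w₀) := by
  refine ⟨fun G hG i e κ hchart P hPG hPi q hq => ?_, fun G Gs hG i e κ hchart q hq hq0 => ?_⟩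
  · obtain ⟨G₁, hG₁, hfib⟩ := hG.2 i
    refine (hfib.1 e κ hchart).exists_isParametrization (hG.1.2.2 i e κ hchart)
      (hG₁ κ hchart.2.1) ⟨P, hPG, hq⟩ ?_
    rw [← hq.2.2.1]
    exact ((hchart.2.2.1 P.1 hq.1).1).1 hPi
  · obtain ⟨hL, -, -, hbase, hconic⟩ := hG
    obtain ⟨G₁, hG₁, hfib, hfibs, -⟩ := hbase i
    obtain ⟨hgraph, -, hT⟩ := hconic i e κ hchart
    obtain ⟨T, hT, hTd⟩ := hT q hq
    -- A point of the front face lies over `Γs`, whose coordinate image lies over the patch; so a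
    -- local graph representation of the section is available there.
    have hpatch : q.1 ∈ B.cornerPatch i e := by
      obtain ⟨ζ₀, P, -, hP⟩ := hq.2.2
      exact ⟨P.1, ⟨hP.1, hP.2.1⟩, hP.2.2.1⟩
    obtain ⟨W₁, W, f₁, f₂, hqW, hW⟩ := hgraph _ hpatch
    obtain ⟨W₁', W', f₁', f₂', h₁, h₂, hqW', hW'⟩ := hW.exists_contDiff hqW
    have hcc : IsConicCorner (B.cornerImage i e G) (B.cornerImage i e Gs) (B.baseImage i κ G₁)
        W₁' W' f₁' f₂' q :=
      ⟨hL.1.2.2 i e κ hchart, hfib.1 e κ hchart, hfibs.1 e κ hchart, hG₁ κ hchart.2.1, h₁, h₂, hW',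
        hq, hqW', hq0⟩
    obtain ⟨k, ψ, w₀, hψ⟩ := hcc.exists_isConicParametrization hT hTd
    exact ⟨k, f₁', _, ψ, w₀, hψ⟩
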